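/- **Setting.** Let $n_a,n_b,n_y,n_u,p,q\ge 0$ be integers and $n_x=n_an_y+(n_b+1)n_u$. Let $u_k\in\mathbb R^{n_u}$, $e_k,y_k\in\mathbb R^{n_y}$ ($k\in\mathbb Z$) be random signals, $f:\mathbb R^{n_x}\to\mathbb R^{n_y}$ measurable, and $$y_k=f(x_k)+e_k\quad(k\ge 0),\qquad x_k=\mathrm{vec}(y_{k-1},\dots,y_{k-n_a},u_k,\dots,u_{k-n_b}).$$ Here $(e_k)$ is white noise: independent, identically distributed, with zero mean and finite variance. The input together with the initial outputs $(y_{-1},\dots,y_{-n_a})$ is independent of $(e_k)_{k\ge0}$. Almost every realization of $u$ is a quasi-stationary signal, that is, $\lim_{N\to\infty}\frac1N\sum_{k=0}^{N-1}u_ku_{k-\tau}^\top$ exists for every integer $\tau\ge0$. $\mathbb E_e$ denotes expectation over the noise $(e_k)_{k\ge0}$ with the realizations of the input and of the outputs before time $0$ held fixed. **Stable system.** For every $\rho>0$ there are $C(\rho)\in[0,\infty)$ and $\lambda\in[0,1)$ such that, for almost every realization of $u$, all integers $k\ge k_o\ge0$ and all $x,\tilde x\in\mathbb R^{n_x}$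 with $\|x-\tilde x\|_2<\rho$, one has $\mathbb E_e\|y_k-\tilde y_k\|_2^4<C(\rho)\lambda^{k-k_o}$, where $y_k$ and $\tilde y_k$ are the outputs of the system driven by the same $u$ and $e$ and started at time $k_o$ with regressor $x$ and $\tilde x$, respectively. **Model.** Let $\phi:\mathbb R^{n_x}\to\mathbb R^{n_y\times p}$ and let $f^{\mathrm{ANN}}_{\theta_a}:\mathbb R^{n_x}\to\mathbb R^{n_y}$, $\theta_a\in\mathbb R^q$, be any function approximator. For data $x_0,\dots,x_{N-1}$ the prediction with $\theta=(\theta_b,\theta_a)\in\mathbb R^{p}\times\mathbb R^{q}$ is $$\hat y_k=\phi(x_k)\theta_b+f^{\mathrm{ANN}}_{\theta_a}(x_k)-\phi(x_k)\theta_{\mathrm{aux}},\qquad \theta_{\mathrm{aux}}=(\Phi^\top\Phi)^{-1}\Phi^\top F_{\theta_a},$$ where $\Phi$ and $F_{\theta_a}$ stack the values of $\phi$ and $f^{\mathrm{ANN}}_{\theta_a}$ at the regressor points used for the projection: the whole training set $x_0,\dots,x_{N-1}$, or any other finite collection of points chosen by a fixed rule from $N$ and the data, for instance a fixed synthetic set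 (the inverse is read as $0$ if $\Phi^\top\Phi$ is singular). Let $\Theta\subset\mathbb R^p\times\mathbb R^q$ be compact and $\breve\Theta\supseteq\Theta$ open. Assume that the predictions are given by one-step-ahead predictors that do not depend on $N$: for all $\theta\in\breve\Theta$, all data and all $0\le k<N$, $$\hat y_k=\gamma_k\bigl(\theta,\{y_i\}_{i=-n_a}^{k-1},\{u_i\}_{i=-n_b}^{k}\bigr),$$ and that $\gamma_k$ is differentiable in $\theta$ on $\breve\Theta$. **Stable predictor.** There are $C\in[0,\infty)$ and $\lambda\in[0,1)$ such that for all $k\ge0$, $\theta\in\breve\Theta$ and all data sequences $(u,y)$, $(\tilde u,\tilde y)$, the difference of the values of $\gamma_k$ at the two sequences has norm at most $C\sum_{i=-n}^{k}\lambda^{k-i}\bigl(\|u_i-\tilde u_i\|_2+\|y_i-\tilde y_i\|_2\bigr)$ with $n=\max(n_a,n_b)$; the same bound holds for $\partial\gamma_k/\partial\theta$; and $\|\gamma_k(\theta,0,0)\|_2\le C$. **Theorem (Convergence).** Let $V_{\mathcal D_N}(\theta)=\frac1N\sum_{k=0}^{N-1}\|y_k-\hat y_k\|_2^2$. Under these assumptions,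 with probability $1$, $$\sup_{\theta\in\Theta}\bigl|V_{\mathcal D_N}(\theta)-\mathbb E_eV_{\mathcal D_N}(\theta)\bigr|\to0\qquad(N\to\infty).$$ Moreover, if with probability $1$ the limit $\bar V(\theta)=\lim_{N\to\infty}\mathbb E_e V_{\mathcal D_N}(\theta)=\lim_{N\to\infty}\frac1N\mathbb E_e\|Y-\hat Y\|_2^2$ exists for every $\theta\in\Theta$ ($Y,\hat Y$ being the stacked $y_k,\hat y_k$, $0\le k<N$), then, with probability $1$, $$\sup_{\theta\in\Theta}\bigl|V_{\mathcal D_N}(\theta)-\bar V(\theta)\bigr|\to0\qquad(N\to\infty).$$ -/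

import Mathlib

open MeasureTheory ProbabilityTheory Filter Topology
open scoped Matrix

noncomputable section

namespace OrthAug

/-- The regressor space `ℝ^{n_x}`, `n_x = n_a n_y + (n_b + 1) n_u`, with the Euclidean norm:
`n_a` lagged outputs and the `n_b + 1` inputs `u_k, …, u_{k - n_b}`. -/
abbrev Regressor (na nb ny nu : ℕ) : Type :=
  EuclideanSpace ℝ ((Fin na × Fin ny) ⊕ (Fin (nb + 1) × Fin nu))

/-- The parameter space; a point is `(θ_b, θ_a)`. -/
abbrev Param (p q : ℕ) : Type := EuclideanSpace ℝ (Fin p) × EuclideanSpace ℝ (Fin q)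

/-- `x_k = vec(y_{k-1}, …, y_{k-n_a}, u_k, …, u_{k-n_b})`. -/
def regressor (na nb : ℕ) {ny nu : ℕ} (y : ℤ → EuclideanSpace ℝ (Fin ny))
    (u : ℤ → EuclideanSpace ℝ (Fin nu)) (k : ℤ) : Regressor na nb ny nu :=
  WithLp.toLp 2 (Sum.elim (fun ia => y (k - 1 - (ia.1.val : ℤ)) ia.2)
    (fun jb => u (k - (jb.1.val : ℤ)) jb.2))

/-- The update `x_k ↦ x_{k+1}` of the regressor: the output `y_k` and the input `u_{k+1}` are
shifted in, the oldest entries drop out. -/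
def nextRegressor {na nb ny nu : ℕ} (x : Regressor na nb ny nu)
    (y : EuclideanSpace ℝ (Fin ny)) (u : EuclideanSpace ℝ (Fin nu)) : Regressor na nb ny nu :=
  WithLp.toLp 2 (Sum.elim
    (fun ia => if ia.1.val = 0 then y ia.2
      else x (Sum.inl (⟨ia.1.val - 1, lt_of_le_of_lt (Nat.sub_le _ _) ia.1.isLt⟩, ia.2)))
    (fun jb => if jb.1.val = 0 then u jb.2
      else x (Sum.inr (⟨jb.1.val - 1, lt_of_le_of_lt (Nat.sub_le _ _) jb.1.isLt⟩, jb.2))))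

/-- The regressor at time `k₀ + m` of the system `y_k = f(x_k) + e_k` started with
`x_{k₀} = x₀` and driven by the signals `u`, `e`. -/
def stateFrom {na nb ny nu : ℕ} (f : Regressor na nb ny nu → EuclideanSpace ℝ (Fin ny))
    (u : ℤ → EuclideanSpace ℝ (Fin nu)) (e : ℤ → EuclideanSpace ℝ (Fin ny))
    (k₀ : ℕ) (x₀ : Regressor na nb ny nu) : ℕ → Regressor na nb ny nu
  | 0 => x₀
  | m + 1 =>
      nextRegressor (stateFrom f u e k₀ x₀ m)
        (f (stateFrom f u e k₀ x₀ m) + e ((k₀ : ℤ) + (m : ℤ))) (u ((k₀ : ℤ) + (m : ℤ) + 1))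

/-- The output at time `k₀ + m` of the system started with `x_{k₀} = x₀`. -/
def outputFrom {na nb ny nu : ℕ} (f : Regressor na nb ny nu → EuclideanSpace ℝ (Fin ny))
    (u : ℤ → EuclideanSpace ℝ (Fin nu)) (e : ℤ → EuclideanSpace ℝ (Fin ny))
    (k₀ : ℕ) (x₀ : Regressor na nb ny nu) (m : ℕ) : EuclideanSpace ℝ (Fin ny) :=
  f (stateFrom f u e k₀ x₀ m) + e ((k₀ : ℤ) + (m : ℤ))

/-- The output sequence that agrees with `y₀` at negative times and satisfies
`y_k = f(x_k) + e_k` for all `k ≥ 0`. -/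
def simulate {na nb ny nu : ℕ} (f : Regressor na nb ny nu → EuclideanSpace ℝ (Fin ny))
    (u : ℤ → EuclideanSpace ℝ (Fin nu)) (e : ℤ → EuclideanSpace ℝ (Fin ny))
    (y₀ : ℤ → EuclideanSpace ℝ (Fin ny)) (k : ℤ) : EuclideanSpace ℝ (Fin ny) :=
  if k < 0 then y₀ k else outputFrom f u e 0 (regressor na nb y₀ u 0) k.toNat

/-- White noise with finite variance: independent, identically distributed, zero mean,
square integrable. -/
structure IsWhiteNoise {Ω : Type*} [MeasurableSpace Ω] {ny : ℕ}
    (e : ℤ → Ω → EuclideanSpace ℝ (Fin ny)) (P : Measure Ω) : Prop where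
  measurable : ∀ k, Measurable (e k)
  indep : iIndepFun e P
  identDistrib : ∀ k, IdentDistrib (e k) (e 0) P P
  memLp : MemLp (e 0) 2 P
  mean_zero : ∫ ω, e 0 ω ∂P = 0

/-- Quasi-stationarity of a signal: for every lag the time-averaged correlation
`(1/N) ∑_{k<N} u_k u_{k-τ}ᵀ` converges (entrywise). A signal need not be bounded. -/
def IsQuasiStationary {nu : ℕ} (u : ℤ → EuclideanSpace ℝ (Fin nu)) : Prop :=
  ∀ τ : ℕ, ∃ R : Matrix (Fin nu) (Fin nu) ℝ, ∀ a b,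
    Tendsto (fun N : ℕ => (N : ℝ)⁻¹ * ∑ k ∈ Finset.range N, u (k : ℤ) a * u ((k : ℤ) - (τ : ℤ)) b)
      atTop (𝓝 (R a b))

/-- Stability of the data-generating system in the fourth-moment sense. The expectation is over
the noise only (the integration variable `ω'`); the input realization `u(ω)` is kept fixed. -/
def StableSystem {Ω : Type*} [MeasurableSpace Ω] {na nb ny nu : ℕ}
    (f : Regressor na nb ny nu → EuclideanSpace ℝ (Fin ny))
    (u : ℤ → Ω → EuclideanSpace ℝ (Fin nu)) (e : ℤ → Ω → EuclideanSpace ℝ (Fin ny))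
    (P : Measure Ω) : Prop :=
  ∀ ρ : ℝ, 0 < ρ → ∃ C lam : ℝ, 0 ≤ C ∧ 0 ≤ lam ∧ lam < 1 ∧
    ∀ᵐ ω ∂P, ∀ (k₀ : ℕ) (x₀ x₁ : Regressor na nb ny nu), ‖x₀ - x₁‖ < ρ → ∀ m : ℕ,
      ∫⁻ ω', ‖outputFrom f (fun i => u i ω) (fun i => e i ω') k₀ x₀ m
          - outputFrom f (fun i => u i ω) (fun i => e i ω') k₀ x₁ m‖ₑ ^ 4 ∂P
        < ENNReal.ofReal (C * lam ^ m)

/-- The stacked regressor matrix `Φ` of a finite list of regressor points. -/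
def stackedPhi {X : Type*} {ny p : ℕ} (φ : X → Matrix (Fin ny) (Fin p) ℝ) (S : List X) :
    Matrix (Fin S.length × Fin ny) (Fin p) ℝ :=
  fun ia j => φ (S.get ia.1) ia.2 j

/-- The stacked values `F` of a function on a finite list of regressor points. -/
def stackedF {X : Type*} {ny : ℕ} (g : X → EuclideanSpace ℝ (Fin ny)) (S : List X) :
    Fin S.length × Fin ny → ℝ :=
  fun ia => g (S.get ia.1) ia.2

/-- `θ_aux = (Φᵀ Φ)⁻¹ Φᵀ F`, evaluated on the points `S`. -/
def thetaAux {X : Type*} {ny p : ℕ} (φ : X → Matrix (Fin ny) (Fin p) ℝ)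
    (g : X → EuclideanSpace ℝ (Fin ny)) (S : List X) : Fin p → ℝ :=
  ((stackedPhi φ S)ᵀ * stackedPhi φ S)⁻¹ *ᵥ ((stackedPhi φ S)ᵀ *ᵥ stackedF g S)

/-- A rule that selects, for every `N` and every data record `(y, u)`, the regressor points on
which `θ_aux` is evaluated. -/
abbrev PointRule (na nb ny nu : ℕ) : Type :=
  ℕ → (ℤ → EuclideanSpace ℝ (Fin ny)) → (ℤ → EuclideanSpace ℝ (Fin nu)) →
    List (Regressor na nb ny nu)

/-- The default rule: the whole training set `x_0, …, x_{N-1}`. -/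
def trainingPoints (na nb ny nu : ℕ) : PointRule na nb ny nu :=
  fun N y u => (List.range N).map (fun k => regressor na nb y u (k : ℤ))

/-- The `k`-th block of `Ŷ = Φ θ_b + F_{θ_a} - Φ θ_aux`, that is
`φ(x_k) θ_b + f_{θ_a}(x_k) - φ(x_k) θ_aux`, for the data record `(y, u)` of length `N`. -/
def orthPrediction {na nb ny nu p q : ℕ}
    (φ : Regressor na nb ny nu → Matrix (Fin ny) (Fin p) ℝ)
    (fANN : EuclideanSpace ℝ (Fin q) → Regressor na nb ny nu → EuclideanSpace ℝ (Fin ny))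
    (S : PointRule na nb ny nu) (N : ℕ) (θ : Param p q)
    (y : ℤ → EuclideanSpace ℝ (Fin ny)) (u : ℤ → EuclideanSpace ℝ (Fin nu)) (k : ℕ) :
    EuclideanSpace ℝ (Fin ny) :=
  WithLp.toLp 2 (φ (regressor na nb y u (k : ℤ)) *ᵥ θ.1.ofLp)
    + fANN θ.2 (regressor na nb y u (k : ℤ))
    - WithLp.toLp 2 (φ (regressor na nb y u (k : ℤ)) *ᵥ thetaAux φ (fANN θ.2) (S N y u))

/-- The empirical cost `V_{D_N}(θ) = (1/N) ‖Y - Ŷ‖²`. -/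
def cost {na nb ny nu p q : ℕ}
    (φ : Regressor na nb ny nu → Matrix (Fin ny) (Fin p) ℝ)
    (fANN : EuclideanSpace ℝ (Fin q) → Regressor na nb ny nu → EuclideanSpace ℝ (Fin ny))
    (S : PointRule na nb ny nu) (N : ℕ) (θ : Param p q)
    (y : ℤ → EuclideanSpace ℝ (Fin ny)) (u : ℤ → EuclideanSpace ℝ (Fin nu)) : ℝ :=
  (N : ℝ)⁻¹ * ∑ k ∈ Finset.range N, ‖y (k : ℤ) - orthPrediction φ fANN S N θ y u k‖ ^ 2

/-- The expected cost `(1/N) E‖Y - Ŷ‖²`. The expectation is over the noise `e_0, e_1, …`; the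
realizations of the input and of the outputs before time `0` are kept fixed. -/
def expectedCost {Ω : Type*} [MeasurableSpace Ω] {na nb ny nu p q : ℕ}
    (f : Regressor na nb ny nu → EuclideanSpace ℝ (Fin ny))
    (φ : Regressor na nb ny nu → Matrix (Fin ny) (Fin p) ℝ)
    (fANN : EuclideanSpace ℝ (Fin q) → Regressor na nb ny nu → EuclideanSpace ℝ (Fin ny))
    (S : PointRule na nb ny nu)
    (e : ℤ → Ω → EuclideanSpace ℝ (Fin ny)) (P : Measure Ω)
    (N : ℕ) (θ : Param p q)
    (y₀ : ℤ → EuclideanSpace ℝ (Fin ny)) (u : ℤ → EuclideanSpace ℝ (Fin nu)) : ℝ :=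
  ∫ ω', cost φ fANN S N θ (simulate f u (fun i => e i ω') y₀) u ∂P

/-- A family of one-step-ahead predictors
`γ_k(θ, y_{-n_a}, …, y_{k-1}, u_{-n_b}, …, u_k)`, `k ≥ 0`. -/
abbrev OneStepPredictor (na nb ny nu p q : ℕ) : Type :=
  (k : ℕ) → Param p q → (Set.Icc (-(na : ℤ)) ((k : ℤ) - 1) → EuclideanSpace ℝ (Fin ny)) →
    (Set.Icc (-(nb : ℤ)) (k : ℤ) → EuclideanSpace ℝ (Fin nu)) → EuclideanSpace ℝ (Fin ny)

/-- `γ_k` evaluated on the past of a data record `(y, u)`. -/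
def OneStepPredictor.eval {na nb ny nu p q : ℕ} (γ : OneStepPredictor na nb ny nu p q) (k : ℕ)
    (y : ℤ → EuclideanSpace ℝ (Fin ny)) (u : ℤ → EuclideanSpace ℝ (Fin nu)) (θ : Param p q) :
    EuclideanSpace ℝ (Fin ny) :=
  γ k θ (fun i => y i) (fun i => u i)

/-- `Γ_k = ∑_{i=-n}^{k} λ^{k-i} (‖u_i - ũ_i‖ + ‖y_i - ỹ_i‖)`, `n = max(n_a, n_b)`. -/
def discountedDist (na nb : ℕ) {ny nu : ℕ} (lam : ℝ) (k : ℕ)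
    (y y' : ℤ → EuclideanSpace ℝ (Fin ny)) (u u' : ℤ → EuclideanSpace ℝ (Fin nu)) : ℝ :=
  ∑ i ∈ Finset.Icc (-((max na nb : ℕ) : ℤ)) (k : ℤ),
    lam ^ ((k : ℤ) - i).toNat * (‖u i - u' i‖ + ‖y i - y' i‖)

/-- Stability of the predictor on the parameter set `Θ'`, with stable parameter derivatives. -/
def StablePredictor {na nb ny nu p q : ℕ} (γ : OneStepPredictor na nb ny nu p q)
    (Θ' : Set (Param p q)) : Prop :=
  ∃ C lam : ℝ, 0 ≤ C ∧ 0 ≤ lam ∧ lam < 1 ∧ ∀ k : ℕ, ∀ θ ∈ Θ',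
    (∀ (y y' : ℤ → EuclideanSpace ℝ (Fin ny)) (u u' : ℤ → EuclideanSpace ℝ (Fin nu)),
      ‖γ.eval k y u θ - γ.eval k y' u' θ‖ ≤ C * discountedDist na nb lam k y y' u u') ∧
    ‖γ.eval k 0 0 θ‖ ≤ C ∧
    (∀ (y y' : ℤ → EuclideanSpace ℝ (Fin ny)) (u u' : ℤ → EuclideanSpace ℝ (Fin nu)),
      ‖fderiv ℝ (γ.eval k y u) θ - fderiv ℝ (γ.eval k y' u') θ‖
        ≤ C * discountedDist na nb lam k y y' u u')

end OrthAug

end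

set_option linter.unusedSectionVars false

/-! The costs are averages of squared prediction errors. The noise has only a second moment, so
these squares need not have a variance and a direct Chebyshev argument fails. The substitute is
forgetting: with the input held fixed, the prediction error at time k is a functional Φ_k(e_0, e_1,
…) for which resampling e_j changes the value by O(λ^{k-j}(1 + ‖e_j‖)) in mean square
(`IsForgetting`). For the outputs this comes from system stability, first chained along segments to
arbitrary pairs of initial regressors (`exists_meanSquareStable`); the discounted Lipschitz bound
carries it over to the predictions (`exists_isForgetting_predictionError`).

The strong law for such functionals (`IsForgetting.strong_law`) expands ‖Φ_k‖² - E‖Φ_k‖² into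
martingale increments along the noise filtration. Collecting the increments of ∑_{k<N} ‖Φ_k‖² by
noise time j gives a triangular array dominated by ξ_j(ξ_j + H_{N,j}), where ξ_j = 1 + ‖e_j‖ is
independent of the past and H_{N,j} is predictable. As in the classical i.i.d. law, take N = ⌊c^n⌋
and truncate at ξ_j² ≤ c^n (`IsAmplitude.tendsto_array`). The variances are summable because ∑_n
c^{-n} E[ξ⁴; ξ² ≤ c^n] is at most a multiple of E ξ²; the truncation is eventually inactive because
ξ_j² = o(j); the compensators are controlled by the tails E[ξ²; ξ² > c^n]. Monotonicity fills the
gaps between the indices ⌊c^n⌋ as c tends to 1. This needs bounds on E‖Φ_k‖² with convergent Cesàro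
means, which quasi-stationarity supplies.

Since the noise is independent of the input and the initial outputs, Fubini turns the law for a
fixed input into an almost sure statement about the observed record. For uniformity in θ, almost
surely the costs and their expectations are equicontinuous uniformly in N, so a countable dense set
of parameters and compactness suffice. The derivative bound only controls differences from the zero
record; on that record every regressor vanishes, so the prediction does not depend on k and its
continuity at k = 0 is enough. A pointwise limit of the expected costs inherits the modulus of
continuity, which gives the second assertion. -/

namespace OrthAug

/-! ### Exponential filters: sums, Cauchy–Schwarz bounds and Cesàro means. -/

section GeometricFilter

/-- The exponentially weighted sum `∑_{i ≤ k} λ^{k-i} a_i`. -/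
noncomputable def geomFilter (lam : ℝ) (a : ℕ → ℝ) (k : ℕ) : ℝ :=
  ∑ i ∈ Finset.range (k + 1), lam ^ (k - i) * a i

theorem geomFilter_zero (lam : ℝ) (a : ℕ → ℝ) : geomFilter lam a 0 = a 0 := by
  simp [geomFilter]

theorem geomFilter_succ (lam : ℝ) (a : ℕ → ℝ) (k : ℕ) :
    geomFilter lam a (k + 1) = lam * geomFilter lam a k + a (k + 1) := by
  rw [geomFilter, Finset.sum_range_succ, geomFilter, Finset.mul_sum]
  congr 1
  · refine Finset.sum_congr rfl fun i hi => ?_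
    have : k + 1 - i = (k - i) + 1 := by have := Finset.mem_range.1 hi; omega
    rw [this, pow_succ]; ring
  · simp

theorem geomFilter_nonneg {lam : ℝ} (h0 : 0 ≤ lam) {a : ℕ → ℝ} (ha : ∀ i, 0 ≤ a i) (k : ℕ) :
    0 ≤ geomFilter lam a k :=
  Finset.sum_nonneg fun i _ => mul_nonneg (pow_nonneg h0 _) (ha i)

theorem le_geomFilter {lam : ℝ} (h0 : 0 ≤ lam) {a : ℕ → ℝ} (ha : ∀ i, 0 ≤ a i) (k : ℕ) :
    a k ≤ geomFilter lam a k := by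
  cases k with
  | zero => rw [geomFilter_zero]
  | succ k =>
    rw [geomFilter_succ]
    have := mul_nonneg h0 (geomFilter_nonneg h0 ha k)
    linarith

theorem geomFilter_mono {lam : ℝ} (h0 : 0 ≤ lam) {a b : ℕ → ℝ} (hab : ∀ i, a i ≤ b i) (k : ℕ) :
    geomFilter lam a k ≤ geomFilter lam b k :=
  Finset.sum_le_sum fun i _ => mul_le_mul_of_nonneg_left (hab i) (pow_nonneg h0 _)

theorem geomFilter_mono_base {lam mu : ℝ} (h0 : 0 ≤ lam) (hlm : lam ≤ mu) {a : ℕ → ℝ}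
    (ha : ∀ i, 0 ≤ a i) (k : ℕ) : geomFilter lam a k ≤ geomFilter mu a k :=
  Finset.sum_le_sum fun i _ => mul_le_mul_of_nonneg_right (pow_le_pow_left₀ h0 hlm _) (ha i)

theorem geomFilter_add (lam : ℝ) (a b : ℕ → ℝ) (k : ℕ) :
    geomFilter lam (fun i => a i + b i) k = geomFilter lam a k + geomFilter lam b k := by
  simp [geomFilter, mul_add, Finset.sum_add_distrib]

theorem geomFilter_const_mul (lam c : ℝ) (a : ℕ → ℝ) (k : ℕ) :
    geomFilter lam (fun i => c * a i) k = c * geomFilter lam a k := by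
  simp only [geomFilter, Finset.mul_sum]
  exact Finset.sum_congr rfl fun i _ => by ring

theorem sum_range_pow_le {lam : ℝ} (h0 : 0 ≤ lam) (h1 : lam < 1) (n : ℕ) :
    ∑ i ∈ Finset.range n, lam ^ i ≤ (1 - lam)⁻¹ := by
  rw [← tsum_geometric_of_lt_one h0 h1]
  exact (summable_geometric_of_lt_one h0 h1).sum_le_tsum _ fun i _ => pow_nonneg h0 i

theorem geomFilter_one_le {lam : ℝ} (h0 : 0 ≤ lam) (h1 : lam < 1) (k : ℕ) :
    geomFilter lam (fun _ => 1) k ≤ (1 - lam)⁻¹ := by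
  have : geomFilter lam (fun _ => 1) k = ∑ i ∈ Finset.range (k + 1), lam ^ i := by
    rw [geomFilter, ← Finset.sum_range_reflect (fun i => lam ^ i)]
    exact Finset.sum_congr rfl fun i hi => by simp
  rw [this]
  exact sum_range_pow_le h0 h1 _

/-- Two nested exponential filters with different rates. -/
theorem geomFilter_pow_le {a b : ℝ} (ha : 0 ≤ a) (hab : a < b) (k : ℕ) :
    geomFilter a (fun i => b ^ i) k ≤ b / (b - a) * b ^ k := by
  have hb : 0 < b := ha.trans_lt hab
  have hba : 0 < b - a := sub_pos.2 hab
  induction k with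
  | zero =>
    rw [geomFilter_zero, pow_zero, mul_one, le_div_iff₀ hba]; linarith
  | succ k ih =>
    rw [geomFilter_succ]
    calc a * geomFilter a (fun i => b ^ i) k + b ^ (k + 1)
        ≤ a * (b / (b - a) * b ^ k) + b ^ (k + 1) := by gcongr
      _ = b / (b - a) * b ^ (k + 1) := by field_simp; ring

/-- Cauchy–Schwarz for weighted sums. -/
theorem sq_weighted_sum_le {ι : Type*} (s : Finset ι) {w a : ι → ℝ} (hw : ∀ i ∈ s, 0 ≤ w i) :
    (∑ i ∈ s, w i * a i) ^ 2 ≤ (∑ i ∈ s, w i) * ∑ i ∈ s, w i * a i ^ 2 :=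
  Finset.sum_sq_le_sum_mul_sum_of_sq_le_mul s hw
    (fun i hi => mul_nonneg (hw i hi) (sq_nonneg _)) fun i _ => le_of_eq (by ring)

theorem sq_geomFilter_le {lam : ℝ} (h0 : 0 ≤ lam) (h1 : lam < 1) (a : ℕ → ℝ) (k : ℕ) :
    geomFilter lam a k ^ 2 ≤ (1 - lam)⁻¹ * geomFilter lam (fun i => a i ^ 2) k := by
  refine (sq_weighted_sum_le _ fun i _ => pow_nonneg h0 _).trans ?_
  refine mul_le_mul_of_nonneg_right ?_ (geomFilter_nonneg h0 (fun i => sq_nonneg (a i)) k)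
  simpa [geomFilter] using geomFilter_one_le h0 h1 k

/-- Summation along the diagonals k - i = m. In this form a Cesàro mean of the filtered sequence is
a geometric mixture of delayed Cesàro means of `a`, which suits dominated convergence. -/
theorem sum_geomFilter_eq (lam : ℝ) (a : ℕ → ℝ) (N : ℕ) :
    ∑ k ∈ Finset.range N, geomFilter lam a k
      = ∑ m ∈ Finset.range N, lam ^ m * ∑ i ∈ Finset.range (N - m), a i := by
  have key : ∀ N, ∑ k ∈ Finset.range (N + 1), geomFilter lam a k
      = lam * ∑ k ∈ Finset.range N, geomFilter lam a k + ∑ i ∈ Finset.range (N + 1), a i := by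
    intro N
    rw [Finset.sum_range_succ', Finset.sum_range_succ' a, geomFilter_zero]
    rw [Finset.sum_congr rfl fun k _ => geomFilter_succ lam a k,
      Finset.sum_add_distrib, Finset.mul_sum]
    ring
  induction N with
  | zero => simp
  | succ N ih =>
    conv_rhs => rw [Finset.sum_range_succ']
    rw [key, ih, Finset.mul_sum]
    simp only [pow_zero, one_mul, Nat.sub_zero, Nat.add_sub_add_right]
    exact congrArg (· + _) (Finset.sum_congr rfl fun m _ => by ring)

theorem sum_geomFilter_le {lam : ℝ} (h0 : 0 ≤ lam) (h1 : lam < 1) {a : ℕ → ℝ}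
    (ha : ∀ i, 0 ≤ a i) (N : ℕ) :
    ∑ k ∈ Finset.range N, geomFilter lam a k ≤ (1 - lam)⁻¹ * ∑ i ∈ Finset.range N, a i := by
  rw [sum_geomFilter_eq]
  calc _ ≤ ∑ m ∈ Finset.range N, lam ^ m * ∑ i ∈ Finset.range N, a i := by
        refine Finset.sum_le_sum fun m _ => mul_le_mul_of_nonneg_left ?_ (pow_nonneg h0 _)
        exact Finset.sum_le_sum_of_subset_of_nonneg
          (Finset.range_mono (Nat.sub_le _ _)) fun i _ _ => ha i
    _ ≤ _ := by
        rw [← Finset.sum_mul]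
        exact mul_le_mul_of_nonneg_right (sum_range_pow_le h0 h1 N)
          (Finset.sum_nonneg fun i _ => ha i)

/-- The anticausal version of `sum_geomFilter_le`. -/
theorem sum_anticausal_le {lam : ℝ} (h0 : 0 ≤ lam) (h1 : lam < 1) {a : ℕ → ℝ}
    (ha : ∀ i, 0 ≤ a i) (N : ℕ) :
    ∑ j ∈ Finset.range N, ∑ k ∈ Finset.Ico j N, lam ^ (k - j) * a k
      ≤ (1 - lam)⁻¹ * ∑ k ∈ Finset.range N, a k := by
  have hswap : ∑ j ∈ Finset.range N, ∑ k ∈ Finset.Ico j N, lam ^ (k - j) * a k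
      = ∑ k ∈ Finset.range N, ∑ j ∈ Finset.range (k + 1), lam ^ (k - j) * a k :=
    Finset.sum_comm' fun j k => by simp only [Finset.mem_range, Finset.mem_Ico]; omega
  rw [hswap, Finset.mul_sum]
  refine Finset.sum_le_sum fun k _ => ?_
  rw [← Finset.sum_mul]
  refine mul_le_mul_of_nonneg_right ?_ (ha k)
  simpa [geomFilter] using geomFilter_one_le h0 h1 k

/-- An exponential filter preserves convergence of Cesàro means. -/
theorem tendsto_cesaro_geomFilter {lam : ℝ} (h0 : 0 ≤ lam) (h1 : lam < 1) {a : ℕ → ℝ} {l : ℝ}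
    (h : Tendsto (fun N : ℕ => (N : ℝ)⁻¹ * ∑ k ∈ Finset.range N, a k) atTop (𝓝 l)) :
    ∃ l', Tendsto (fun N : ℕ => (N : ℝ)⁻¹ * ∑ k ∈ Finset.range N, geomFilter lam a k)
      atTop (𝓝 l') := by
  obtain ⟨K, hK⟩ : ∃ K, ∀ N : ℕ, |(N : ℝ)⁻¹ * ∑ k ∈ Finset.range N, a k| ≤ K := by
    obtain ⟨K, hK⟩ := (Metric.isBounded_range_of_tendsto _ h).exists_norm_le
    exact ⟨K, fun N => hK _ ⟨N, rfl⟩⟩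
  set A : ℕ → ℝ := fun N => ∑ k ∈ Finset.range N, a k with hA
  -- The finite sum extends to a series over all m because truncated subtraction gives `A (N - m) =
  -- A 0 = 0` once m ≥ N.
  have hrw : ∀ N : ℕ, (N : ℝ)⁻¹ * ∑ k ∈ Finset.range N, geomFilter lam a k
      = ∑' m, lam ^ m * ((N : ℝ)⁻¹ * A (N - m)) := by
    intro N
    rw [sum_geomFilter_eq, tsum_eq_sum (s := Finset.range N), Finset.mul_sum]
    · exact Finset.sum_congr rfl fun m _ => by simp only [hA]; ring
    · intro m hm
      have : N - m = 0 := by simp at hm; omega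
      simp [this, hA]
  simp_rw [hrw]
  refine ⟨∑' m, lam ^ m * l, ?_⟩
  refine tendsto_tsum_of_dominated_convergence (bound := fun m => lam ^ m * K)
    ((summable_geometric_of_lt_one h0 h1).mul_right K) (fun m => ?_) (Eventually.of_forall ?_)
  · refine Tendsto.const_mul _ ?_
    have hs : Tendsto (fun N : ℕ => ((N : ℝ)⁻¹ * A N)) atTop (𝓝 l) := h
    have hs' := hs.comp (tendsto_sub_atTop_nat m)
    have hr : Tendsto (fun N : ℕ => ((N - m : ℕ) : ℝ) / N) atTop (𝓝 1) := by
      have h3 : Tendsto (fun N : ℕ => 1 - (m : ℝ) * (N : ℝ)⁻¹) atTop (𝓝 (1 - (m : ℝ) * 0)) :=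
        tendsto_const_nhds.sub (tendsto_inv_atTop_nhds_zero_nat.const_mul _)
      simp only [mul_zero, sub_zero] at h3
      refine h3.congr' ?_
      filter_upwards [eventually_ge_atTop (m + 1)] with N hN
      have : (N : ℝ) ≠ 0 := Nat.cast_ne_zero.2 (by omega)
      rw [Nat.cast_sub (by omega)]; field_simp
    have := hr.mul hs'
    rw [one_mul] at this
    refine this.congr' ?_
    filter_upwards [eventually_ge_atTop (m + 1)] with N hN
    have : ((N - m : ℕ) : ℝ) ≠ 0 := by
      have : 0 < N - m := by omega
      positivity
    simp only [Function.comp]; field_simp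
  · intro N m
    rw [norm_mul, Real.norm_of_nonneg (pow_nonneg h0 m)]
    refine mul_le_mul_of_nonneg_left ?_ (pow_nonneg h0 m)
    have h2 := hK (N - m)
    rw [abs_mul] at h2
    rw [Real.norm_eq_abs, abs_mul]
    -- Domination by K: the delayed sum is divided by N, which is at least N - m, so it is no larger
    -- than the genuine Cesàro mean at N - m; the case N - m = 0 is separate because the comparison
    -- of inverses needs a positive denominator.
    by_cases hm : N - m = 0
    · simp only [hm, hA, Finset.range_zero, Finset.sum_empty, abs_zero, mul_zero]
      exact (abs_nonneg _).trans (hK 0)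
    · refine le_trans (mul_le_mul_of_nonneg_right ?_ (abs_nonneg _)) h2
      rw [abs_of_nonneg (by positivity), abs_of_nonneg (by positivity)]
      have : (0:ℝ) < ((N - m : ℕ) : ℝ) := by exact_mod_cast Nat.pos_of_ne_zero hm
      exact inv_anti₀ this (by exact_mod_cast Nat.sub_le _ _)

end GeometricFilter

/-! ### Compensated sums, and truncation of i.i.d. noise amplitudes. -/

section MartingaleArrays

variable {Ω : Type*} {mΩ : MeasurableSpace Ω} {P : Measure Ω} [IsProbabilityMeasure P]

theorem integral_sq_sub_condExp_le {m : MeasurableSpace Ω} (hm : m ≤ mΩ) {X : Ω → ℝ}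
    (hX : MemLp X 2 P) : ∫ ω, (X ω - (P[X | m]) ω) ^ 2 ∂P ≤ ∫ ω, X ω ^ 2 ∂P := by
  have h1 := condVar_ae_le_condExp_sq hm hX
  have h2 : ∫ ω, (Var[X; P | m]) ω ∂P = ∫ ω, (X ω - (P[X | m]) ω) ^ 2 ∂P := by
    rw [condVar, integral_condExp hm]; rfl
  have h3 : ∫ ω, (P[X ^ 2 | m]) ω ∂P = ∫ ω, X ω ^ 2 ∂P := by
    rw [integral_condExp hm]; rfl
  rw [← h2, ← h3]
  exact integral_mono_ae integrable_condExp integrable_condExp h1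

/-- Orthogonality of compensated increments. -/
theorem integral_sq_sum_sub_condExp_le (𝓕 : Filtration ℕ mΩ) {X : ℕ → Ω → ℝ}
    (hX : ∀ j, StronglyMeasurable[𝓕 (j + 1)] (X j)) (hL : ∀ j, MemLp (X j) 2 P) (N : ℕ) :
    MemLp (fun ω => ∑ j ∈ Finset.range N, (X j ω - (P[X j | 𝓕 j]) ω)) 2 P ∧
    ∫ ω, (∑ j ∈ Finset.range N, (X j ω - (P[X j | 𝓕 j]) ω)) ^ 2 ∂P
      ≤ ∑ j ∈ Finset.range N, ∫ ω, X j ω ^ 2 ∂P := by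
  have hD : ∀ j, MemLp (fun ω => X j ω - (P[X j | 𝓕 j]) ω) 2 P := fun j =>
    (hL j).sub ((hL j).condExp one_le_two)
  have hS : ∀ n, MemLp (fun ω => ∑ j ∈ Finset.range n, (X j ω - (P[X j | 𝓕 j]) ω)) 2 P :=
    fun n => memLp_finsetSum _ fun j _ => hD j
  refine ⟨hS N, ?_⟩
  induction N with
  | zero => simp
  | succ n ih =>
    set S : Ω → ℝ := fun ω => ∑ j ∈ Finset.range n, (X j ω - (P[X j | 𝓕 j]) ω) with hSdef
    set D : Ω → ℝ := fun ω => X n ω - (P[X n | 𝓕 n]) ω with hDdef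
    have hSm : StronglyMeasurable[𝓕 n] S := by
      refine Finset.stronglyMeasurable_fun_sum _ fun j hj => ?_
      have hj' : j + 1 ≤ n := Finset.mem_range.1 hj
      exact ((hX j).mono (𝓕.mono hj')).sub
        (stronglyMeasurable_condExp.mono (𝓕.mono (by omega)))
    have hSD : Integrable (S * D) P := (hS n).integrable_mul (hD n)
    have hDint : Integrable D P := (hD n).integrable one_le_two
    have hD0 : P[D | 𝓕 n] =ᵐ[P] 0 := by
      have e1 := condExp_sub (m := 𝓕 n) ((hL n).integrable one_le_two)
        (integrable_condExp (m := 𝓕 n) (μ := P) (f := X n))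
      have e2 : P[P[X n | 𝓕 n] | 𝓕 n] = P[X n | 𝓕 n] :=
        condExp_of_stronglyMeasurable (𝓕.le n) stronglyMeasurable_condExp integrable_condExp
      rw [e2, sub_self] at e1
      exact e1
    -- `S` is known at time n and pulls out of the conditional expectation, while `D` has
    -- conditional mean zero.
    have hcross : ∫ ω, (S * D) ω ∂P = 0 := by
      rw [← integral_condExp (𝓕.le n)]
      have e := condExp_mul_of_stronglyMeasurable_left hSm hSD hDint
      rw [integral_congr_ae e]
      have : S * P[D | 𝓕 n] =ᵐ[P] 0 := by
        filter_upwards [hD0] with ω hω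
        simp [hω]
      rw [integral_congr_ae this]; simp
    have hS2 := (hS n).integrable_sq
    have hD2 := (hD n).integrable_sq
    have hexp : ∀ ω, (∑ j ∈ Finset.range (n + 1), (X j ω - (P[X j | 𝓕 j]) ω)) ^ 2
        = S ω ^ 2 + 2 * (S * D) ω + D ω ^ 2 := by
      intro ω
      rw [Finset.sum_range_succ]
      simp only [Pi.mul_apply, hSdef, hDdef]; ring
    simp_rw [hexp]
    have hi2 : Integrable (fun ω => 2 * (S * D) ω) P := hSD.const_mul 2
    have hi1 : Integrable (fun ω => S ω ^ 2 + 2 * (S * D) ω) P := hS2.add hi2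
    rw [integral_add hi1 hD2, integral_add hS2 hi2, integral_const_mul, hcross, mul_zero, add_zero, Finset.sum_range_succ]
    exact add_le_add ih (integral_sq_sub_condExp_le (𝓕.le n) (hL n))

/-- If the second moments are summable the sequence tends to zero almost surely. -/
theorem ae_tendsto_zero_of_summable_integral_sq {Z : ℕ → Ω → ℝ} (hZ : ∀ n, MemLp (Z n) 2 P)
    (hs : Summable fun n => ∫ ω, Z n ω ^ 2 ∂P) :
    ∀ᵐ ω ∂P, Tendsto (fun n => Z n ω) atTop (𝓝 0) := by
  have hm : ∀ n, AEMeasurable (fun ω => ENNReal.ofReal (Z n ω ^ 2)) P := fun n =>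
    ((hZ n).aestronglyMeasurable.aemeasurable.pow_const 2).ennreal_ofReal
  have h1 : ∫⁻ ω, ∑' n, ENNReal.ofReal (Z n ω ^ 2) ∂P ≠ ⊤ := by
    rw [lintegral_tsum hm]
    have : ∀ n, ∫⁻ ω, ENNReal.ofReal (Z n ω ^ 2) ∂P = ENNReal.ofReal (∫ ω, Z n ω ^ 2 ∂P) :=
      fun n => (ofReal_integral_eq_lintegral_ofReal (hZ n).integrable_sq
        (Eventually.of_forall fun ω => sq_nonneg _)).symm
    simp_rw [this]
    exact hs.tsum_ofReal_ne_top
  have h2 := ae_lt_top' (AEMeasurable.tsum hm) h1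
  filter_upwards [h2] with ω hω
  have h3 := ENNReal.tendsto_atTop_zero_of_tsum_ne_top hω.ne
  have h4 : Tendsto (fun n => Z n ω ^ 2) atTop (𝓝 0) := by
    have := (ENNReal.tendsto_toReal ENNReal.zero_ne_top).comp h3
    simpa [Function.comp_def, ENNReal.toReal_ofReal (sq_nonneg _)] using this
  have h5 := h4.sqrt
  simp only [Real.sqrt_sq_eq_abs, Real.sqrt_zero] at h5
  exact (tendsto_zero_iff_abs_tendsto_zero _).2 h5

/-- The pointwise estimate behind the summability of truncated fourth moments. -/
theorem sum_truncated_le {c : ℝ} (hc : 1 < c) {t : ℝ} (ht : 0 < t) (L : ℕ) :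
    ∑ n ∈ Finset.range L, (c ^ n)⁻¹ * (if t ≤ c ^ n then t ^ 2 else 0) ≤ (1 - c⁻¹)⁻¹ * t := by
  have hc0 : 0 < c := one_pos.trans hc
  have hex : ∃ n : ℕ, t ≤ c ^ n := (pow_unbounded_of_one_lt t hc).imp fun n h => h.le
  -- The summand vanishes before the first n with t ≤ c^n. From there the series is geometric with
  -- leading term c^{-n0} t² ≤ t.
  set n0 := Nat.find hex with hn0
  have hspec : t ≤ c ^ n0 := Nat.find_spec hex
  have hi0 : 0 ≤ c⁻¹ := inv_nonneg.2 hc0.le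
  have hi1 : c⁻¹ < 1 := inv_lt_one_of_one_lt₀ hc
  calc ∑ n ∈ Finset.range L, (c ^ n)⁻¹ * (if t ≤ c ^ n then t ^ 2 else 0)
      ≤ ∑ n ∈ Finset.Ico n0 L, (c ^ n)⁻¹ * t ^ 2 := by
        rw [← Finset.sum_filter_add_sum_filter_not (Finset.range L) (fun n => n0 ≤ n)]
        have hz : ∑ n ∈ Finset.range L with ¬ n0 ≤ n,
            (c ^ n)⁻¹ * (if t ≤ c ^ n then t ^ 2 else 0) = 0 := by
          refine Finset.sum_eq_zero fun n hn => ?_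
          rw [if_neg (Nat.find_min hex (not_le.1 (Finset.mem_filter.1 hn).2)), mul_zero]
        rw [hz, add_zero]
        have hset : (Finset.range L).filter (fun n => n0 ≤ n) = Finset.Ico n0 L := by
          ext n; simp [and_comm]
        rw [hset]
        refine Finset.sum_le_sum fun n _ => mul_le_mul_of_nonneg_left ?_ (by positivity)
        split_ifs
        · exact le_rfl
        · positivity
    _ = (c⁻¹ ^ n0 * t ^ 2) * ∑ k ∈ Finset.range (L - n0), c⁻¹ ^ k := by
        rw [Finset.sum_Ico_eq_sum_range, Finset.mul_sum]
        refine Finset.sum_congr rfl fun k _ => ?_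
        rw [← inv_pow, pow_add]; ring
    _ ≤ t * (1 - c⁻¹)⁻¹ := by
        refine mul_le_mul ?_ (sum_range_pow_le hi0 hi1 _)
          (Finset.sum_nonneg fun k _ => pow_nonneg hi0 k) ht.le
        have : c⁻¹ ^ n0 * t ≤ 1 := by
          rw [inv_pow, inv_mul_le_iff₀ (by positivity), mul_one]; exact hspec
        nlinarith
    _ = _ := mul_comm _ _

/-- The assumptions on the scalar noise amplitudes: adapted with one step delay, independent of
the past, identically distributed, bounded below by one, square integrable. -/
structure IsAmplitude (ξ : ℕ → Ω → ℝ) (𝓕 : Filtration ℕ mΩ) (P : Measure Ω) : Prop where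
  meas : ∀ j, StronglyMeasurable[𝓕 (j + 1)] (ξ j)
  indep : ∀ j, Indep (MeasurableSpace.comap (ξ j) inferInstance) (𝓕 j) P
  ident : ∀ j, IdentDistrib (ξ j) (ξ 0) P P
  one_le : ∀ j ω, 1 ≤ ξ j ω
  memLp : MemLp (ξ 0) 2 P

namespace IsAmplitude

variable {ξ : ℕ → Ω → ℝ} {𝓕 : Filtration ℕ mΩ}

theorem memLp' (h : IsAmplitude ξ 𝓕 P) (j : ℕ) : MemLp (ξ j) 2 P :=
  (h.ident j).memLp_iff.2 h.memLp

theorem measurable (h : IsAmplitude ξ 𝓕 P) (j : ℕ) : Measurable (ξ j) :=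
  ((h.meas j).mono (𝓕.le _)).measurable

theorem indepFun (h : IsAmplitude ξ 𝓕 P) {j : ℕ} {H : Ω → ℝ} (hH : StronglyMeasurable[𝓕 j] H) :
    IndepFun (ξ j) H P := by
  rw [IndepFun_iff_Indep]
  exact indep_of_indep_of_le_right (h.indep j) hH.measurable.comap_le

theorem condExp_comp (h : IsAmplitude ξ 𝓕 P) (j : ℕ) {g : ℝ → ℝ} (hg : Measurable g) :
    P[fun ω => g (ξ j ω) | 𝓕 j] =ᵐ[P] fun _ => ∫ ω, g (ξ 0 ω) ∂P := by
  have hm : MeasurableSpace.comap (ξ j) inferInstance ≤ mΩ := (h.measurable j).comap_le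
  have hsm : StronglyMeasurable[MeasurableSpace.comap (ξ j) inferInstance]
      (fun ω => g (ξ j ω)) :=
    (hg.comp (comap_measurable (ξ j))).stronglyMeasurable
  have := condExp_indep_eq hm (𝓕.le j) hsm (h.indep j)
  rwa [show ∫ ω, g (ξ j ω) ∂P = ∫ ω, g (ξ 0 ω) ∂P from ((h.ident j).comp hg).integral_eq] at this

/-- Etemadi's strong law asks only for pairwise independence, and this holds because the earlier of
two amplitudes is measurable for the past of the later one. -/
theorem strong_law_sq (h : IsAmplitude ξ 𝓕 P) :
    ∀ᵐ ω ∂P, Tendsto (fun n : ℕ => (∑ i ∈ Finset.range n, ξ i ω ^ 2) / n) atTop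
      (𝓝 (∫ ω, ξ 0 ω ^ 2 ∂P)) := by
  have hsq : Measurable fun x : ℝ => x ^ 2 := by fun_prop
  have hind : Pairwise (Function.onFun (fun X Y => IndepFun X Y P) fun j ω => ξ j ω ^ 2) := by
    have key : ∀ i j, i < j → IndepFun (fun ω => ξ j ω ^ 2) (fun ω => ξ i ω ^ 2) P :=
      fun i j hij => (h.indepFun ((h.meas i).mono (𝓕.mono hij))).comp hsq hsq
    intro i j hij
    rcases lt_or_gt_of_ne hij with h' | h'
    · exact (key i j h').symm
    · exact key j i h'
  exact strong_law_ae_real (fun j ω => ξ j ω ^ 2) h.memLp.integrable_sq hind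
    fun j => (h.ident j).comp hsq

theorem ae_exists_sum_le (h : IsAmplitude ξ 𝓕 P) :
    ∀ᵐ ω ∂P, ∃ K : ℝ, ∀ N : ℕ, ∑ i ∈ Finset.range N, ξ i ω ≤ K * N := by
  filter_upwards [h.strong_law_sq] with ω hω
  obtain ⟨K, hK⟩ := (Metric.isBounded_range_of_tendsto _ hω).exists_norm_le
  refine ⟨K, fun N => ?_⟩
  rcases N.eq_zero_or_pos with rfl | hN
  · simp
  have hN' : (0 : ℝ) < N := by exact_mod_cast hN
  have h1 := (le_abs_self _).trans (hK _ ⟨N, rfl⟩)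
  rw [div_le_iff₀ hN'] at h1
  refine le_trans (Finset.sum_le_sum fun i _ => ?_) h1
  have := h.one_le i ω
  nlinarith

/-- `ξ_N² = o(N)` almost surely. -/
theorem ae_eventually_sq_le (h : IsAmplitude ξ 𝓕 P) :
    ∀ᵐ ω ∂P, ∀ᶠ j : ℕ in atTop, ξ j ω ^ 2 ≤ j := by
  filter_upwards [h.strong_law_sq] with ω hω
  set S : ℕ → ℝ := fun n => ∑ i ∈ Finset.range n, ξ i ω ^ 2 with hS
  have h1 : Tendsto (fun n : ℕ => S (n + 1) / ((n + 1 : ℕ) : ℝ)) atTop _ :=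
    hω.comp (tendsto_add_atTop_nat 1)
  have h2 : Tendsto (fun n : ℕ => ((n + 1 : ℕ) : ℝ) / n) atTop (𝓝 1) := by
    have h3 : Tendsto (fun n : ℕ => 1 + (n : ℝ)⁻¹) atTop (𝓝 (1 + 0)) :=
      tendsto_const_nhds.add tendsto_inv_atTop_nhds_zero_nat
    rw [add_zero] at h3
    refine h3.congr' ?_
    filter_upwards [eventually_ge_atTop 1] with n hn
    have : (n : ℝ) ≠ 0 := Nat.cast_ne_zero.2 (by omega)
    push_cast; field_simp
  -- Up to the factor (n+1)/n → 1, ξ_n²/n is the difference of two consecutive averages with the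
  -- same limit.
  have h4 := (h1.mul h2).sub hω
  rw [mul_one, sub_self] at h4
  have h5 := h4.eventually (gt_mem_nhds (zero_lt_one' ℝ))
  filter_upwards [h5, eventually_ge_atTop 1] with n hn hn1
  have hn0 : (0 : ℝ) < n := by exact_mod_cast hn1
  have e : S (n + 1) = S n + ξ n ω ^ 2 := Finset.sum_range_succ _ _
  have h6 : S (n + 1) / ((n + 1 : ℕ) : ℝ) * (((n + 1 : ℕ) : ℝ) / n) - S n / n
      = ξ n ω ^ 2 / n := by
    rw [e]; field_simp; ring
  rw [h6, div_lt_one hn0] at hn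
  exact hn.le

/-- Late amplitudes satisfy ξ_j² ≤ j ≤ c^n, and the finitely many early ones are eventually below
c^n. Hence the truncation is pathwise inactive for large n. -/
theorem ae_eventually_truncation (h : IsAmplitude ξ 𝓕 P) {c : ℝ} (hc : 1 < c) :
    ∀ᵐ ω ∂P, ∀ᶠ n : ℕ in atTop, ∀ j < ⌊c ^ n⌋₊, ξ j ω ^ 2 ≤ c ^ n := by
  filter_upwards [h.ae_eventually_sq_le] with ω hω
  obtain ⟨J, hJ⟩ := eventually_atTop.1 hω
  have hlim := tendsto_pow_atTop_atTop_of_one_lt hc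
  filter_upwards [hlim.eventually_ge_atTop (∑ i ∈ Finset.range J, ξ i ω ^ 2)] with n hn j hj
  by_cases hjJ : j < J
  · exact (Finset.single_le_sum (f := fun i => ξ i ω ^ 2) (fun i _ => sq_nonneg _)
      (Finset.mem_range.2 hjJ)).trans hn
  · have h1 := hJ j (by omega)
    have h2 : (j : ℝ) ≤ ⌊c ^ n⌋₊ := by exact_mod_cast hj.le
    exact h1.trans (h2.trans (Nat.floor_le (by positivity)))

theorem tendsto_tail (h : IsAmplitude ξ 𝓕 P) {c : ℝ} (hc : 1 < c) :
    Tendsto (fun n : ℕ => ∫ ω, (if ξ 0 ω ^ 2 ≤ c ^ n then 0 else ξ 0 ω ^ 2) ∂P) atTop (𝓝 0) := by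
  have hm := h.measurable 0
  have : Tendsto (fun n : ℕ => ∫ ω, (if ξ 0 ω ^ 2 ≤ c ^ n then 0 else ξ 0 ω ^ 2) ∂P) atTop
      (𝓝 (∫ _, (0 : ℝ) ∂P)) := by
    refine tendsto_integral_of_dominated_convergence (fun ω => ξ 0 ω ^ 2) (fun n => ?_)
      h.memLp.integrable_sq (fun n => Eventually.of_forall fun ω => ?_)
      (Eventually.of_forall fun ω => ?_)
    · exact (Measurable.ite (measurableSet_le (by fun_prop) measurable_const) measurable_const
        (by fun_prop)).aestronglyMeasurable
    · split_ifs
      · simp; positivity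
      · simp
    · refine tendsto_const_nhds.congr' ?_
      filter_upwards [(tendsto_pow_atTop_atTop_of_one_lt hc).eventually_ge_atTop (ξ 0 ω ^ 2)]
        with n hn
      rw [if_pos hn]
  simpa using this

/-- Here the second moment does the work of a fourth: exchanging sum and expectation,
`sum_truncated_le` with t = ξ² bounds every partial sum by a multiple of E ξ². -/
theorem summable_truncated (h : IsAmplitude ξ 𝓕 P) {c : ℝ} (hc : 1 < c) :
    Summable fun n : ℕ =>
      (c ^ n)⁻¹ * ∫ ω, (if ξ 0 ω ^ 2 ≤ c ^ n then (ξ 0 ω ^ 2) ^ 2 else 0) ∂P := by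
  have hc0 : 0 < c := one_pos.trans hc
  have hm := h.measurable 0
  have hint : ∀ n : ℕ,
      Integrable (fun ω => if ξ 0 ω ^ 2 ≤ c ^ n then (ξ 0 ω ^ 2) ^ 2 else 0) P := by
    intro n
    refine Integrable.of_bound (C := (c ^ n) ^ 2) (Measurable.ite
      (measurableSet_le (by fun_prop) measurable_const) (by fun_prop)
      measurable_const).aestronglyMeasurable (Eventually.of_forall fun ω => ?_)
    split_ifs with hω
    · rw [Real.norm_of_nonneg (by positivity)]
      exact pow_le_pow_left₀ (sq_nonneg _) hω 2
    · simp; positivity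
  refine summable_of_sum_range_le (c := (1 - c⁻¹)⁻¹ * ∫ ω, ξ 0 ω ^ 2 ∂P) (fun n => ?_) fun L => ?_
  · refine mul_nonneg (by positivity) (integral_nonneg fun ω => ?_)
    simp only [Pi.zero_apply]
    split_ifs <;> positivity
  · simp_rw [← integral_const_mul]
    rw [← integral_finsetSum _ fun n _ => (hint n).const_mul _]
    refine integral_mono (integrable_finsetSum _ fun n _ => (hint n).const_mul _)
      (h.memLp.integrable_sq.const_mul _) fun ω => ?_
    exact sum_truncated_le hc (by have := h.one_le 0 ω; positivity) L

end IsAmplitude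

end MartingaleArrays

/-! ### Strong law for triangular arrays along geometric subsequences. -/

section MartingaleArrays

variable {Ω : Type*} {mΩ : MeasurableSpace Ω} {P : Measure Ω} [IsProbabilityMeasure P]

namespace IsAmplitude

variable {ξ : ℕ → Ω → ℝ} {𝓕 : Filtration ℕ mΩ}

/-- Second moment of a truncated increment. -/
theorem truncated_memLp_integral_sq_le (h : IsAmplitude ξ 𝓕 P) {j : ℕ} {Δ H : Ω → ℝ} {C : ℝ}
    (hΔ : Measurable Δ) (hH : StronglyMeasurable[𝓕 j] H) (hHL : MemLp H 2 P)
    (hbd : ∀ᵐ ω ∂P, |Δ ω| ≤ C * (ξ j ω * (ξ j ω + H ω))) (T : ℝ) :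
    MemLp (fun ω => if ξ j ω ^ 2 ≤ T then Δ ω else 0) 2 P ∧
    ∫ ω, (if ξ j ω ^ 2 ≤ T then Δ ω else 0) ^ 2 ∂P
      ≤ 2 * C ^ 2 * (∫ ω, (if ξ 0 ω ^ 2 ≤ T then (ξ 0 ω ^ 2) ^ 2 else 0) ∂P
        + (∫ ω, ξ 0 ω ^ 2 ∂P) * ∫ ω, H ω ^ 2 ∂P) := by
  have hξ := h.measurable j
  have hset : MeasurableSet {ω | ξ j ω ^ 2 ≤ T} := measurableSet_le (by fun_prop) measurable_const
  have hXm : Measurable fun ω => if ξ j ω ^ 2 ≤ T then Δ ω else 0 :=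
    Measurable.ite hset hΔ measurable_const
  have hsq : Measurable fun x : ℝ => x ^ 2 := by fun_prop
  have hind : IndepFun (fun ω => ξ j ω ^ 2) (fun ω => H ω ^ 2) P := (h.indepFun hH).comp hsq hsq
  -- Independence makes the mixed term ξ²H² integrable with second moments alone; only the ξ⁴ term
  -- needs the truncation.
  have hprod : Integrable (fun ω => ξ j ω ^ 2 * H ω ^ 2) P :=
    hind.integrable_mul (h.memLp' j).integrable_sq hHL.integrable_sq
  have hprodI : ∫ ω, ξ j ω ^ 2 * H ω ^ 2 ∂P = (∫ ω, ξ 0 ω ^ 2 ∂P) * ∫ ω, H ω ^ 2 ∂P := by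
    rw [hind.integral_fun_mul_eq_mul_integral (by fun_prop) hHL.integrable_sq.aestronglyMeasurable]
    congr 1
    exact ((h.ident j).comp hsq).integral_eq
  have hgm : Measurable fun x : ℝ => if x ^ 2 ≤ T then (x ^ 2) ^ 2 else 0 :=
    Measurable.ite (measurableSet_le (by fun_prop) measurable_const) (by fun_prop) measurable_const
  have hfour : Integrable (fun ω => if ξ j ω ^ 2 ≤ T then (ξ j ω ^ 2) ^ 2 else 0) P := by
    refine Integrable.of_bound (C := T ^ 2) (hgm.comp hξ).aestronglyMeasurable
      (Eventually.of_forall fun ω => ?_)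
    split_ifs with hω
    · rw [Real.norm_of_nonneg (by positivity)]
      exact pow_le_pow_left₀ (sq_nonneg _) hω 2
    · simp; positivity
  have hfourI : ∫ ω, (if ξ j ω ^ 2 ≤ T then (ξ j ω ^ 2) ^ 2 else 0) ∂P
      = ∫ ω, (if ξ 0 ω ^ 2 ≤ T then (ξ 0 ω ^ 2) ^ 2 else 0) ∂P :=
    ((h.ident j).comp hgm).integral_eq
  have hmaj : Integrable (fun ω => 2 * C ^ 2 *
      ((if ξ j ω ^ 2 ≤ T then (ξ j ω ^ 2) ^ 2 else 0) + ξ j ω ^ 2 * H ω ^ 2)) P :=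
    (hfour.add hprod).const_mul _
  have hle : ∀ᵐ ω ∂P, (if ξ j ω ^ 2 ≤ T then Δ ω else 0) ^ 2 ≤ 2 * C ^ 2 *
      ((if ξ j ω ^ 2 ≤ T then (ξ j ω ^ 2) ^ 2 else 0) + ξ j ω ^ 2 * H ω ^ 2) := by
    filter_upwards [hbd] with ω hω
    split_ifs
    · have h1 : Δ ω ^ 2 ≤ (C * (ξ j ω * (ξ j ω + H ω))) ^ 2 := by
        rw [← sq_abs]; exact pow_le_pow_left₀ (abs_nonneg _) hω 2
      -- This encodes (ξ + H)² ≤ 2ξ² + 2H², the source of the factor 2 C².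
      have h2 : 0 ≤ C ^ 2 * ξ j ω ^ 2 * (ξ j ω - H ω) ^ 2 := by positivity
      nlinarith
    · rw [zero_pow two_ne_zero, zero_add]; positivity
  have hX2 : Integrable (fun ω => (if ξ j ω ^ 2 ≤ T then Δ ω else 0) ^ 2) P := by
    refine hmaj.mono' (hXm.pow_const 2).aestronglyMeasurable ?_
    filter_upwards [hle] with ω hω
    rw [Real.norm_of_nonneg (sq_nonneg _)]
    exact hω
  refine ⟨(memLp_two_iff_integrable_sq hXm.aestronglyMeasurable).2 hX2, ?_⟩
  refine (integral_mono_ae hX2 hmaj hle).trans (le_of_eq ?_)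
  rw [integral_const_mul, integral_add hfour hprod, hfourI, hprodI]

/-- The compensator of a truncated martingale increment. -/
theorem abs_condExp_truncated_le (h : IsAmplitude ξ 𝓕 P) {j : ℕ} {Δ H : Ω → ℝ} {C : ℝ}
    (hC : 0 ≤ C) (hΔ : Measurable Δ) (hΔi : Integrable Δ P) (hΔ0 : P[Δ | 𝓕 j] =ᵐ[P] 0)
    (hH : StronglyMeasurable[𝓕 j] H) (hH0 : ∀ ω, 0 ≤ H ω) (hHL : MemLp H 2 P)
    (hbd : ∀ᵐ ω ∂P, |Δ ω| ≤ C * (ξ j ω * (ξ j ω + H ω))) (T : ℝ) :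
    ∀ᵐ ω ∂P, |(P[fun ω => if ξ j ω ^ 2 ≤ T then Δ ω else 0 | 𝓕 j]) ω|
      ≤ C * (∫ ω, (if ξ 0 ω ^ 2 ≤ T then 0 else ξ 0 ω ^ 2) ∂P) * (1 + H ω) := by
  have hξ := h.measurable j
  set τ := ∫ ω, (if ξ 0 ω ^ 2 ≤ T then 0 else ξ 0 ω ^ 2) ∂P with hτ
  have hset : MeasurableSet {ω | ξ j ω ^ 2 ≤ T} := measurableSet_le (by fun_prop) measurable_const
  set X : Ω → ℝ := fun ω => if ξ j ω ^ 2 ≤ T then Δ ω else 0 with hX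
  set R : Ω → ℝ := fun ω => if ξ j ω ^ 2 ≤ T then 0 else Δ ω with hR
  set g : ℝ → ℝ := fun x => if x ^ 2 ≤ T then 0 else x ^ 2 with hg
  have hgm : Measurable g :=
    Measurable.ite (measurableSet_le (by fun_prop) measurable_const) measurable_const (by fun_prop)
  have hRm : Measurable R := Measurable.ite hset measurable_const hΔ
  have hRi : Integrable R P := by
    refine hΔi.norm.mono' hRm.aestronglyMeasurable (Eventually.of_forall fun ω => ?_)
    simp only [hR]; split_ifs <;> simp
  -- Since `Δ` has conditional mean zero, the compensator of the truncated part `X` is minus that of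
  -- the discarded part `R`, which lives on {ξ² > T}.
  have hXR : X = Δ - R := by
    funext ω; simp only [hX, hR, Pi.sub_apply]; split_ifs <;> simp
  have hgi : Integrable (fun ω => g (ξ j ω)) P := by
    refine (h.memLp' j).integrable_sq.mono' (hgm.comp hξ).aestronglyMeasurable
      (Eventually.of_forall fun ω => ?_)
    simp only [hg]; split_ifs
    · simp; positivity
    · simp
  have hgcond : P[fun ω => g (ξ j ω) | 𝓕 j] =ᵐ[P] fun _ => τ := h.condExp_comp j hgm
  have hHsm : StronglyMeasurable[𝓕 j] (fun ω => 1 + H ω) := stronglyMeasurable_const.add hH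
  have hprod : Integrable ((fun ω => 1 + H ω) * fun ω => g (ξ j ω)) P := by
    have hHi : Integrable (fun ω => 1 + H ω) P :=
      (integrable_const 1).add (hHL.integrable one_le_two)
    exact ((h.indepFun hHsm).comp hgm measurable_id).symm.integrable_mul hHi hgi
  have hmaj : Integrable (C • ((fun ω => 1 + H ω) * fun ω => g (ξ j ω))) P := hprod.smul C
  have hle : (fun ω => ‖R ω‖) ≤ᵐ[P] C • ((fun ω => 1 + H ω) * fun ω => g (ξ j ω)) := by
    filter_upwards [hbd] with ω hω
    simp only [hR, hg, Pi.smul_apply, Pi.mul_apply, smul_eq_mul]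
    split_ifs
    · simp
    · rw [Real.norm_eq_abs]
      refine hω.trans (mul_le_mul_of_nonneg_left ?_ hC)
      have h1 := h.one_le j ω
      have h2 := hH0 ω
      -- From ξ ≥ 1 one gets ξ(ξ + H) ≤ ξ²(1 + H), a product of an amplitude term and a predictable
      -- term.
      nlinarith [mul_nonneg (mul_nonneg (sub_nonneg.2 h1) (zero_le_one.trans h1)) h2]
  have e1 := condExp_sub (m := 𝓕 j) hΔi hRi
  have e2 := norm_condExp_le (m := 𝓕 j) (μ := P) R
  have e3 := condExp_mono (m := 𝓕 j) hRi.norm hmaj hle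
  have e4 := condExp_smul (m := 𝓕 j) (μ := P) C ((fun ω => 1 + H ω) * fun ω => g (ξ j ω))
  have e5 := condExp_mul_of_stronglyMeasurable_left hHsm hprod hgi
  rw [hXR]
  filter_upwards [e1, e2, e3, e4, e5, hΔ0, hgcond] with ω h1 h2 h3 h4 h5 h6 h7
  rw [h1, Pi.sub_apply, h6, Pi.zero_apply, zero_sub, abs_neg]
  refine (h2.trans h3).trans (le_of_eq ?_)
  rw [h4, Pi.smul_apply, h5, Pi.mul_apply, h7, smul_eq_mul]; ring

/-- A strong law along geometric subsequences for triangular arrays of martingale increments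
dominated by the noise amplitudes. -/
theorem tendsto_array (h : IsAmplitude ξ 𝓕 P) {Δ H : ℕ → ℕ → Ω → ℝ} {C K : ℝ} (hC : 0 ≤ C)
    (hΔ : ∀ N j, StronglyMeasurable[𝓕 (j + 1)] (Δ N j)) (hΔi : ∀ N j, Integrable (Δ N j) P)
    (hΔ0 : ∀ N j, P[Δ N j | 𝓕 j] =ᵐ[P] 0)
    (hH : ∀ N j, StronglyMeasurable[𝓕 j] (H N j)) (hH0 : ∀ N j ω, 0 ≤ H N j ω)
    (hHL : ∀ N j, MemLp (H N j) 2 P)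
    (hbd : ∀ N j, ∀ᵐ ω ∂P, |Δ N j ω| ≤ C * (ξ j ω * (ξ j ω + H N j ω)))
    (hHsum : ∀ N : ℕ, ∑ j ∈ Finset.range N, ∫ ω, H N j ω ^ 2 ∂P ≤ K * N)
    (hHae : ∀ᵐ ω ∂P, ∃ K' : ℝ, ∀ N : ℕ, ∑ j ∈ Finset.range N, H N j ω ≤ K' * N)
    {c : ℝ} (hc : 1 < c) :
    ∀ᵐ ω ∂P, Tendsto (fun n : ℕ =>
      (⌊c ^ n⌋₊ : ℝ)⁻¹ * ∑ j ∈ Finset.range ⌊c ^ n⌋₊, Δ ⌊c ^ n⌋₊ j ω) atTop (𝓝 0) := by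
  have hc0 : 0 < c := one_pos.trans hc
  set M : ℕ → ℕ := fun n => ⌊c ^ n⌋₊ with hM
  have hMpos : ∀ n, (0 : ℝ) < M n := fun n => by
    have : 1 ≤ M n := Nat.one_le_floor_iff _ |>.2 (one_le_pow₀ hc.le)
    exact_mod_cast this
  have hMinv : ∀ n, (M n : ℝ)⁻¹ ≤ 2 * (c ^ n)⁻¹ := fun n => by
    have h1 : c ^ n < M n + 1 := Nat.lt_floor_add_one _
    have h2 : (1 : ℝ) ≤ M n := by exact_mod_cast (Nat.one_le_floor_iff _ |>.2 (one_le_pow₀ hc.le))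
    rw [inv_le_iff_one_le_mul₀ (hMpos n), mul_assoc, mul_comm, mul_assoc, mul_comm _ (2 : ℝ),
      ← div_eq_inv_mul, le_div_iff₀ (by positivity)]
    linarith
  set X : ℕ → ℕ → Ω → ℝ := fun n j ω => if ξ j ω ^ 2 ≤ c ^ n then Δ (M n) j ω else 0 with hX
  set τ : ℕ → ℝ := fun n => ∫ ω, (if ξ 0 ω ^ 2 ≤ c ^ n then 0 else ξ 0 ω ^ 2) ∂P with hτ
  set F4 : ℕ → ℝ := fun n =>
    ∫ ω, (if ξ 0 ω ^ 2 ≤ c ^ n then (ξ 0 ω ^ 2) ^ 2 else 0) ∂P with hF4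
  set E2 : ℝ := ∫ ω, ξ 0 ω ^ 2 ∂P with hE2
  have hE2nn : 0 ≤ E2 := integral_nonneg fun ω => sq_nonneg _
  have hΔm : ∀ N j, Measurable (Δ N j) := fun N j => ((hΔ N j).mono (𝓕.le _)).measurable
  have hXsm : ∀ n j, StronglyMeasurable[𝓕 (j + 1)] (X n j) := fun n j => by
    have hset : MeasurableSet[𝓕 (j + 1)] {ω | ξ j ω ^ 2 ≤ c ^ n} :=
      measurableSet_le ((h.meas j).measurable.pow_const 2) measurable_const
    exact (Measurable.ite hset (hΔ (M n) j).measurable measurable_const).stronglyMeasurable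
  have hmom := fun n j => h.truncated_memLp_integral_sq_le (hΔm (M n) j) (hH (M n) j)
    (hHL (M n) j) (hbd (M n) j) (c ^ n)
  have horth := fun n => integral_sq_sum_sub_condExp_le 𝓕 (hXsm n) (fun j => (hmom n j).1) (M n)
  -- The normalized compensated truncated sums. Orthogonality makes E Z_n² at most a constant times
  -- c^{-n}(E[ξ⁴; ξ² ≤ c^n] + 1), where one factor of M⁻² is spent on the M summands; this is
  -- summable in n.
  set Z : ℕ → Ω → ℝ := fun n ω =>
    (M n : ℝ)⁻¹ * ∑ j ∈ Finset.range (M n), (X n j ω - (P[X n j | 𝓕 j]) ω) with hZ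
  have hZL : ∀ n, MemLp (Z n) 2 P := fun n => (horth n).1.const_mul _
  have hZle : ∀ n, ∫ ω, Z n ω ^ 2 ∂P
      ≤ 4 * C ^ 2 * ((c ^ n)⁻¹ * F4 n) + 4 * C ^ 2 * (E2 * K) * (c ^ n)⁻¹ := by
    intro n
    have hKM : ∑ j ∈ Finset.range (M n), ∫ ω, H (M n) j ω ^ 2 ∂P ≤ K * M n := hHsum (M n)
    have hF4nn : 0 ≤ F4 n := integral_nonneg fun ω => by
      simp only [Pi.zero_apply]; split_ifs <;> positivity
    have hK0 : 0 ≤ K := by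
      have : 0 ≤ K * M n := le_trans
        (Finset.sum_nonneg fun j _ => integral_nonneg fun ω => sq_nonneg _) hKM
      exact nonneg_of_mul_nonneg_left this (hMpos n)
    calc ∫ ω, Z n ω ^ 2 ∂P
        = ((M n : ℝ)⁻¹) ^ 2 *
          ∫ ω, (∑ j ∈ Finset.range (M n), (X n j ω - (P[X n j | 𝓕 j]) ω)) ^ 2 ∂P := by
          rw [← integral_const_mul]; simp only [hZ, mul_pow]
      _ ≤ ((M n : ℝ)⁻¹) ^ 2 * ∑ j ∈ Finset.range (M n), ∫ ω, X n j ω ^ 2 ∂P :=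
          mul_le_mul_of_nonneg_left (horth n).2 (sq_nonneg _)
      _ ≤ ((M n : ℝ)⁻¹) ^ 2 * ∑ j ∈ Finset.range (M n),
            2 * C ^ 2 * (F4 n + E2 * ∫ ω, H (M n) j ω ^ 2 ∂P) := by
          gcongr with j hj
          exact (hmom n j).2
      _ = ((M n : ℝ)⁻¹) ^ 2 * (2 * C ^ 2 * (M n * F4 n
            + E2 * ∑ j ∈ Finset.range (M n), ∫ ω, H (M n) j ω ^ 2 ∂P)) := by
          rw [← Finset.mul_sum, Finset.sum_add_distrib, ← Finset.mul_sum]; simp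
      _ ≤ ((M n : ℝ)⁻¹) ^ 2 * (2 * C ^ 2 * (M n * F4 n + E2 * (K * M n))) := by gcongr
      _ = (M n : ℝ)⁻¹ * (2 * C ^ 2 * (F4 n + E2 * K)) := by
          have := (hMpos n).ne'
          field_simp
      _ ≤ (2 * (c ^ n)⁻¹) * (2 * C ^ 2 * (F4 n + E2 * K)) :=
          mul_le_mul_of_nonneg_right (hMinv n) (by positivity)
      _ = _ := by ring
  have hgeo : Summable fun n : ℕ => (c ^ n)⁻¹ := by
    simp_rw [← inv_pow]
    exact summable_geometric_of_lt_one (by positivity) (inv_lt_one_of_one_lt₀ hc)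
  have hZsum : Summable fun n => ∫ ω, Z n ω ^ 2 ∂P :=
    Summable.of_nonneg_of_le (fun n => integral_nonneg fun ω => sq_nonneg _) hZle
      (((h.summable_truncated hc).mul_left _).add (hgeo.mul_left _))
  have hZ0 := ae_tendsto_zero_of_summable_integral_sq hZL hZsum
  have hcomp : ∀ᵐ ω ∂P, ∀ n j, |(P[X n j | 𝓕 j]) ω| ≤ C * τ n * (1 + H (M n) j ω) := by
    rw [ae_all_iff]; intro n
    rw [ae_all_iff]; intro j
    exact h.abs_condExp_truncated_le hC (hΔm (M n) j) (hΔi (M n) j) (hΔ0 (M n) j) (hH (M n) j)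
      (hH0 (M n) j) (hHL (M n) j) (hbd (M n) j) (c ^ n)
  have hτ0 : Tendsto τ atTop (𝓝 0) := h.tendsto_tail hc
  have hτnn : ∀ n, 0 ≤ τ n := fun n => integral_nonneg fun ω => by
    simp only [Pi.zero_apply]; split_ifs <;> positivity
  filter_upwards [hZ0, hcomp, hHae, h.ae_eventually_truncation hc] with ω hω1 hω2 ⟨K', hK'⟩ hω4
  have hlim : Tendsto (fun n => |Z n ω| + C * τ n * (1 + K')) atTop (𝓝 0) := by
    have h1 := hω1.abs
    have h2 := (hτ0.const_mul C).mul_const (1 + K')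
    simpa using h1.add h2
  refine squeeze_zero_norm' ?_ hlim
  filter_upwards [hω4] with n hn
  -- Once the truncation is inactive, the original sum is the compensated sum, which tends to 0,
  -- plus the compensators, whose mean is at most C τ_n (1 + K') and vanishes with the tail τ_n.
  have hsplit : ∑ j ∈ Finset.range (M n), Δ (M n) j ω
      = ∑ j ∈ Finset.range (M n), (X n j ω - (P[X n j | 𝓕 j]) ω)
        + ∑ j ∈ Finset.range (M n), (P[X n j | 𝓕 j]) ω := by
    rw [← Finset.sum_add_distrib]
    refine Finset.sum_congr rfl fun j hj => ?_
    simp only [sub_add_cancel, hX]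
    rw [if_pos (hn j (Finset.mem_range.1 hj))]
  rw [hsplit, mul_add, Real.norm_eq_abs]
  refine (abs_add_le _ _).trans (add_le_add le_rfl ?_)
  rw [abs_mul, abs_of_pos (inv_pos.2 (hMpos n)), inv_mul_le_iff₀ (hMpos n)]
  calc |∑ j ∈ Finset.range (M n), (P[X n j | 𝓕 j]) ω|
      ≤ ∑ j ∈ Finset.range (M n), C * τ n * (1 + H (M n) j ω) :=
        (Finset.abs_sum_le_sum_abs _ _).trans (Finset.sum_le_sum fun j _ => hω2 n j)
    _ = C * τ n * (M n + ∑ j ∈ Finset.range (M n), H (M n) j ω) := by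
        rw [← Finset.mul_sum, Finset.sum_add_distrib]; simp
    _ ≤ C * τ n * (M n + K' * M n) := by
        have := hτnn n
        gcongr
        exact hK' (M n)
    _ = _ := by ring

end IsAmplitude

end MartingaleArrays

/-! ### Independent copies of the future, and conditioning on the past. -/

section Splice

/-- The sequence that follows `w` before time `j` and `w'` from time `j` on. -/
def splice {E : Type*} (j : ℕ) (w w' : ℕ → E) : ℕ → E := fun i => if i < j then w i else w' i

@[simp] theorem splice_zero {E : Type*} (w w' : ℕ → E) : splice 0 w w' = w' := by
  funext i; simp [splice]

theorem splice_of_lt {E : Type*} {j i : ℕ} (h : i < j) (w w' : ℕ → E) : splice j w w' i = w i :=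
  if_pos h

theorem splice_of_le {E : Type*} {j i : ℕ} (h : j ≤ i) (w w' : ℕ → E) : splice j w w' i = w' i :=
  if_neg (not_lt.2 h)

theorem splice_self {E : Type*} (j : ℕ) (w : ℕ → E) : splice j w w = w := by
  funext i; simp [splice]

theorem measurable_splice {E : Type*} [MeasurableSpace E] (j : ℕ) :
    Measurable fun p : (ℕ → E) × (ℕ → E) => splice j p.1 p.2 := by
  refine measurable_pi_lambda _ fun i => ?_
  by_cases h : i < j
  · simp only [splice, h, if_true]; fun_prop
  · simp only [splice, h, if_false]; fun_prop

variable {Ω E : Type*} {mΩ : MeasurableSpace Ω} {P : Measure Ω} [IsProbabilityMeasure P]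
  [MeasurableSpace E]

/-- The variables before time `j`. -/
def pastTuple (e : ℕ → Ω → E) (j : ℕ) : Ω → (Set.Iio j → E) := fun ω i => e i ω

/-- The variables from time `j` on. -/
def futureTuple (e : ℕ → Ω → E) (j : ℕ) : Ω → (Set.Ici j → E) := fun ω i => e i ω

/-- The sequence with given values before and from time `j` on. -/
def joinTuples {j : ℕ} (p : (Set.Iio j → E) × (Set.Ici j → E)) : ℕ → E :=
  fun i => if h : i < j then p.1 ⟨i, h⟩ else p.2 ⟨i, not_lt.1 h⟩

theorem measurable_joinTuples (j : ℕ) : Measurable (joinTuples (E := E) (j := j)) := by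
  refine measurable_pi_lambda _ fun i => ?_
  by_cases h : i < j
  · simp only [joinTuples, h, dif_pos]; fun_prop
  · simp only [joinTuples, h, dif_neg, not_false_eq_true]; fun_prop

theorem joinTuples_eq (e : ℕ → Ω → E) (j : ℕ) (ω ω' : Ω) :
    joinTuples (pastTuple e j ω, futureTuple e j ω') = splice j (fun i => e i ω) fun i => e i ω' := by
  funext i
  simp only [joinTuples, splice, pastTuple, futureTuple, dite_eq_ite]

theorem measurable_pastTuple {e : ℕ → Ω → E} (he : ∀ i, Measurable (e i)) (j : ℕ) :
    Measurable (pastTuple e j) := measurable_pi_lambda _ fun i => he i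

theorem measurable_futureTuple {e : ℕ → Ω → E} (he : ∀ i, Measurable (e i)) (j : ℕ) :
    Measurable (futureTuple e j) := measurable_pi_lambda _ fun i => he i

theorem indepFun_past_future {e : ℕ → Ω → E} (he : ∀ i, Measurable (e i)) (hi : iIndepFun e P)
    (j : ℕ) : IndepFun (pastTuple e j) (futureTuple e j) P := by
  have hS : ∀ S : Set ℕ, MeasurableSpace.comap (fun ω (i : S) => e i ω) MeasurableSpace.pi
      = ⨆ i ∈ S, MeasurableSpace.comap (e i) inferInstance := by
    intro S
    rw [MeasurableSpace.pi, MeasurableSpace.comap_iSup, iSup_subtype']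
    simp_rw [MeasurableSpace.comap_comp]
    rfl
  rw [IndepFun_iff_Indep]
  have h := indep_iSup_of_disjoint (fun i => (he i).comap_le) hi
    (S := Set.Iio j) (T := Set.Ici j)
    (Set.disjoint_left.2 fun x hx hx' => absurd (Set.mem_Iio.1 hx) (not_lt.2 hx'))
  rw [← hS, ← hS] at h
  exact h

/-- Tonelli for the product law of past and future: the outer variable carries the past, the inner
one an independent future. -/
theorem lintegral_splice {e : ℕ → Ω → E} (he : ∀ i, Measurable (e i)) (hi : iIndepFun e P)
    (j : ℕ) {G : (ℕ → E) → ENNReal} (hG : Measurable G) :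
    ∫⁻ ω, G (fun i => e i ω) ∂P
      = ∫⁻ ω, ∫⁻ ω', G (splice j (fun i => e i ω) fun i => e i ω') ∂P ∂P := by
  have hX := measurable_pastTuple he j
  have hY := measurable_futureTuple he j
  have hind := (indepFun_iff_map_prod_eq_prod_map_map hX.aemeasurable hY.aemeasurable).1
    (indepFun_past_future he hi j)
  have hGj : Measurable fun p => G (joinTuples (j := j) p) := hG.comp (measurable_joinTuples j)
  have h1 : ∫⁻ ω, G (fun i => e i ω) ∂P
      = ∫⁻ p, G (joinTuples p) ∂(P.map fun ω => (pastTuple e j ω, futureTuple e j ω)) := by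
    rw [lintegral_map hGj (hX.prodMk hY)]
    simp_rw [joinTuples_eq, splice_self]
  rw [h1, hind, lintegral_prod _ hGj.aemeasurable, lintegral_map _ hX]
  · refine lintegral_congr fun ω => ?_
    rw [lintegral_map (f := fun y => G (joinTuples (pastTuple e j ω, y)))
      (hGj.comp measurable_prodMk_left) hY]
    simp_rw [joinTuples_eq]
  · exact hGj.lintegral_prod_right'

/-- The filtration generated by the variables before time `j`. -/
def pastFiltration (e : ℕ → Ω → E) (he : ∀ i, Measurable (e i)) : Filtration ℕ mΩ where
  seq j := MeasurableSpace.comap (pastTuple e j) inferInstance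
  mono' i j hij := by
    have : pastTuple e i
        = (fun (x : Set.Iio j → E) (l : Set.Iio i) => x ⟨l, lt_of_lt_of_le l.2 hij⟩)
          ∘ pastTuple e j := rfl
    simp only [this]
    rw [← MeasurableSpace.comap_comp]
    exact MeasurableSpace.comap_mono (Measurable.comap_le (by fun_prop))
  le' j := (measurable_pastTuple he j).comap_le

theorem measurable_pastFiltration (e : ℕ → Ω → E) (he : ∀ i, Measurable (e i)) {i j : ℕ}
    (hij : i < j) : Measurable[pastFiltration e he j] (e i) := by
  have h1 : Measurable[pastFiltration e he j] (pastTuple e j) := comap_measurable _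
  exact (measurable_pi_apply (⟨i, hij⟩ : Set.Iio j)).comp h1

/-- Conditioning on the past amounts to integrating over an independent copy of the future. -/
theorem condExp_pastFiltration [StandardBorelSpace E] [Nonempty E] {e : ℕ → Ω → E}
    (he : ∀ i, Measurable (e i)) (hi : iIndepFun e P) (j : ℕ) {G : (ℕ → E) → ℝ}
    (hG : Measurable G) (hint : Integrable (fun ω => G fun i => e i ω) P) :
    P[fun ω => G fun i => e i ω | pastFiltration e he j]
      =ᵐ[P] fun ω => ∫ ω', G (splice j (fun i => e i ω) fun i => e i ω') ∂P := by
  have hX := measurable_pastTuple he j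
  have hY := measurable_futureTuple he j
  have hGj : Measurable fun p => G (joinTuples (j := j) p) := hG.comp (measurable_joinTuples j)
  have hrw : (fun ω => G fun i => e i ω)
      = fun ω => G (joinTuples (pastTuple e j ω, futureTuple e j ω)) := by
    funext ω; rw [joinTuples_eq, splice_self]
  have h1 := condExp_prod_ae_eq_integral_condDistrib hX hY.aemeasurable
    (f := fun p => G (joinTuples (j := j) p)) hGj.stronglyMeasurable (by rw [← hrw]; exact hint)
  -- By independence the conditional law of the future given the past is the constant kernel at its
  -- unconditional law.
  have h2 : condDistrib (futureTuple e j) (pastTuple e j) P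
      =ᵐ[P.map (pastTuple e j)] Kernel.const _ (P.map (futureTuple e j)) := by
    have : IsProbabilityMeasure (P.map (futureTuple e j)) :=
      Measure.isProbabilityMeasure_map hY.aemeasurable
    refine condDistrib_ae_eq_of_measure_eq_compProd _ hY.aemeasurable ?_
    rw [Measure.compProd_const]
    exact (indepFun_iff_map_prod_eq_prod_map_map hX.aemeasurable hY.aemeasurable).1
      (indepFun_past_future he hi j)
  have h3 := ae_of_ae_map hX.aemeasurable h2
  rw [hrw]
  refine h1.trans ?_
  filter_upwards [h3] with ω hω
  rw [hω, Kernel.const_apply, integral_map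
    (f := fun y => G (joinTuples (pastTuple e j ω, y))) hY.aemeasurable
    (hGj.comp measurable_prodMk_left).aestronglyMeasurable]
  simp_rw [joinTuples_eq]

/-- The added 1 provides the lower bound ξ ≥ 1, with which constants are absorbed into amplitudes.
-/
theorem isAmplitude_norm {E : Type*} [NormedAddCommGroup E] [MeasurableSpace E] [BorelSpace E]
    {e : ℕ → Ω → E} (he : ∀ i, Measurable (e i)) (hi : iIndepFun e P)
    (hid : ∀ i, IdentDistrib (e i) (e 0) P P) (hL : MemLp (e 0) 2 P) :
    IsAmplitude (fun j ω => 1 + ‖e j ω‖) (pastFiltration e he) P := by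
  have h1 : ∀ j, Measurable[pastFiltration e he (j + 1)] (fun ω => 1 + ‖e j ω‖) := fun j =>
    (measurable_norm.comp (measurable_pastFiltration e he (Nat.lt_succ_self j))).const_add 1
  have h2 : ∀ j, IndepFun (fun ω => 1 + ‖e j ω‖) (pastTuple e j) P := fun j => by
    have hg : Measurable fun x : Set.Ici j → E => 1 + ‖x ⟨j, Set.self_mem_Ici⟩‖ :=
      (measurable_pi_apply (⟨j, Set.self_mem_Ici⟩ : Set.Ici j)).norm.const_add 1
    exact (indepFun_past_future he hi j).symm.comp hg measurable_id
  have h3 : ∀ j, IdentDistrib (fun ω => 1 + ‖e j ω‖) (fun ω => 1 + ‖e 0 ω‖) P P := fun j =>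
    (hid j).comp (u := fun x => 1 + ‖x‖) (measurable_norm.const_add 1)
  have h4 : MemLp (fun ω => 1 + ‖e 0 ω‖) 2 P :=
    MemLp.add (f := fun _ => (1 : ℝ)) (memLp_const 1) hL.norm
  have h5 : ∀ j, Indep (MeasurableSpace.comap (fun ω => 1 + ‖e j ω‖) inferInstance)
      (pastFiltration e he j) P := fun j => (IndepFun_iff_Indep _ _ _).1 (h2 j)
  have h6 : ∀ j, StronglyMeasurable[pastFiltration e he (j + 1)] (fun ω => 1 + ‖e j ω‖) :=
    fun j => (h1 j).stronglyMeasurable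
  have h7 : ∀ (j : ℕ) ω, 1 ≤ 1 + ‖e j ω‖ := fun j ω => le_add_of_nonneg_right (norm_nonneg _)
  exact ⟨h6, h5, h3, h7, h4⟩

end Splice

/-! ### Second moments through L² norms. -/

section SquareNorms

variable {Ω : Type*} {mΩ : MeasurableSpace Ω} {P : Measure Ω}
  {F : Type*} [NormedAddCommGroup F]

theorem integral_norm_sq_eq {U : Ω → F} (hU : MemLp U 2 P) :
    ∫ ω, ‖U ω‖ ^ 2 ∂P = (eLpNorm U 2 P).toReal ^ 2 := by
  rw [hU.eLpNorm_eq_integral_rpow_norm two_ne_zero ENNReal.ofNat_ne_top, ENNReal.toReal_ofReal]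
  · have h0 : 0 ≤ ∫ a, ‖U a‖ ^ (2 : ENNReal).toReal ∂P :=
      integral_nonneg fun a => by positivity
    rw [← Real.rpow_natCast, ← Real.rpow_mul h0]
    simp
  · exact Real.rpow_nonneg (integral_nonneg fun a => by positivity) _

theorem integral_norm_sq_le {U : Ω → F} {b : ℝ} (hU : AEStronglyMeasurable U P)
    (hb0 : 0 ≤ b) (hb : eLpNorm U 2 P ≤ ENNReal.ofReal b) : ∫ ω, ‖U ω‖ ^ 2 ∂P ≤ b ^ 2 := by
  have hUL : MemLp U 2 P := ⟨hU, hb.trans_lt ENNReal.ofReal_lt_top⟩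
  rw [integral_norm_sq_eq hUL]
  exact pow_le_pow_left₀ ENNReal.toReal_nonneg (ENNReal.toReal_le_of_le_ofReal hb0 hb) 2

/-- With x, y the L² norms of U, V, the difference is |x - y|(x + y); the triangle inequality in L²
gives |x - y| ≤ a and x + y ≤ a + 2b. No moment beyond the second enters. -/
theorem abs_integral_norm_sq_sub_le {U V : Ω → F} {a b : ℝ} (hU : AEStronglyMeasurable U P)
    (hV : AEStronglyMeasurable V P) (ha0 : 0 ≤ a) (hb0 : 0 ≤ b)
    (ha : eLpNorm (fun ω => U ω - V ω) 2 P ≤ ENNReal.ofReal a)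
    (hb : eLpNorm V 2 P ≤ ENNReal.ofReal b) :
    |∫ ω, ‖U ω‖ ^ 2 ∂P - ∫ ω, ‖V ω‖ ^ 2 ∂P| ≤ a * (a + 2 * b) := by
  have hVL : MemLp V 2 P := ⟨hV, hb.trans_lt ENNReal.ofReal_lt_top⟩
  have hDL : MemLp (fun ω => U ω - V ω) 2 P := ⟨hU.sub hV, ha.trans_lt ENNReal.ofReal_lt_top⟩
  have hUL : MemLp U 2 P := by
    have := hDL.add hVL
    convert this using 1
    funext ω; simp
  rw [integral_norm_sq_eq hUL, integral_norm_sq_eq hVL]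
  set x := (eLpNorm U 2 P).toReal
  set y := (eLpNorm V 2 P).toReal
  set d := (eLpNorm (fun ω => U ω - V ω) 2 P).toReal
  have hx0 : 0 ≤ x := ENNReal.toReal_nonneg
  have hy0 : 0 ≤ y := ENNReal.toReal_nonneg
  have hda : d ≤ a := ENNReal.toReal_le_of_le_ofReal ha0 ha
  have hyb : y ≤ b := ENNReal.toReal_le_of_le_ofReal hb0 hb
  have h1 : x ≤ d + y := by
    have := eLpNorm_add_le (p := 2) hDL.1 hVL.1 one_le_two
    have e : ((fun ω => U ω - V ω) + V) = U := by funext ω; simp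
    rw [e] at this
    have h2 := ENNReal.toReal_mono (ENNReal.add_ne_top.2 ⟨hDL.eLpNorm_ne_top, hVL.eLpNorm_ne_top⟩) this
    rwa [ENNReal.toReal_add hDL.eLpNorm_ne_top hVL.eLpNorm_ne_top] at h2
  have h2 : y ≤ d + x := by
    have := eLpNorm_sub_le (p := 2) hUL.1 hDL.1 one_le_two
    have e : (U - fun ω => U ω - V ω) = V := by funext ω; simp
    rw [e] at this
    have h2 := ENNReal.toReal_mono (ENNReal.add_ne_top.2 ⟨hUL.eLpNorm_ne_top, hDL.eLpNorm_ne_top⟩) this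
    rw [ENNReal.toReal_add hUL.eLpNorm_ne_top hDL.eLpNorm_ne_top] at h2
    linarith
  have h3 : |x - y| ≤ a := abs_le.2 ⟨by linarith, by linarith⟩
  have h4 : x + y ≤ a + 2 * b := by linarith
  calc |x ^ 2 - y ^ 2| = |x - y| * (x + y) := by
        rw [sq_sub_sq, abs_mul, abs_of_nonneg (add_nonneg hx0 hy0), mul_comm]
    _ ≤ a * (a + 2 * b) := mul_le_mul h3 h4 (by positivity) ha0

end SquareNorms

/-! ### Forgetting functionals and their martingale increments. -/

section StrongLaw

variable {Ω E F : Type*} {mΩ : MeasurableSpace Ω} {P : Measure Ω} [IsProbabilityMeasure P]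
  [NormedAddCommGroup E] [MeasurableSpace E] [BorelSpace E] [StandardBorelSpace E]
  [NormedAddCommGroup F] [MeasurableSpace F] [BorelSpace F] [SecondCountableTopology F]

/-- A process `Φ_k(e_0, e_1, …)` of functionals of the noise with exponentially forgetting
sensitivity in mean square: replacing the noise at time `j ≤ k` by an independent copy (with the
earlier noise fixed and the later noise averaged out) changes `Φ_k` by `O(λ^{k-j} (1 + ‖e_j‖))`;
the mean square sizes of `Φ_k` are at most `β_k`, where the Cesàro means of `β_k²` converge. -/
structure IsForgetting (e : ℕ → Ω → E) (P : Measure Ω) (Φ : ℕ → (ℕ → E) → F) (C lam : ℝ)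
    (β : ℕ → ℝ) : Prop where
  nonneg_C : 0 ≤ C
  lam_nonneg : 0 ≤ lam
  lam_lt_one : lam < 1
  meas : ∀ k, Measurable (Φ k)
  causal : ∀ k (w w' : ℕ → E), (∀ i ≤ k, w i = w' i) → Φ k w = Φ k w'
  forget : ∀ (w : ℕ → E) (j k : ℕ), j ≤ k →
    eLpNorm (fun ω => Φ k (splice (j + 1) w fun i => e i ω) - Φ k (splice j w fun i => e i ω)) 2 P
      ≤ ENNReal.ofReal (C * lam ^ (k - j) * (1 + ‖w j‖))
  nonneg_β : ∀ k, 0 ≤ β k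
  size : ∀ k, eLpNorm (fun ω => Φ k fun i => e i ω) 2 P ≤ ENNReal.ofReal (β k)
  cesaro : ∃ l, Tendsto (fun N : ℕ => (N : ℝ)⁻¹ * ∑ k ∈ Finset.range N, β k ^ 2) atTop (𝓝 l)

namespace IsForgetting

variable {e : ℕ → Ω → E} {Φ : ℕ → (ℕ → E) → F} {C lam : ℝ} {β : ℕ → ℝ}

theorem measurable_comp (h : IsForgetting e P Φ C lam β) (he : ∀ i, Measurable (e i)) (k : ℕ) :
    Measurable fun ω => Φ k fun i => e i ω :=
  (h.meas k).comp (measurable_pi_lambda _ he)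

theorem memLp (h : IsForgetting e P Φ C lam β) (he : ∀ i, Measurable (e i)) (k : ℕ) :
    MemLp (fun ω => Φ k fun i => e i ω) 2 P :=
  ⟨(h.measurable_comp he k).aestronglyMeasurable, (h.size k).trans_lt ENNReal.ofReal_lt_top⟩

theorem measurable_splice_comp (h : IsForgetting e P Φ C lam β) (he : ∀ i, Measurable (e i))
    (k j : ℕ) (w : ℕ → E) : Measurable fun ω => Φ k (splice j w fun i => e i ω) :=
  (h.meas k).comp ((measurable_splice j).comp
    (measurable_const.prodMk (measurable_pi_lambda _ he)))

/-- The memory of the noise amplitudes before time `j`. -/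
noncomputable def pastSum (lam : ℝ) (x : ℕ → E) (j : ℕ) : ℝ :=
  ∑ i ∈ Finset.range j, lam ^ (j - i) * (1 + ‖x i‖)

theorem pastSum_nonneg {lam : ℝ} (h0 : 0 ≤ lam) (x : ℕ → E) (j : ℕ) : 0 ≤ pastSum lam x j :=
  Finset.sum_nonneg fun i _ => mul_nonneg (pow_nonneg h0 _) (by positivity)

theorem pastSum_le {lam : ℝ} (h0 : 0 ≤ lam) (x : ℕ → E) (j : ℕ) :
    pastSum lam x j ≤ geomFilter lam (fun i => 1 + ‖x i‖) j := by
  rw [geomFilter, Finset.sum_range_succ]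
  exact le_add_of_nonneg_right (mul_nonneg (pow_nonneg h0 _) (by positivity))

/-- Fix the noise one time at a time: each replacement before j costs one forgetting bound.
Weakening λ^{k-i} to λ^{j-i} leaves k only in β_k, so the remaining term is a function of the past
of j alone. -/
theorem eLpNorm_splice_le (h : IsForgetting e P Φ C lam β) (he : ∀ i, Measurable (e i))
    (w : ℕ → E) {j k : ℕ} (hjk : j ≤ k) :
    eLpNorm (fun ω => Φ k (splice j w fun i => e i ω)) 2 P
      ≤ ENNReal.ofReal (β k + C * pastSum lam w j) := by
  have hterm : ∀ i, 0 ≤ C * lam ^ (k - i) * (1 + ‖w i‖) := fun i =>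
    mul_nonneg (mul_nonneg h.nonneg_C (pow_nonneg h.lam_nonneg _)) (by positivity)
  have key : ∀ m ≤ k, eLpNorm (fun ω => Φ k (splice m w fun i => e i ω)) 2 P
      ≤ ENNReal.ofReal (β k + ∑ i ∈ Finset.range m, C * lam ^ (k - i) * (1 + ‖w i‖)) := by
    intro m
    induction m with
    | zero => intro _; simpa using h.size k
    | succ m ih =>
      intro hm
      have e1 : (fun ω => Φ k (splice (m + 1) w fun i => e i ω))
          = (fun ω => Φ k (splice m w fun i => e i ω))
            + fun ω => Φ k (splice (m + 1) w fun i => e i ω)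
              - Φ k (splice m w fun i => e i ω) := by
        funext ω; simp
      rw [e1]
      have hm1 := (h.measurable_splice_comp he k m w).aestronglyMeasurable (μ := P)
      have hm2 := (h.measurable_splice_comp he k (m + 1) w).aestronglyMeasurable (μ := P)
      refine (eLpNorm_add_le hm1 (hm2.sub hm1) one_le_two).trans ?_
      refine (add_le_add (ih (by omega)) (h.forget w m k (by omega))).trans (le_of_eq ?_)
      rw [← ENNReal.ofReal_add (add_nonneg (h.nonneg_β k)
        (Finset.sum_nonneg fun i _ => hterm i)) (hterm m), Finset.sum_range_succ, add_assoc]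
  refine (key j hjk).trans (ENNReal.ofReal_le_ofReal (add_le_add le_rfl ?_))
  rw [pastSum, Finset.mul_sum]
  refine Finset.sum_le_sum fun i hi => ?_
  rw [mul_assoc]
  refine mul_le_mul_of_nonneg_left (mul_le_mul_of_nonneg_right ?_ (by positivity)) h.nonneg_C
  exact pow_le_pow_of_le_one h.lam_nonneg h.lam_lt_one.le (by omega)

/-- The increment of the conditional expectation of `‖Φ_k‖²` at time `j`. -/
noncomputable def increment (he : ∀ i, Measurable (e i)) (P : Measure Ω) (Φ : ℕ → (ℕ → E) → F)
    (k j : ℕ) : Ω → ℝ :=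
  P[fun ω => ‖Φ k fun i => e i ω‖ ^ 2 | pastFiltration e he (j + 1)]
    - P[fun ω => ‖Φ k fun i => e i ω‖ ^ 2 | pastFiltration e he j]

theorem condExp_sq (h : IsForgetting e P Φ C lam β) (he : ∀ i, Measurable (e i))
    (hi : iIndepFun e P) (k j : ℕ) :
    P[fun ω => ‖Φ k fun i => e i ω‖ ^ 2 | pastFiltration e he j]
      =ᵐ[P] fun ω => ∫ ω', ‖Φ k (splice j (fun i => e i ω) fun i => e i ω')‖ ^ 2 ∂P :=
  condExp_pastFiltration he hi j (G := fun w => ‖Φ k w‖ ^ 2) ((h.meas k).norm.pow_const 2)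
    (h.memLp he k).integrable_norm_pow'

/-- The two conditional expectations are second moments over an independent future, with e_j frozen
in one and averaged in the other. Their L² distance is the forgetting bound and the size of the
second is `eLpNorm_splice_le`. -/
theorem abs_increment_le (h : IsForgetting e P Φ C lam β) (he : ∀ i, Measurable (e i))
    (hi : iIndepFun e P) {j k : ℕ} (hjk : j ≤ k) :
    ∀ᵐ ω ∂P, |increment he P Φ k j ω|
      ≤ C * lam ^ (k - j) * (1 + ‖e j ω‖) * (C * lam ^ (k - j) * (1 + ‖e j ω‖)
        + 2 * (β k + C * pastSum lam (fun i => e i ω) j)) := by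
  filter_upwards [h.condExp_sq he hi k (j + 1), h.condExp_sq he hi k j] with ω h1 h2
  rw [increment, Pi.sub_apply, h1, h2]
  refine abs_integral_norm_sq_sub_le
    (h.measurable_splice_comp he k (j + 1) _).aestronglyMeasurable
    (h.measurable_splice_comp he k j _).aestronglyMeasurable
    (mul_nonneg (mul_nonneg h.nonneg_C (pow_nonneg h.lam_nonneg _)) (by positivity))
    (add_nonneg (h.nonneg_β k) (mul_nonneg h.nonneg_C (pastSum_nonneg h.lam_nonneg _ _)))
    (h.forget (fun i => e i ω) j k hjk) (h.eLpNorm_splice_le he _ hjk)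

/-- The sum telescopes. At the upper end causality leaves nothing to average, since Φ_k is
determined by the noise up to k; at the lower end nothing is frozen and the full expectation
appears. -/
theorem ae_sum_increment (h : IsForgetting e P Φ C lam β) (he : ∀ i, Measurable (e i))
    (hi : iIndepFun e P) : ∀ᵐ ω ∂P, ∀ k, ∑ j ∈ Finset.range (k + 1), increment he P Φ k j ω
      = ‖Φ k fun i => e i ω‖ ^ 2 - ∫ ω', ‖Φ k fun i => e i ω'‖ ^ 2 ∂P := by
  rw [ae_all_iff]
  intro k
  filter_upwards [h.condExp_sq he hi k (k + 1), h.condExp_sq he hi k 0] with ω h1 h2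
  simp only [increment, Pi.sub_apply]
  rw [Finset.sum_range_sub fun j =>
    (P[fun ω => ‖Φ k fun i => e i ω‖ ^ 2 | pastFiltration e he j]) ω, h1, h2]
  have e1 : ∀ ω', Φ k (splice (k + 1) (fun i => e i ω) fun i => e i ω') = Φ k fun i => e i ω :=
    fun ω' => h.causal k _ _ fun i hi' => splice_of_lt (by omega) _ _
  simp [e1]

theorem stronglyMeasurable_increment (he : ∀ i, Measurable (e i)) (k j : ℕ) :
    StronglyMeasurable[pastFiltration e he (j + 1)] (increment he P Φ k j) :=
  stronglyMeasurable_condExp.sub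
    (stronglyMeasurable_condExp.mono ((pastFiltration e he).mono (Nat.le_succ j)))

theorem integrable_increment (he : ∀ i, Measurable (e i)) (k j : ℕ) :
    Integrable (increment he P Φ k j) P :=
  integrable_condExp.sub integrable_condExp

theorem condExp_increment (he : ∀ i, Measurable (e i)) (k j : ℕ) :
    P[increment he P Φ k j | pastFiltration e he j] =ᵐ[P] 0 := by
  set G : Ω → ℝ := fun ω => ‖Φ k fun i => e i ω‖ ^ 2
  set 𝓕 := pastFiltration e he
  have e1 := condExp_sub (m := 𝓕 j) (integrable_condExp (m := 𝓕 (j + 1)) (μ := P) (f := G))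
    (integrable_condExp (m := 𝓕 j) (μ := P) (f := G))
  have e2 : P[P[G | 𝓕 (j + 1)] | 𝓕 j] =ᵐ[P] P[G | 𝓕 j] :=
    condExp_condExp_of_le (𝓕.mono (Nat.le_succ j)) (𝓕.le _)
  have e3 : P[P[G | 𝓕 j] | 𝓕 j] = P[G | 𝓕 j] :=
    condExp_of_stronglyMeasurable (𝓕.le j) stronglyMeasurable_condExp integrable_condExp
  filter_upwards [e1, e2] with ω h1 h2
  rw [increment, h1, Pi.sub_apply, h2, e3, sub_self]; rfl

theorem exists_sum_sq_le (h : IsForgetting e P Φ C lam β) :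
    ∃ K : ℝ, 0 ≤ K ∧ ∀ N : ℕ, ∑ k ∈ Finset.range N, β k ^ 2 ≤ K * N := by
  obtain ⟨l, hl⟩ := h.cesaro
  obtain ⟨K, hK⟩ := (Metric.isBounded_range_of_tendsto _ hl).exists_norm_le
  refine ⟨K, (norm_nonneg _).trans (hK _ ⟨0, rfl⟩), fun N => ?_⟩
  rcases N.eq_zero_or_pos with rfl | hN
  · simp
  have hN' : (0 : ℝ) < N := by exact_mod_cast hN
  have h1 := (le_abs_self _).trans (hK _ ⟨N, rfl⟩)
  rwa [inv_mul_le_iff₀ hN', mul_comm] at h1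

end IsForgetting

end StrongLaw

/-! ### Strong law for squared norms of forgetting functionals. -/

section StrongLaw

variable {Ω E F : Type*} {mΩ : MeasurableSpace Ω} {P : Measure Ω} [IsProbabilityMeasure P]
  [NormedAddCommGroup E] [MeasurableSpace E] [BorelSpace E] [StandardBorelSpace E]
  [NormedAddCommGroup F] [MeasurableSpace F] [BorelSpace F] [SecondCountableTopology F]

namespace IsForgetting

variable {e : ℕ → Ω → E} {Φ : ℕ → (ℕ → E) → F} {C lam : ℝ} {β : ℕ → ℝ}

/-- The martingale increment at time `j` of `∑_{k<N} ‖Φ_k‖²`. -/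
noncomputable def sumIncrement (he : ∀ i, Measurable (e i)) (P : Measure Ω) (Φ : ℕ → (ℕ → E) → F)
    (N j : ℕ) : Ω → ℝ := ∑ k ∈ Finset.Ico j N, increment he P Φ k j

/-- The predictable part of the bound on `sumIncrement`. -/
noncomputable def predictableBound (e : ℕ → Ω → E) (lam : ℝ) (β : ℕ → ℝ) (N j : ℕ) (ω : Ω) : ℝ :=
  ∑ k ∈ Finset.Ico j N, lam ^ (k - j) * β k + pastSum lam (fun i => e i ω) j

theorem sum_Ico_pow_le {lam : ℝ} (h0 : 0 ≤ lam) (h1 : lam < 1) (j N : ℕ) :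
    ∑ k ∈ Finset.Ico j N, lam ^ (k - j) ≤ (1 - lam)⁻¹ := by
  rw [Finset.sum_Ico_eq_sum_range]
  simpa using sum_range_pow_le h0 h1 (N - j)

/-- Geometric weights make the sum over k bounded uniformly in N, and the bound has the shape
amplitude × (amplitude + predictable) required by `IsAmplitude.tendsto_array`. -/
theorem abs_sumIncrement_le (h : IsForgetting e P Φ C lam β) (he : ∀ i, Measurable (e i))
    (hi : iIndepFun e P) (N j : ℕ) :
    ∀ᵐ ω ∂P, |sumIncrement he P Φ N j ω|
      ≤ C * (2 + 2 * C * (1 - lam)⁻¹) *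
        ((1 + ‖e j ω‖) * (1 + ‖e j ω‖ + predictableBound e lam β N j ω)) := by
  have hall : ∀ᵐ ω ∂P, ∀ k, j ≤ k → |increment he P Φ k j ω|
      ≤ C * lam ^ (k - j) * (1 + ‖e j ω‖) * (C * lam ^ (k - j) * (1 + ‖e j ω‖)
        + 2 * (β k + C * pastSum lam (fun i => e i ω) j)) := by
    rw [ae_all_iff]; intro k
    by_cases hjk : j ≤ k
    · filter_upwards [h.abs_increment_le he hi hjk] with ω hω _
      exact hω
    · exact Eventually.of_forall fun ω h => absurd h hjk
  filter_upwards [hall] with ω hω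
  have hC := h.nonneg_C
  have h0 := h.lam_nonneg
  have h1 := h.lam_lt_one
  set x := 1 + ‖e j ω‖ with hx
  set G := pastSum lam (fun i => e i ω) j with hG
  set B := ∑ k ∈ Finset.Ico j N, lam ^ (k - j) * β k with hB
  set L := (1 - lam)⁻¹ with hL
  have hx0 : 0 ≤ x := by positivity
  have hG0 : 0 ≤ G := pastSum_nonneg h0 _ _
  have hB0 : 0 ≤ B := Finset.sum_nonneg fun k _ => mul_nonneg (pow_nonneg h0 _) (h.nonneg_β k)
  have hL0 : 0 ≤ L := inv_nonneg.2 (by linarith)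
  have hS := sum_Ico_pow_le h0 h1 j N
  set S := ∑ k ∈ Finset.Ico j N, lam ^ (k - j) with hSdef
  rw [sumIncrement, Finset.sum_apply]
  calc |∑ k ∈ Finset.Ico j N, increment he P Φ k j ω|
      ≤ ∑ k ∈ Finset.Ico j N, |increment he P Φ k j ω| := Finset.abs_sum_le_sum_abs _ _
    _ ≤ ∑ k ∈ Finset.Ico j N,
          (C * x * (C * x + 2 * C * G) * lam ^ (k - j) + 2 * C * x * (lam ^ (k - j) * β k)) := by
        refine Finset.sum_le_sum fun k hk => ?_
        refine (hω k (Finset.mem_Ico.1 hk).1).trans ?_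
        have hp0 : 0 ≤ lam ^ (k - j) := pow_nonneg h0 _
        have hp1 : lam ^ (k - j) ≤ 1 := pow_le_one₀ h0 h1.le
        -- In the quadratic term one of the two factors λ^{k-j} is dropped, so that all terms share
        -- the same weight.
        have : C * lam ^ (k - j) * x * (C * lam ^ (k - j) * x)
            ≤ C * lam ^ (k - j) * x * (C * 1 * x) := by gcongr
        nlinarith
    _ = C * x * (C * x + 2 * C * G) * S + 2 * C * x * B := by
        rw [Finset.sum_add_distrib, ← Finset.mul_sum, ← Finset.mul_sum]
    _ ≤ C * x * (C * x + 2 * C * G) * L + 2 * C * x * B := by gcongr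
    _ ≤ C * (2 + 2 * C * L) * (x * (x + (B + G))) := by
        have e1 : 0 ≤ C * x * G := by positivity
        have e2 : 0 ≤ C * x * x := by positivity
        have e3 : 0 ≤ C * C * L * x * x := by positivity
        have e4 : 0 ≤ C * C * L * x * B := by positivity
        nlinarith

theorem integral_pastSum_sq_le
    (hid : ∀ i, IdentDistrib (e i) (e 0) P P) (hL : MemLp (e 0) 2 P) {lam : ℝ} (h0 : 0 ≤ lam)
    (h1 : lam < 1) (j : ℕ) :
    MemLp (fun ω => pastSum lam (fun i => e i ω) j) 2 P ∧
    ∫ ω, pastSum lam (fun i => e i ω) j ^ 2 ∂P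
      ≤ (1 - lam)⁻¹ * (1 - lam)⁻¹ * ∫ ω, (1 + ‖e 0 ω‖) ^ 2 ∂P := by
  have hξ0 : MemLp (fun ω => 1 + ‖e 0 ω‖) 2 P :=
    MemLp.add (f := fun _ => (1 : ℝ)) (memLp_const 1) hL.norm
  have hidξ : ∀ i, IdentDistrib (fun ω => 1 + ‖e i ω‖) (fun ω => 1 + ‖e 0 ω‖) P P := fun i =>
    (hid i).comp (u := fun x => 1 + ‖x‖) (measurable_norm.const_add 1)
  have hξ : ∀ i, MemLp (fun ω => 1 + ‖e i ω‖) 2 P := fun i => (hidξ i).memLp_iff.2 hξ0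
  have hM : MemLp (fun ω => pastSum lam (fun i => e i ω) j) 2 P :=
    memLp_finsetSum _ fun i _ => (hξ i).const_mul _
  refine ⟨hM, ?_⟩
  set A := ∫ ω, (1 + ‖e 0 ω‖) ^ 2 ∂P with hA
  have hAi : ∀ i, ∫ ω, (1 + ‖e i ω‖) ^ 2 ∂P = A := fun i =>
    ((hidξ i).comp (u := fun x => x ^ 2) (by fun_prop)).integral_eq
  have hgi : Integrable
      (fun ω => (1 - lam)⁻¹ * geomFilter lam (fun i => (1 + ‖e i ω‖) ^ 2) j) P :=
    (integrable_finsetSum _ fun i _ => ((hξ i).integrable_sq.const_mul _)).const_mul _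
  refine (integral_mono hM.integrable_sq hgi fun ω => ?_).trans ?_
  · refine le_trans ?_ (sq_geomFilter_le h0 h1 _ j)
    exact pow_le_pow_left₀ (pastSum_nonneg h0 _ _) (pastSum_le h0 _ _) 2
  · rw [integral_const_mul, mul_assoc]
    refine mul_le_mul_of_nonneg_left ?_ (inv_nonneg.2 (by linarith))
    simp only [geomFilter]
    rw [integral_finsetSum _ fun i _ => ((hξ i).integrable_sq.const_mul _)]
    simp_rw [integral_const_mul, hAi]
    rw [← Finset.sum_mul]
    refine mul_le_mul_of_nonneg_right ?_ (integral_nonneg fun ω => sq_nonneg _)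
    simpa [geomFilter] using geomFilter_one_le h0 h1 j

theorem tendsto_subseq (h : IsForgetting e P Φ C lam β) (he : ∀ i, Measurable (e i))
    (hi : iIndepFun e P) (hid : ∀ i, IdentDistrib (e i) (e 0) P P) (hL2 : MemLp (e 0) 2 P)
    {c : ℝ} (hc : 1 < c) :
    ∀ᵐ ω ∂P, Tendsto (fun n : ℕ => (⌊c ^ n⌋₊ : ℝ)⁻¹ * ∑ k ∈ Finset.range ⌊c ^ n⌋₊,
      (‖Φ k fun i => e i ω‖ ^ 2 - ∫ ω', ‖Φ k fun i => e i ω'‖ ^ 2 ∂P)) atTop (𝓝 0) := by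
  have hC := h.nonneg_C
  have h0 := h.lam_nonneg
  have h1 := h.lam_lt_one
  have hamp := isAmplitude_norm he hi hid hL2
  set 𝓕 := pastFiltration e he with h𝓕
  set L := (1 - lam)⁻¹ with hL
  have hL0 : 0 ≤ L := inv_nonneg.2 (by linarith)
  obtain ⟨K, hK0, hK⟩ := h.exists_sum_sq_le
  set A := ∫ ω, (1 + ‖e 0 ω‖) ^ 2 ∂P with hA
  set B : ℕ → ℕ → ℝ := fun N j => ∑ k ∈ Finset.Ico j N, lam ^ (k - j) * β k with hB
  have hB0 : ∀ N j, 0 ≤ B N j := fun N j =>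
    Finset.sum_nonneg fun k _ => mul_nonneg (pow_nonneg h0 _) (h.nonneg_β k)
  have hpast := fun j => integral_pastSum_sq_le hid hL2 h0 h1 j
  have hHL : ∀ N j, MemLp (predictableBound e lam β N j) 2 P := fun N j =>
    MemLp.add (f := fun _ => B N j) (memLp_const _) (hpast j).1
  -- One factor L comes from Cauchy–Schwarz in the weights, the other from exchanging the anticausal
  -- double sum.
  have hBsq : ∀ N, ∑ j ∈ Finset.range N, B N j ^ 2 ≤ L * (L * (K * N)) := by
    intro N
    calc ∑ j ∈ Finset.range N, B N j ^ 2
        ≤ ∑ j ∈ Finset.range N, L * ∑ k ∈ Finset.Ico j N, lam ^ (k - j) * β k ^ 2 := by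
          refine Finset.sum_le_sum fun j _ => ?_
          refine (sq_weighted_sum_le _ fun k _ => pow_nonneg h0 _).trans ?_
          exact mul_le_mul_of_nonneg_right (sum_Ico_pow_le h0 h1 j N)
            (Finset.sum_nonneg fun k _ => mul_nonneg (pow_nonneg h0 _) (sq_nonneg _))
      _ ≤ L * (L * ∑ k ∈ Finset.range N, β k ^ 2) := by
          rw [← Finset.mul_sum]
          exact mul_le_mul_of_nonneg_left
            (sum_anticausal_le h0 h1 (fun k => sq_nonneg (β k)) N) hL0
      _ ≤ L * (L * (K * N)) := by gcongr; exact hK N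
  have hB1 : ∀ N, ∑ j ∈ Finset.range N, B N j ≤ L * ((1 + K) * N) := by
    intro N
    refine (sum_anticausal_le h0 h1 h.nonneg_β N).trans (mul_le_mul_of_nonneg_left ?_ hL0)
    calc ∑ k ∈ Finset.range N, β k ≤ ∑ k ∈ Finset.range N, (1 + β k ^ 2) :=
          Finset.sum_le_sum fun k _ => by nlinarith [sq_nonneg (β k - 1)]
      _ = N + ∑ k ∈ Finset.range N, β k ^ 2 := by rw [Finset.sum_add_distrib]; simp
      _ ≤ N + K * N := by gcongr; exact hK N
      _ = (1 + K) * N := by ring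
  have hsum : ∀ N : ℕ, ∑ j ∈ Finset.range N, ∫ ω, predictableBound e lam β N j ω ^ 2 ∂P
      ≤ (2 * (L * (L * K)) + 2 * (L * L * A)) * N := by
    intro N
    have hj : ∀ j, ∫ ω, predictableBound e lam β N j ω ^ 2 ∂P
        ≤ 2 * B N j ^ 2 + 2 * (L * L * A) := by
      intro j
      have hi2 : Integrable (fun ω => 2 * B N j ^ 2
          + 2 * pastSum lam (fun i => e i ω) j ^ 2) P :=
        (integrable_const _).add ((hpast j).1.integrable_sq.const_mul 2)
      refine (integral_mono (hHL N j).integrable_sq hi2 fun ω => ?_).trans ?_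
      · simp only [predictableBound]
        nlinarith [sq_nonneg (B N j - pastSum lam (fun i => e i ω) j)]
      · rw [integral_add (integrable_const _) ((hpast j).1.integrable_sq.const_mul 2)]
        simp only [integral_const, probReal_univ, one_smul, integral_const_mul]
        linarith [(hpast j).2]
    calc _ ≤ ∑ j ∈ Finset.range N, (2 * B N j ^ 2 + 2 * (L * L * A)) :=
          Finset.sum_le_sum fun j _ => hj j
      _ = 2 * ∑ j ∈ Finset.range N, B N j ^ 2 + N * (2 * (L * L * A)) := by
          rw [Finset.sum_add_distrib, ← Finset.mul_sum]; simp
      _ ≤ 2 * (L * (L * (K * N))) + N * (2 * (L * L * A)) := by linarith [hBsq N]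
      _ = _ := by ring
  have hae : ∀ᵐ ω ∂P, ∃ K' : ℝ, ∀ N : ℕ,
      ∑ j ∈ Finset.range N, predictableBound e lam β N j ω ≤ K' * N := by
    filter_upwards [hamp.ae_exists_sum_le] with ω ⟨K', hK'⟩
    refine ⟨L * (1 + K) + L * K', fun N => ?_⟩
    simp only [predictableBound]
    rw [Finset.sum_add_distrib]
    have e1 : ∑ j ∈ Finset.range N, pastSum lam (fun i => e i ω) j ≤ L * (K' * N) := by
      refine (Finset.sum_le_sum fun j _ => pastSum_le h0 _ j).trans ?_
      refine (sum_geomFilter_le h0 h1 (fun i => by positivity) N).trans ?_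
      exact mul_le_mul_of_nonneg_left (hK' N) hL0
    have e2 := hB1 N
    calc _ ≤ L * ((1 + K) * N) + L * (K' * N) := add_le_add e2 e1
      _ = _ := by ring
  have hHm : ∀ N j, StronglyMeasurable[𝓕 j] (predictableBound e lam β N j) := by
    intro N j
    refine stronglyMeasurable_const.add ?_
    refine Finset.stronglyMeasurable_fun_sum _ fun i hi => ?_
    have hm : Measurable[𝓕 j] (e i) := measurable_pastFiltration e he (Finset.mem_range.1 hi)
    exact (((measurable_norm.comp hm).const_add 1).const_mul _).stronglyMeasurable
  have hΔ0 : ∀ N j, P[sumIncrement he P Φ N j | 𝓕 j] =ᵐ[P] 0 := by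
    intro N j
    have e1 := condExp_finsetSum (m := 𝓕 j) (s := Finset.Ico j N)
      (f := fun k => increment he P Φ k j) (fun k _ => integrable_increment he k j)
    have e2 : ∀ᵐ ω ∂P, ∀ k, (P[increment he P Φ k j | 𝓕 j]) ω = 0 := by
      rw [ae_all_iff]; exact fun k => condExp_increment he k j
    refine EventuallyEq.trans e1 ?_
    filter_upwards [e2] with ω hω
    simp [Finset.sum_apply, hω]
  have hmain := hamp.tendsto_array (Δ := fun N j => sumIncrement he P Φ N j)
    (H := fun N j => predictableBound e lam β N j) (C := C * (2 + 2 * C * L)) (by positivity)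
    (fun N j => Finset.stronglyMeasurable_sum _ fun k _ => stronglyMeasurable_increment he k j)
    (fun N j => integrable_finsetSum' _ fun k _ => integrable_increment he k j)
    hΔ0 hHm (fun N j ω => add_nonneg (hB0 N j) (pastSum_nonneg h0 _ _)) hHL
    (fun N j => h.abs_sumIncrement_le he hi N j) hsum hae hc
  -- Exchanging the sums over j ≤ k < N identifies the row sums of the array with the centred sums.
  filter_upwards [hmain, h.ae_sum_increment he hi] with ω hω hs
  refine hω.congr fun n => ?_
  congr 1
  simp_rw [← hs, sumIncrement, Finset.sum_apply]
  exact Finset.sum_comm' fun j k => by simp only [Finset.mem_range, Finset.mem_Ico]; omega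

/-- **Strong law of large numbers** for the squared norms of exponentially forgetting functionals
of i.i.d. square integrable noise. -/
theorem strong_law (h : IsForgetting e P Φ C lam β) (he : ∀ i, Measurable (e i))
    (hi : iIndepFun e P) (hid : ∀ i, IdentDistrib (e i) (e 0) P P) (hL2 : MemLp (e 0) 2 P) :
    ∀ᵐ ω ∂P, Tendsto (fun N : ℕ => (N : ℝ)⁻¹ * ∑ k ∈ Finset.range N,
      (‖Φ k fun i => e i ω‖ ^ 2 - ∫ ω', ‖Φ k fun i => e i ω'‖ ^ 2 ∂P)) atTop (𝓝 0) := by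
  obtain ⟨l, hl⟩ := h.cesaro
  -- Countably many ratios tending to 1: a single null set covers all geometric subsequences, as the
  -- interpolation argument requires.
  set c : ℕ → ℝ := fun m => 1 + ((m : ℝ) + 1)⁻¹ with hcdef
  have hc1 : ∀ m, 1 < c m := fun m => by simp only [hcdef]; linarith [inv_pos.2 (by positivity : (0:ℝ) < m + 1)]
  have hclim : Tendsto c atTop (𝓝 1) := by
    have := (tendsto_one_div_add_atTop_nhds_zero_nat (𝕜 := ℝ)).const_add 1
    simpa [hcdef] using this
  have hall : ∀ᵐ ω ∂P, ∀ m : ℕ, Tendsto (fun n : ℕ => (⌊c m ^ n⌋₊ : ℝ)⁻¹ *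
      ∑ k ∈ Finset.range ⌊c m ^ n⌋₊,
      (‖Φ k fun i => e i ω‖ ^ 2 - ∫ ω', ‖Φ k fun i => e i ω'‖ ^ 2 ∂P)) atTop (𝓝 0) := by
    rw [ae_all_iff]; exact fun m => h.tendsto_subseq he hi hid hL2 (hc1 m)
  filter_upwards [hall] with ω hω
  set D : ℕ → ℝ := fun N => ∑ k ∈ Finset.range N,
    (‖Φ k fun i => e i ω‖ ^ 2 - ∫ ω', ‖Φ k fun i => e i ω'‖ ^ 2 ∂P) with hD
  set W : ℕ → ℝ := fun N => ∑ k ∈ Finset.range N, β k ^ 2 with hW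
  -- The centred sums are not monotone; adding ∑ β_k² makes every increment nonnegative, since β_k²
  -- dominates the subtracted expectation. The added term can be removed at the end because its
  -- Cesàro means converge.
  have hmono : Monotone fun N => D N + W N := by
    refine monotone_nat_of_le_succ fun N => ?_
    simp only [hD, hW, Finset.sum_range_succ]
    have e1 := integral_norm_sq_le (h.measurable_comp he N).aestronglyMeasurable
      (h.nonneg_β N) (h.size N)
    have e2 := sq_nonneg ‖Φ N fun i => e i ω‖
    linarith
  have hlim : Tendsto (fun N : ℕ => (D N + W N) / N) atTop (𝓝 l) := by
    refine tendsto_div_of_monotone_of_tendsto_div_floor_pow _ l hmono c hc1 hclim fun m => ?_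
    have hfl : Tendsto (fun n : ℕ => ⌊c m ^ n⌋₊) atTop atTop :=
      tendsto_nat_floor_atTop.comp (tendsto_pow_atTop_atTop_of_one_lt (hc1 m))
    have h3 := (hω m).add (hl.comp hfl)
    rw [zero_add] at h3
    refine h3.congr fun n => ?_
    simp only [Function.comp, hD, hW]
    rw [← mul_add, div_eq_inv_mul]
  have := hlim.sub hl
  rw [sub_self] at this
  refine this.congr fun N => ?_
  rw [div_eq_inv_mul, mul_add, add_sub_cancel_right]

end IsForgetting

end StrongLaw

/-! ### The regressor dynamics: causality, restarting and measurability. -/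

section Dynamics

variable {na nb ny nu : ℕ}

/-- A noise sequence indexed by the natural numbers, seen as a two-sided sequence. -/
def extendNoise {E : Type*} (w : ℕ → E) : ℤ → E := fun i => w i.toNat

@[simp] theorem extendNoise_natCast {E : Type*} (w : ℕ → E) (k : ℕ) : extendNoise w k = w k := rfl

theorem nextRegressor_regressor (y : ℤ → EuclideanSpace ℝ (Fin ny))
    (u : ℤ → EuclideanSpace ℝ (Fin nu)) (k : ℤ) :
    nextRegressor (regressor na nb y u k) (y k) (u (k + 1)) = regressor na nb y u (k + 1) := by
  ext i
  rcases i with ⟨i, c⟩ | ⟨i, c⟩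
  · simp only [nextRegressor, regressor, Sum.elim_inl]
    split_ifs with h
    · simp [h]
    · have : k - 1 - ((i.val - 1 : ℕ) : ℤ) = k + 1 - 1 - (i.val : ℤ) := by omega
      rw [this]
  · simp only [nextRegressor, regressor, Sum.elim_inr]
    split_ifs with h
    · simp [h]
    · have : k - ((i.val - 1 : ℕ) : ℤ) = k + 1 - (i.val : ℤ) := by omega
      rw [this]

theorem regressor_congr {y y' : ℤ → EuclideanSpace ℝ (Fin ny)}
    {u : ℤ → EuclideanSpace ℝ (Fin nu)} {k : ℤ}
    (h : ∀ i, k - na ≤ i → i < k → y i = y' i) :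
    regressor na nb y u k = regressor na nb y' u k := by
  ext i
  rcases i with ⟨i, c⟩ | ⟨i, c⟩
  · simp only [regressor, Sum.elim_inl]
    rw [h _ (by have := i.isLt; omega) (by omega)]
  · rfl

/-- The shifted entries coincide, so only the newest blocks contribute. -/
theorem norm_nextRegressor_sub_le (x : Regressor na nb ny nu) (a b : EuclideanSpace ℝ (Fin ny))
    (v v' : EuclideanSpace ℝ (Fin nu)) :
    ‖nextRegressor x a v - nextRegressor x b v'‖ ≤ ‖a - b‖ + ‖v - v'‖ := by
  -- An inequality rather than an equality, because with n = 0 lags there is no slot for the new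
  -- value.
  have key : ∀ (n m : ℕ) (d : Fin m → ℝ),
      ∑ i : Fin n × Fin m, (if i.1.val = 0 then d i.2 else 0) ^ 2 ≤ ∑ c, d c ^ 2 := by
    intro n m d
    rw [Fintype.sum_prod_type, Finset.sum_comm]
    refine Finset.sum_le_sum fun c _ => ?_
    cases n with
    | zero => simp; positivity
    | succ n =>
      rw [Finset.sum_eq_single (0 : Fin (n + 1))]
      · simp
      · intro i _ hi
        have : i.val ≠ 0 := fun h => hi (Fin.ext h)
        simp [this]
      · simp
  have hsq : ‖nextRegressor x a v - nextRegressor x b v'‖ ^ 2 ≤ ‖a - b‖ ^ 2 + ‖v - v'‖ ^ 2 := by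
    rw [EuclideanSpace.real_norm_sq_eq, EuclideanSpace.real_norm_sq_eq,
      EuclideanSpace.real_norm_sq_eq, Fintype.sum_sum_type]
    refine add_le_add (le_trans (le_of_eq ?_) (key na ny (a - b).ofLp))
      (le_trans (le_of_eq ?_) (key (nb + 1) nu (v - v').ofLp))
    · refine Finset.sum_congr rfl fun i _ => ?_
      simp only [nextRegressor, PiLp.sub_apply, Sum.elim_inl]
      split_ifs <;> simp
    · refine Finset.sum_congr rfl fun i _ => ?_
      simp only [nextRegressor, PiLp.sub_apply, Sum.elim_inr]
      split_ifs <;> simp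
  refine abs_le_of_sq_le_sq' ?_ (by positivity) |>.2
  nlinarith [mul_nonneg (norm_nonneg (a - b)) (norm_nonneg (v - v'))]

theorem nextRegressor_zero : nextRegressor (0 : Regressor na nb ny nu) 0 0 = 0 := by
  ext i
  rcases i with ⟨i, c⟩ | ⟨i, c⟩ <;> simp [nextRegressor]

theorem norm_nextRegressor_zero_le (a : EuclideanSpace ℝ (Fin ny))
    (v : EuclideanSpace ℝ (Fin nu)) :
    ‖nextRegressor (0 : Regressor na nb ny nu) a v‖ ≤ ‖a‖ + ‖v‖ := by
  simpa [nextRegressor_zero] using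
    norm_nextRegressor_sub_le (0 : Regressor na nb ny nu) a 0 v 0

variable {f : Regressor na nb ny nu → EuclideanSpace ℝ (Fin ny)}
  {u : ℤ → EuclideanSpace ℝ (Fin nu)} {e e' : ℤ → EuclideanSpace ℝ (Fin ny)}

theorem stateFrom_congr {k₀ : ℕ} {x₀ : Regressor na nb ny nu} :
    ∀ {m : ℕ}, (∀ i < m, e (k₀ + i : ℤ) = e' (k₀ + i : ℤ)) →
      stateFrom f u e k₀ x₀ m = stateFrom f u e' k₀ x₀ m
  | 0, _ => rfl
  | m + 1, h => by
    rw [stateFrom, stateFrom, stateFrom_congr fun i hi => h i (by omega), h m (by omega)]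

theorem outputFrom_congr {k₀ : ℕ} {x₀ : Regressor na nb ny nu} {m : ℕ}
    (h : ∀ i ≤ m, e (k₀ + i : ℤ) = e' (k₀ + i : ℤ)) :
    outputFrom f u e k₀ x₀ m = outputFrom f u e' k₀ x₀ m := by
  rw [outputFrom, outputFrom, stateFrom_congr fun i hi => h i hi.le, h m le_rfl]

theorem stateFrom_add (k₀ a : ℕ) (x₀ : Regressor na nb ny nu) (m : ℕ) :
    stateFrom f u e k₀ x₀ (a + m) = stateFrom f u e (k₀ + a) (stateFrom f u e k₀ x₀ a) m := by
  induction m with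
  | zero => rfl
  | succ m ih =>
    rw [← add_assoc, stateFrom, stateFrom, ih]
    push_cast
    simp only [add_assoc]

theorem outputFrom_add (k₀ a : ℕ) (x₀ : Regressor na nb ny nu) (m : ℕ) :
    outputFrom f u e k₀ x₀ (a + m) = outputFrom f u e (k₀ + a) (stateFrom f u e k₀ x₀ a) m := by
  rw [outputFrom, outputFrom, stateFrom_add]
  push_cast
  rw [add_assoc (k₀ : ℤ)]

theorem outputFrom_succ (k₀ : ℕ) (x₀ : Regressor na nb ny nu) (m : ℕ) :
    outputFrom f u e k₀ x₀ (m + 1)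
      = outputFrom f u e (k₀ + 1) (nextRegressor x₀ (f x₀ + e k₀) (u (k₀ + 1))) m := by
  rw [add_comm m 1, outputFrom_add]
  simp [stateFrom]

theorem simulate_natCast (y₀ : ℤ → EuclideanSpace ℝ (Fin ny)) (k : ℕ) :
    simulate f u e y₀ k = outputFrom f u e 0 (regressor na nb y₀ u 0) k := by
  simp [simulate]

theorem simulate_of_neg (y₀ : ℤ → EuclideanSpace ℝ (Fin ny)) {k : ℤ} (hk : k < 0) :
    simulate f u e y₀ k = y₀ k := if_pos hk

theorem simulate_congr {y₀ : ℤ → EuclideanSpace ℝ (Fin ny)} {k : ℤ}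
    (h : ∀ i : ℕ, (i : ℤ) ≤ k → e i = e' i) : simulate f u e y₀ k = simulate f u e' y₀ k := by
  rcases lt_or_ge k 0 with hk | hk
  · rw [simulate_of_neg _ hk, simulate_of_neg _ hk]
  · lift k to ℕ using hk
    rw [simulate_natCast, simulate_natCast]
    exact outputFrom_congr fun i hi => by simpa using h i (by exact_mod_cast hi)

/-- A record that obeys the system equations from time `0` on is the simulated one. -/
theorem simulate_eq_self {y : ℤ → EuclideanSpace ℝ (Fin ny)}
    (h : ∀ k : ℤ, 0 ≤ k → y k = f (regressor na nb y u k) + e k) (k : ℤ) :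
    simulate f u e y k = y k := by
  have hst : ∀ m : ℕ, stateFrom f u e 0 (regressor na nb y u 0) m = regressor na nb y u m := by
    intro m
    induction m with
    | zero => rfl
    | succ m ih =>
      rw [stateFrom, ih]
      simp only [Nat.cast_zero, zero_add]
      rw [← h m (by positivity), nextRegressor_regressor]
      simp
  rcases lt_or_ge k 0 with hk | hk
  · exact simulate_of_neg _ hk
  · lift k to ℕ using hk
    rw [simulate_natCast, outputFrom, hst, h k (by positivity)]
    simp

theorem simulate_congr_initial {y₀ y₁ : ℤ → EuclideanSpace ℝ (Fin ny)}
    (h : ∀ i, -(na : ℤ) ≤ i → i < 0 → y₀ i = y₁ i) {k : ℤ} (hk : -(na : ℤ) ≤ k) :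
    simulate f u e y₀ k = simulate f u e y₁ k := by
  rcases lt_or_ge k 0 with hk' | hk'
  · rw [simulate_of_neg _ hk', simulate_of_neg _ hk', h k hk hk']
  · lift k to ℕ using hk'
    rw [simulate_natCast, simulate_natCast,
      regressor_congr fun i hi hi' => h i (by simpa using hi) hi']

theorem measurable_nextRegressor :
    Measurable fun p : Regressor na nb ny nu × EuclideanSpace ℝ (Fin ny) ×
      EuclideanSpace ℝ (Fin nu) => nextRegressor p.1 p.2.1 p.2.2 := by
  refine (WithLp.measurable_toLp 2 _).comp (measurable_pi_lambda _ fun i => ?_)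
  rcases i with ⟨i, c⟩ | ⟨i, c⟩
  · simp only [Sum.elim_inl]
    split_ifs <;> fun_prop
  · simp only [Sum.elim_inr]
    split_ifs <;> fun_prop

variable {α : Type*} [MeasurableSpace α]

theorem measurable_regressor {y : ℤ → α → EuclideanSpace ℝ (Fin ny)}
    {u : ℤ → α → EuclideanSpace ℝ (Fin nu)} (hy : ∀ k, Measurable (y k))
    (hu : ∀ k, Measurable (u k)) (k : ℤ) :
    Measurable fun a => regressor na nb (fun i => y i a) (fun i => u i a) k := by
  refine (WithLp.measurable_toLp 2 _).comp (measurable_pi_lambda _ fun i => ?_)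
  rcases i with ⟨i, c⟩ | ⟨i, c⟩
  · simp only [Sum.elim_inl]; fun_prop
  · simp only [Sum.elim_inr]; fun_prop

theorem measurable_stateFrom (hf : Measurable f) {u : ℤ → α → EuclideanSpace ℝ (Fin nu)}
    {e : ℤ → α → EuclideanSpace ℝ (Fin ny)} (hu : ∀ k, Measurable (u k))
    (he : ∀ k, Measurable (e k)) {x : α → Regressor na nb ny nu} (hx : Measurable x) (k₀ m : ℕ) :
    Measurable fun a => stateFrom f (fun i => u i a) (fun i => e i a) k₀ (x a) m := by
  induction m with
  | zero => exact hx
  | succ m ih =>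
    exact measurable_nextRegressor.comp
      (ih.prodMk (((hf.comp ih).add (he _)).prodMk (hu _)))

theorem measurable_outputFrom (hf : Measurable f) {u : ℤ → α → EuclideanSpace ℝ (Fin nu)}
    {e : ℤ → α → EuclideanSpace ℝ (Fin ny)} (hu : ∀ k, Measurable (u k))
    (he : ∀ k, Measurable (e k)) {x : α → Regressor na nb ny nu} (hx : Measurable x) (k₀ m : ℕ) :
    Measurable fun a => outputFrom f (fun i => u i a) (fun i => e i a) k₀ (x a) m :=
  (hf.comp (measurable_stateFrom hf hu he hx k₀ m)).add (he _)

theorem measurable_simulate (hf : Measurable f) {u : ℤ → α → EuclideanSpace ℝ (Fin nu)}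
    {e y₀ : ℤ → α → EuclideanSpace ℝ (Fin ny)} (hu : ∀ k, Measurable (u k))
    (he : ∀ k, Measurable (e k)) (hy : ∀ k, Measurable (y₀ k)) (k : ℤ) :
    Measurable fun a => simulate f (fun i => u i a) (fun i => e i a) (fun i => y₀ i a) k := by
  by_cases hk : k < 0
  · simp only [simulate, hk, if_true]; exact hy k
  · simp only [simulate, hk, if_false]
    exact measurable_outputFrom hf hu he (measurable_regressor hy hu 0) 0 _

end Dynamics

/-! ### From local fourth-moment stability to global mean-square stability. -/

section Stability

variable {Ω : Type*} {mΩ : MeasurableSpace Ω} {P : Measure Ω} [IsProbabilityMeasure P]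
  {na nb ny nu : ℕ}

/-- Exponential stability in mean square of the system driven by the fixed input `v`, for
arbitrary pairs of initial regressors. -/
def MeanSquareStable (f : Regressor na nb ny nu → EuclideanSpace ℝ (Fin ny))
    (v : ℤ → EuclideanSpace ℝ (Fin nu)) (e : ℕ → Ω → EuclideanSpace ℝ (Fin ny)) (P : Measure Ω)
    (C lam : ℝ) : Prop :=
  ∀ (k₀ m : ℕ) (x₀ x₁ : Regressor na nb ny nu),
    eLpNorm (fun ω => outputFrom f v (extendNoise fun i => e i ω) k₀ x₀ m
      - outputFrom f v (extendNoise fun i => e i ω) k₀ x₁ m) 2 P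
      ≤ ENNReal.ofReal (C * lam ^ m * (1 + ‖x₀ - x₁‖))

theorem measurable_extendNoise_comp {E : Type*} [MeasurableSpace E] {e : ℕ → Ω → E}
    (he : ∀ i, Measurable (e i)) (i : ℤ) : Measurable fun ω => extendNoise (fun i => e i ω) i :=
  he _

theorem measurable_outputFrom_noise {f : Regressor na nb ny nu → EuclideanSpace ℝ (Fin ny)}
    (hf : Measurable f) (v : ℤ → EuclideanSpace ℝ (Fin nu))
    {e : ℕ → Ω → EuclideanSpace ℝ (Fin ny)} (he : ∀ i, Measurable (e i))
    {x : Ω → Regressor na nb ny nu} (hx : Measurable x) (k₀ m : ℕ) :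
    Measurable fun ω => outputFrom f v (extendNoise fun i => e i ω) k₀ (x ω) m :=
  measurable_outputFrom (u := fun i _ => v i)
    (e := fun i ω => extendNoise (fun i => e i ω) i) hf (fun _ => measurable_const)
    (measurable_extendNoise_comp he) hx k₀ m

/-- Local fourth moment stability chains up to mean square stability with linear growth in the
distance of the initial regressors. -/
theorem exists_meanSquareStable {f : Regressor na nb ny nu → EuclideanSpace ℝ (Fin ny)}
    (hf : Measurable f) {v : ℤ → EuclideanSpace ℝ (Fin nu)}
    {e : ℕ → Ω → EuclideanSpace ℝ (Fin ny)} (he : ∀ i, Measurable (e i)) {C lam : ℝ}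
    (hC : 0 ≤ C) (h0 : 0 ≤ lam) (h1 : lam < 1)
    (hst : ∀ (k₀ : ℕ) (x₀ x₁ : Regressor na nb ny nu), ‖x₀ - x₁‖ < 2 → ∀ m : ℕ,
      ∫⁻ ω, ‖outputFrom f v (extendNoise fun i => e i ω) k₀ x₀ m
          - outputFrom f v (extendNoise fun i => e i ω) k₀ x₁ m‖ₑ ^ 4 ∂P
        < ENNReal.ofReal (C * lam ^ m)) :
    ∃ C' lam' : ℝ, 0 ≤ C' ∧ 0 ≤ lam' ∧ lam' < 1 ∧ MeanSquareStable f v e P C' lam' := by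
  have hroot : ∀ x : ℝ, 0 ≤ x → (x ^ (1 / 4 : ℝ)) ^ 4 = x := fun x hx => by
    rw [← Real.rpow_natCast, ← Real.rpow_mul hx]; norm_num
  -- The fourth roots appear because the L² norm is bounded by the L⁴ norm on a probability space.
  set c := C ^ (1 / 4 : ℝ) with hc
  set l := lam ^ (1 / 4 : ℝ) with hl
  have hc0 : 0 ≤ c := Real.rpow_nonneg hC _
  have hl0 : 0 ≤ l := Real.rpow_nonneg h0 _
  have hl1 : l < 1 := Real.rpow_lt_one h0 h1 (by norm_num)
  refine ⟨2 * c, l, by positivity, hl0, hl1, fun k₀ m => ?_⟩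
  set a := c * l ^ m with ha
  have ha0 : 0 ≤ a := by positivity
  set D : Regressor na nb ny nu → Ω → EuclideanSpace ℝ (Fin ny) := fun x ω =>
    outputFrom f v (extendNoise fun i => e i ω) k₀ x m with hD
  have hDm : ∀ x, AEStronglyMeasurable (D x) P := fun x =>
    (measurable_outputFrom_noise hf v he measurable_const k₀ m).aestronglyMeasurable
  have hloc : ∀ x₀ x₁, ‖x₀ - x₁‖ < 2 →
      eLpNorm (fun ω => D x₀ ω - D x₁ ω) 2 P ≤ ENNReal.ofReal a := by
    intro x₀ x₁ hx
    have hm : AEStronglyMeasurable (fun ω => D x₀ ω - D x₁ ω) P := (hDm x₀).sub (hDm x₁)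
    refine (eLpNorm_le_eLpNorm_of_exponent_le (q := 4) (by norm_num) hm).trans ?_
    rw [eLpNorm_eq_lintegral_rpow_enorm_toReal (by norm_num) (by norm_num)]
    have h4 : (4 : ENNReal).toReal = 4 := by norm_num
    rw [h4, one_div, ENNReal.rpow_inv_le_iff (by norm_num)]
    have h5 := (hst k₀ x₀ x₁ hx m).le
    have h6 : ENNReal.ofReal (C * lam ^ m) = ENNReal.ofReal a ^ (4 : ℝ) := by
      rw [show (4 : ℝ) = ((4 : ℕ) : ℝ) by norm_num, ENNReal.rpow_natCast,
        ← ENNReal.ofReal_pow ha0, ha, mul_pow, hroot C hC, ← pow_mul, mul_comm m 4, pow_mul,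
        hroot lam h0]
    rw [← h6]
    refine le_trans (le_of_eq ?_) h5
    refine lintegral_congr fun ω => ?_
    rw [show (4 : ℝ) = ((4 : ℕ) : ℝ) by norm_num, ENNReal.rpow_natCast]
  have hchain : ∀ (n : ℕ) x₀ x₁, ‖x₀ - x₁‖ ≤ n →
      eLpNorm (fun ω => D x₀ ω - D x₁ ω) 2 P ≤ ENNReal.ofReal (n * a) := by
    intro n
    induction n with
    | zero =>
      intro x₀ x₁ hx
      have : x₀ = x₁ := sub_eq_zero.1 (norm_le_zero_iff.1 (by simpa using hx))
      simp [this]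
    | succ n ih =>
      intro x₀ x₁ hx
      -- A segment of length at most n + 1 splits into a piece of length at most n and a last piece
      -- of length at most 1, within the radius 2 where local stability holds. Summing the pieces
      -- costs a factor linear in the distance.
      set x' := x₁ + ((n : ℝ) / (n + 1)) • (x₀ - x₁) with hx'
      have hn : (0 : ℝ) < n + 1 := by positivity
      push_cast at hx
      have e1 : ‖x' - x₁‖ ≤ n := by
        rw [hx', add_sub_cancel_left, norm_smul, Real.norm_of_nonneg (by positivity),
          div_mul_eq_mul_div, div_le_iff₀ hn]
        gcongr
      have e2 : ‖x₀ - x'‖ < 2 := by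
        have : x₀ - x' = ((1 : ℝ) / (n + 1)) • (x₀ - x₁) := by
          have h7 : (1 : ℝ) / (n + 1) = 1 - n / (n + 1) := by field_simp; ring
          rw [h7, sub_smul, one_smul, hx']; abel
        rw [this, norm_smul, Real.norm_of_nonneg (by positivity), div_mul_eq_mul_div, one_mul,
          div_lt_iff₀ hn]
        linarith
      have e3 : (fun ω => D x₀ ω - D x₁ ω)
          = (fun ω => D x₀ ω - D x' ω) + fun ω => D x' ω - D x₁ ω := by
        funext ω; simp
      rw [e3]
      refine (eLpNorm_add_le ((hDm _).sub (hDm _)) ((hDm _).sub (hDm _)) one_le_two).trans ?_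
      refine (add_le_add (hloc _ _ e2) (ih _ _ e1)).trans (le_of_eq ?_)
      rw [← ENNReal.ofReal_add ha0 (by positivity)]
      congr 1; push_cast; ring
  intro x₀ x₁
  refine (hchain ⌈‖x₀ - x₁‖⌉₊ x₀ x₁ (Nat.le_ceil _)).trans (ENNReal.ofReal_le_ofReal ?_)
  have h8 : (⌈‖x₀ - x₁‖⌉₊ : ℝ) ≤ ‖x₀ - x₁‖ + 1 := (Nat.ceil_lt_add_one (norm_nonneg _)).le
  have h9 := norm_nonneg (x₀ - x₁)
  calc (⌈‖x₀ - x₁‖⌉₊ : ℝ) * a ≤ (‖x₀ - x₁‖ + 1) * a := by gcongr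
    _ ≤ 2 * c * l ^ m * (1 + ‖x₀ - x₁‖) := by rw [ha]; nlinarith [mul_nonneg ha0 h9]

theorem MeanSquareStable.mono {f : Regressor na nb ny nu → EuclideanSpace ℝ (Fin ny)}
    {v : ℤ → EuclideanSpace ℝ (Fin nu)} {e : ℕ → Ω → EuclideanSpace ℝ (Fin ny)} {C lam lam' : ℝ}
    (hC : 0 ≤ C) (h0 : 0 ≤ lam) (hl : lam ≤ lam') (h : MeanSquareStable f v e P C lam) :
    MeanSquareStable f v e P C lam' := fun k₀ m x₀ x₁ =>
  (h k₀ m x₀ x₁).trans (ENNReal.ofReal_le_ofReal (by gcongr))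

theorem lintegral_enorm_sq_le_iff {F : Type*} [NormedAddCommGroup F] {g : Ω → F} {a : ENNReal} :
    ∫⁻ ω, ‖g ω‖ₑ ^ 2 ∂P ≤ a ^ 2 ↔ eLpNorm g 2 P ≤ a := by
  rw [eLpNorm_eq_lintegral_rpow_enorm_toReal (by norm_num) (by norm_num)]
  have h2 : (2 : ENNReal).toReal = 2 := by norm_num
  rw [h2, one_div, ENNReal.rpow_inv_le_iff (by norm_num)]
  rw [show (2 : ℝ) = ((2 : ℕ) : ℝ) by norm_num, ENNReal.rpow_natCast]
  simp_rw [ENNReal.rpow_natCast]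

/-- Stability for initial regressors at time `j + 1` that depend on the noise at time `j`. -/
theorem MeanSquareStable.random_start {f : Regressor na nb ny nu → EuclideanSpace ℝ (Fin ny)}
    (hf : Measurable f) {v : ℤ → EuclideanSpace ℝ (Fin nu)}
    {e : ℕ → Ω → EuclideanSpace ℝ (Fin ny)} (he : ∀ i, Measurable (e i)) (hi : iIndepFun e P)
    {C lam : ℝ} (hC : 0 ≤ C) (h0 : 0 ≤ lam) (h : MeanSquareStable f v e P C lam) {j : ℕ}
    {X₀ X₁ : EuclideanSpace ℝ (Fin ny) → Regressor na nb ny nu} (hX₀ : Measurable X₀)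
    (hX₁ : Measurable X₁) {c σ : ℝ} (hc : 0 ≤ c) (hσ0 : 0 ≤ σ)
    (hσ : eLpNorm (e j) 2 P ≤ ENNReal.ofReal σ) (hX : ∀ z, ‖X₀ z - X₁ z‖ ≤ c + ‖z‖) (m : ℕ) :
    eLpNorm (fun ω => outputFrom f v (extendNoise fun i => e i ω) (j + 1) (X₀ (e j ω)) m
      - outputFrom f v (extendNoise fun i => e i ω) (j + 1) (X₁ (e j ω)) m) 2 P
      ≤ ENNReal.ofReal (C * lam ^ m * (1 + c + σ)) := by
  set G : (ℕ → EuclideanSpace ℝ (Fin ny)) → ENNReal := fun w =>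
    ‖outputFrom f v (extendNoise w) (j + 1) (X₀ (w j)) m
      - outputFrom f v (extendNoise w) (j + 1) (X₁ (w j)) m‖ₑ ^ 2 with hG
  have hGm : Measurable G := by
    have hw : ∀ i, Measurable fun w : ℕ → EuclideanSpace ℝ (Fin ny) => w i := measurable_pi_apply
    have e0 := measurable_outputFrom_noise (Ω := ℕ → EuclideanSpace ℝ (Fin ny)) hf v hw
      (hX₀.comp (hw j)) (j + 1) m
    have e1 := measurable_outputFrom_noise (Ω := ℕ → EuclideanSpace ℝ (Fin ny)) hf v hw
      (hX₁.comp (hw j)) (j + 1) m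
    exact (e0.sub e1).enorm.pow_const 2
  have hp0 : 0 ≤ C * lam ^ m := by positivity
  rw [← lintegral_enorm_sq_le_iff]
  change ∫⁻ ω, G (fun i => e i ω) ∂P ≤ _
  -- With the noise through time j frozen, the initial regressors are deterministic and the outputs
  -- from j + 1 on see only the fresh noise; stability for fixed starts then applies inside.
  rw [lintegral_splice he hi (j + 1) hGm]
  have hinner : ∀ ω, ∫⁻ ω', G (splice (j + 1) (fun i => e i ω) fun i => e i ω') ∂P
      ≤ ENNReal.ofReal (C * lam ^ m) ^ 2 * ‖1 + c + ‖e j ω‖‖ₑ ^ 2 := by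
    intro ω
    have hs : ∀ ω' x, outputFrom f v (extendNoise (splice (j + 1) (fun i => e i ω)
          fun i => e i ω')) (j + 1) x m
        = outputFrom f v (extendNoise fun i => e i ω') (j + 1) x m := by
      intro ω' x
      refine outputFrom_congr fun i _ => ?_
      have : ((j + 1 : ℕ) : ℤ) + (i : ℤ) = ((j + 1 + i : ℕ) : ℤ) := by push_cast; ring
      rw [this, extendNoise_natCast, extendNoise_natCast, splice_of_le (by omega)]
    simp only [hG, hs, splice_of_lt (Nat.lt_succ_self j)]
    rw [← mul_pow, lintegral_enorm_sq_le_iff, ← ofReal_norm,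
      ← ENNReal.ofReal_mul hp0, Real.norm_of_nonneg (by positivity)]
    refine (h (j + 1) m _ _).trans (ENNReal.ofReal_le_ofReal ?_)
    refine mul_le_mul_of_nonneg_left ?_ hp0
    linarith [hX (e j ω)]
  refine (lintegral_mono hinner).trans ?_
  have hnm : Measurable fun ω => ‖1 + c + ‖e j ω‖‖ₑ ^ 2 :=
    ((he j).norm.const_add (1 + c)).enorm.pow_const 2
  rw [lintegral_const_mul _ hnm, ENNReal.ofReal_mul hp0, mul_pow]
  refine mul_le_mul_right ?_ _
  rw [lintegral_enorm_sq_le_iff]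
  have hadd := eLpNorm_add_le (f := fun _ : Ω => (1 + c : ℝ)) (g := fun ω => ‖e j ω‖) (μ := P)
    (p := 2) aestronglyMeasurable_const (he j).norm.aestronglyMeasurable one_le_two
  refine hadd.trans ?_
  rw [ENNReal.ofReal_add (by positivity) hσ0]
  refine add_le_add ?_ ?_
  · rw [eLpNorm_const _ two_ne_zero (IsProbabilityMeasure.ne_zero P)]
    simp [← ofReal_norm, Real.norm_of_nonneg (by positivity : 0 ≤ 1 + c)]
  · rw [eLpNorm_norm]; exact hσ

end Stability

/-! ### Sensitivity and mean-square size of the simulated output. -/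

section Stability

variable {Ω : Type*} {mΩ : MeasurableSpace Ω} {P : Measure Ω} [IsProbabilityMeasure P]
  {na nb ny nu : ℕ} {f : Regressor na nb ny nu → EuclideanSpace ℝ (Fin ny)}
  {v : ℤ → EuclideanSpace ℝ (Fin nu)} {e : ℕ → Ω → EuclideanSpace ℝ (Fin ny)} {C lam σ : ℝ}

theorem simulate_restart (w : ℕ → EuclideanSpace ℝ (Fin ny))
    (y₀ : ℤ → EuclideanSpace ℝ (Fin ny)) (j m : ℕ) :
    simulate f v (extendNoise w) y₀ ((j + m : ℕ) : ℤ) = outputFrom f v (extendNoise w) j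
      (stateFrom f v (extendNoise w) 0 (regressor na nb y₀ v 0) j) m := by
  rw [simulate_natCast, outputFrom_add, zero_add]

theorem outputFrom_extendNoise_congr {w w' : ℕ → EuclideanSpace ℝ (Fin ny)} {j m : ℕ}
    {x : Regressor na nb ny nu} (h : ∀ i, j ≤ i → i ≤ j + m → w i = w' i) :
    outputFrom f v (extendNoise w) j x m = outputFrom f v (extendNoise w') j x m := by
  refine outputFrom_congr fun i hi => ?_
  have : (j : ℤ) + (i : ℤ) = ((j + i : ℕ) : ℤ) := by push_cast; ring
  rw [this, extendNoise_natCast, extendNoise_natCast, h _ (by omega) (by omega)]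

theorem measurable_simulate_noise (hf : Measurable f) (v : ℤ → EuclideanSpace ℝ (Fin nu))
    (y₀ : ℤ → EuclideanSpace ℝ (Fin ny)) (k : ℤ) :
    Measurable fun w : ℕ → EuclideanSpace ℝ (Fin ny) => simulate f v (extendNoise w) y₀ k :=
  measurable_simulate (u := fun i _ => v i)
    (e := fun i (w : ℕ → EuclideanSpace ℝ (Fin ny)) => extendNoise w i)
    (y₀ := fun i _ => y₀ i) hf (fun _ => measurable_const) (fun _ => measurable_pi_apply _)
    (fun _ => measurable_const) k

/-- Sensitivity of the simulated output to the noise at a single time. -/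
theorem eLpNorm_simulate_splice_le (hf : Measurable f) (he : ∀ i, Measurable (e i))
    (hi : iIndepFun e P) (hC : 0 ≤ C) (h0 : 0 < lam) (h : MeanSquareStable f v e P C lam)
    (hσ0 : 0 ≤ σ) (hσ : ∀ j, eLpNorm (e j) 2 P ≤ ENNReal.ofReal σ)
    (y₀ : ℤ → EuclideanSpace ℝ (Fin ny)) (w : ℕ → EuclideanSpace ℝ (Fin ny)) (j m : ℕ) :
    eLpNorm (fun ω =>
        simulate f v (extendNoise (splice (j + 1) w fun i => e i ω)) y₀ ((j + m : ℕ) : ℤ)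
      - simulate f v (extendNoise (splice j w fun i => e i ω)) y₀ ((j + m : ℕ) : ℤ)) 2 P
      ≤ ENNReal.ofReal ((1 + σ) * (1 + C / lam) * lam ^ m * (1 + ‖w j‖)) := by
  -- Both spliced noises equal `w` before j, so both trajectories pass through the same
  -- deterministic regressor at time j.
  set x := stateFrom f v (extendNoise w) 0 (regressor na nb y₀ v 0) j with hx
  have hst : ∀ w' : ℕ → EuclideanSpace ℝ (Fin ny), (∀ i < j, w' i = w i) →
      stateFrom f v (extendNoise w') 0 (regressor na nb y₀ v 0) j = x := fun w' hw' =>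
    stateFrom_congr fun i hi => by simpa using hw' i hi
  have hs1 : ∀ ω, stateFrom f v (extendNoise (splice (j + 1) w fun i => e i ω)) 0
      (regressor na nb y₀ v 0) j = x := fun ω => hst _ fun i hi => splice_of_lt (by omega) _ _
  have hs0 : ∀ ω, stateFrom f v (extendNoise (splice j w fun i => e i ω)) 0
      (regressor na nb y₀ v 0) j = x := fun ω => hst _ fun i hi => splice_of_lt hi _ _
  simp_rw [simulate_restart, hs1, hs0]
  have hn := norm_nonneg (w j)
  have hCl : 0 ≤ C / lam := by positivity
  cases m with
  | zero =>
    have hrw : ∀ ω, outputFrom f v (extendNoise (splice (j + 1) w fun i => e i ω)) j x 0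
        - outputFrom f v (extendNoise (splice j w fun i => e i ω)) j x 0
        = w j - e j ω := fun ω => by
      simp [outputFrom, stateFrom, splice_of_lt (Nat.lt_succ_self j), splice_of_le le_rfl]
    simp_rw [hrw]
    refine (eLpNorm_sub_le (f := fun _ => w j) aestronglyMeasurable_const
      (he j).aestronglyMeasurable one_le_two).trans ?_
    have h1 : eLpNorm (fun _ : Ω => w j) 2 P = ENNReal.ofReal ‖w j‖ := by
      rw [eLpNorm_const _ two_ne_zero (IsProbabilityMeasure.ne_zero P)]
      simp
    rw [h1]
    refine (add_le_add le_rfl (hσ j)).trans ?_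
    rw [← ENNReal.ofReal_add hn hσ0]
    refine ENNReal.ofReal_le_ofReal ?_
    have h2 : (1 + σ) * 1 ≤ (1 + σ) * (1 + C / lam) := by gcongr; linarith
    calc ‖w j‖ + σ ≤ (1 + σ) * 1 * (1 + ‖w j‖) := by nlinarith [mul_nonneg hσ0 hn]
      _ ≤ (1 + σ) * (1 + C / lam) * (1 + ‖w j‖) := by gcongr
      _ = _ := by ring
  | succ m =>
    have hrw1 : ∀ ω, outputFrom f v (extendNoise (splice (j + 1) w fun i => e i ω)) j x (m + 1)
        = outputFrom f v (extendNoise fun i => e i ω) (j + 1)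
          (nextRegressor x (f x + w j) (v (j + 1))) m := fun ω => by
      rw [outputFrom_succ, extendNoise_natCast, splice_of_lt (Nat.lt_succ_self j)]
      exact outputFrom_extendNoise_congr fun i hi _ => splice_of_le hi _ _
    have hrw0 : ∀ ω, outputFrom f v (extendNoise (splice j w fun i => e i ω)) j x (m + 1)
        = outputFrom f v (extendNoise fun i => e i ω) (j + 1)
          (nextRegressor x (f x + e j ω) (v (j + 1))) m := fun ω => by
      rw [outputFrom_succ, extendNoise_natCast, splice_of_le le_rfl]
      exact outputFrom_extendNoise_congr fun i hi _ => splice_of_le (by omega) _ _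
    simp_rw [hrw1, hrw0]
    have hXm : Measurable fun z : EuclideanSpace ℝ (Fin ny) =>
        nextRegressor x (f x + z) (v (j + 1)) :=
      measurable_nextRegressor.comp (measurable_const.prodMk
        ((measurable_id.const_add (f x)).prodMk measurable_const))
    refine (h.random_start hf he hi hC h0.le (j := j)
      (X₀ := fun _ => nextRegressor x (f x + w j) (v (j + 1))) measurable_const hXm
      (norm_nonneg (w j)) hσ0 (hσ j) (fun z => ?_) m).trans (ENNReal.ofReal_le_ofReal ?_)
    · refine (norm_nextRegressor_sub_le _ _ _ _ _).trans ?_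
      rw [sub_self, norm_zero, add_zero, add_sub_add_left_eq_sub]
      exact norm_sub_le _ _
    -- The perturbation enters the regressor only at time j + 1, so one step of decay is missing;
    -- this is the origin of C / λ and of the requirement λ > 0.
    · have h3 : C * lam ^ m = C / lam * lam ^ (m + 1) := by rw [pow_succ]; field_simp
      rw [h3]
      have h4 : 1 + ‖w j‖ + σ ≤ (1 + σ) * (1 + ‖w j‖) := by nlinarith [mul_nonneg hσ0 hn]
      calc C / lam * lam ^ (m + 1) * (1 + ‖w j‖ + σ)
          ≤ (1 + C / lam) * lam ^ (m + 1) * ((1 + σ) * (1 + ‖w j‖)) := by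
            gcongr; linarith
        _ = _ := by ring

/-- Mean square size of the output of the system started at rest. -/
theorem eLpNorm_outputFrom_zero_le (hf : Measurable f) (he : ∀ i, Measurable (e i))
    (hi : iIndepFun e P) (hC : 0 ≤ C) (h0 : 0 ≤ lam) (h : MeanSquareStable f v e P C lam)
    (hσ0 : 0 ≤ σ) (hσ : ∀ j, eLpNorm (e j) 2 P ≤ ENNReal.ofReal σ) (m : ℕ) :
    ∀ j : ℕ, eLpNorm (fun ω => outputFrom f v (extendNoise fun i => e i ω) j 0 m) 2 P
      ≤ ENNReal.ofReal (‖f 0‖ + σ + ∑ i ∈ Finset.range m,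
        C * lam ^ (m - 1 - i) * (1 + ‖f 0‖ + σ + ‖v ((j + 1 + i : ℕ) : ℤ)‖)) := by
  induction m with
  | zero =>
    intro j
    have hrw : ∀ ω, outputFrom f v (extendNoise fun i => e i ω) j 0 0 = f 0 + e j ω := fun ω => by
      simp [outputFrom, stateFrom]
    simp_rw [hrw]
    refine (eLpNorm_add_le (f := fun _ => f 0) aestronglyMeasurable_const
      (he j).aestronglyMeasurable one_le_two).trans ?_
    have h1 : eLpNorm (fun _ : Ω => f 0) 2 P = ENNReal.ofReal ‖f 0‖ := by
      rw [eLpNorm_const _ two_ne_zero (IsProbabilityMeasure.ne_zero P)]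
      simp
    rw [h1]
    refine (add_le_add le_rfl (hσ j)).trans ?_
    rw [← ENNReal.ofReal_add (norm_nonneg _) hσ0]
    simp
  | succ m ih =>
    intro j
    set X : EuclideanSpace ℝ (Fin ny) → Regressor na nb ny nu := fun z =>
      nextRegressor 0 (f 0 + z) (v (j + 1)) with hX
    have hXm : Measurable X := measurable_nextRegressor.comp (measurable_const.prodMk
        ((measurable_id.const_add (f 0)).prodMk measurable_const))
    -- Compare the trajectory from rest at j with the one from rest at j + 1. After one step they
    -- differ by a single regressor update of size at most ‖f 0‖ + ‖e_j‖ + ‖v_{j+1}‖, so no growth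
    -- condition on `f` is needed.
    have hrw : (fun ω => outputFrom f v (extendNoise fun i => e i ω) j 0 (m + 1))
        = (fun ω => outputFrom f v (extendNoise fun i => e i ω) (j + 1) 0 m)
          + fun ω => outputFrom f v (extendNoise fun i => e i ω) (j + 1) (X (e j ω)) m
            - outputFrom f v (extendNoise fun i => e i ω) (j + 1) 0 m := by
      funext ω
      rw [Pi.add_apply, add_sub_cancel, outputFrom_succ, extendNoise_natCast]
    have hm0 : AEStronglyMeasurable
        (fun ω => outputFrom f v (extendNoise fun i => e i ω) (j + 1) 0 m) P :=
      (measurable_outputFrom_noise hf v he measurable_const (j + 1) m).aestronglyMeasurable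
    have hm1 : AEStronglyMeasurable
        (fun ω => outputFrom f v (extendNoise fun i => e i ω) (j + 1) (X (e j ω)) m) P :=
      (measurable_outputFrom_noise hf v he (hXm.comp (he j)) (j + 1) m).aestronglyMeasurable
    have hstep := h.random_start hf he hi hC h0 (j := j) (X₀ := X) (X₁ := fun _ => 0) hXm
      measurable_const (c := ‖f 0‖ + ‖v (j + 1)‖) (by positivity) hσ0 (hσ j) (fun z => by
        rw [sub_zero]
        refine (norm_nextRegressor_zero_le _ _).trans ?_
        have := norm_add_le (f 0) z
        linarith) m
    rw [hrw]
    refine (eLpNorm_add_le hm0 (hm1.sub hm0) one_le_two).trans ?_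
    refine (add_le_add (ih (j + 1)) hstep).trans (le_of_eq ?_)
    rw [← ENNReal.ofReal_add (add_nonneg (by positivity)
      (Finset.sum_nonneg fun i _ => by positivity)) (by positivity), Finset.sum_range_succ']
    congr 1
    have e1 : ∀ i ∈ Finset.range m,
        C * lam ^ (m - 1 - i) * (1 + ‖f 0‖ + σ + ‖v ((j + 1 + 1 + i : ℕ) : ℤ)‖)
        = C * lam ^ (m + 1 - 1 - (i + 1)) * (1 + ‖f 0‖ + σ + ‖v ((j + 1 + (i + 1) : ℕ) : ℤ)‖) := by
      intro i hi
      have a1 : m - 1 - i = m + 1 - 1 - (i + 1) := by omega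
      have a2 : j + 1 + 1 + i = j + 1 + (i + 1) := by omega
      rw [a1, a2]
    rw [Finset.sum_congr rfl e1]
    simp only [Nat.add_sub_cancel, Nat.sub_zero, add_zero]
    push_cast
    ring

/-- Mean square size of the simulated output. -/
theorem exists_eLpNorm_simulate_le (hf : Measurable f) (he : ∀ i, Measurable (e i))
    (hi : iIndepFun e P) (hC : 0 ≤ C) (h0 : 0 ≤ lam) (h1 : lam < 1)
    (h : MeanSquareStable f v e P C lam)
    (hσ0 : 0 ≤ σ) (hσ : ∀ j, eLpNorm (e j) 2 P ≤ ENNReal.ofReal σ)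
    (y₀ : ℤ → EuclideanSpace ℝ (Fin ny)) :
    ∃ K : ℝ, 0 ≤ K ∧ ∀ k : ℕ,
      eLpNorm (fun ω => simulate f v (extendNoise fun i => e i ω) y₀ k) 2 P
        ≤ ENNReal.ofReal (K * (1 + geomFilter lam (fun i => ‖v i‖) k)) := by
  set x₀ := regressor na nb y₀ v 0 with hx₀
  set D := ‖f 0‖ + σ with hD
  have hD0 : 0 ≤ D := by positivity
  have hL0 : 0 ≤ (1 - lam)⁻¹ := inv_nonneg.2 (by linarith)
  refine ⟨D + C * (1 + ‖x₀‖) + C * (1 + D) * (1 - lam)⁻¹ + C, by positivity, fun k => ?_⟩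
  set g := geomFilter lam (fun i : ℕ => ‖v i‖) k with hg
  have hg0 : 0 ≤ g := geomFilter_nonneg h0 (fun i => norm_nonneg _) k
  have hm : ∀ x, AEStronglyMeasurable
      (fun ω => outputFrom f v (extendNoise fun i => e i ω) 0 x k) P := fun x =>
    (measurable_outputFrom_noise hf v he measurable_const 0 k).aestronglyMeasurable
  have hrw : (fun ω => simulate f v (extendNoise fun i => e i ω) y₀ k)
      = (fun ω => outputFrom f v (extendNoise fun i => e i ω) 0 0 k)
        + fun ω => outputFrom f v (extendNoise fun i => e i ω) 0 x₀ k
          - outputFrom f v (extendNoise fun i => e i ω) 0 0 k := by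
    funext ω
    rw [Pi.add_apply, add_sub_cancel, simulate_natCast]
  rw [hrw]
  refine (eLpNorm_add_le (hm 0) ((hm x₀).sub (hm 0)) one_le_two).trans ?_
  refine (add_le_add (eLpNorm_outputFrom_zero_le hf he hi hC h0 h hσ0 hσ k 0)
    (h 0 k x₀ 0)).trans ?_
  rw [← ENNReal.ofReal_add (add_nonneg hD0 (Finset.sum_nonneg fun i _ => by positivity))
    (by positivity)]
  refine ENNReal.ofReal_le_ofReal ?_
  have hsum : ∑ i ∈ Finset.range k,
      C * lam ^ (k - 1 - i) * (1 + ‖f 0‖ + σ + ‖v ((0 + 1 + i : ℕ) : ℤ)‖)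
      ≤ C * (1 + D) * (1 - lam)⁻¹ + C * g := by
    have e1 : geomFilter lam (fun i : ℕ => C * ((1 + D) * 1 + ‖v i‖)) k
        = C * ((1 + D) * geomFilter lam (fun _ => 1) k + g) := by
      rw [geomFilter_const_mul, geomFilter_add, geomFilter_const_mul]
    -- Shifted by one, the sum is the filter without its term at i = 0, which is nonnegative.
    have e2 : ∑ i ∈ Finset.range k,
        C * lam ^ (k - 1 - i) * (1 + ‖f 0‖ + σ + ‖v ((0 + 1 + i : ℕ) : ℤ)‖)
        ≤ geomFilter lam (fun i : ℕ => C * ((1 + D) * 1 + ‖v i‖)) k := by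
      rw [geomFilter, Finset.sum_range_succ']
      refine le_add_of_le_of_nonneg (le_of_eq (Finset.sum_congr rfl fun i hi => ?_))
        (mul_nonneg (pow_nonneg h0 _) (by positivity))
      have a1 : k - 1 - i = k - (i + 1) := by omega
      have a2 : 0 + 1 + i = i + 1 := by omega
      rw [a1, a2, hD]; ring
    refine e2.trans (e1.le.trans ?_)
    have e3 := geomFilter_one_le h0 h1 k
    have e4 : (1 + D) * geomFilter lam (fun _ => 1) k ≤ (1 + D) * (1 - lam)⁻¹ := by gcongr
    nlinarith
  have hp : lam ^ k ≤ 1 := pow_le_one₀ h0 h1.le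
  have hx : C * lam ^ k * (1 + ‖x₀ - 0‖) ≤ C * 1 * (1 + ‖x₀‖) := by
    rw [sub_zero]; gcongr
  have hK : 0 ≤ (D + C * (1 + ‖x₀‖) + C * (1 + D) * (1 - lam)⁻¹) * g := by positivity
  nlinarith

end Stability

/-! ### Discounted distances between data records as exponential filters. -/

section DiscountedDistance

variable {na nb ny nu : ℕ}

theorem sum_Icc_natCast (F : ℤ → ℝ) {j k : ℕ} (hjk : j ≤ k) :
    ∑ i ∈ Finset.Icc (j : ℤ) k, F i
      = ∑ m ∈ Finset.range (k - j + 1), F ((j + m : ℕ) : ℤ) := by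
  refine Finset.sum_nbij' (fun i => (i - j).toNat) (fun m => ((j + m : ℕ) : ℤ)) ?_ ?_ ?_ ?_ ?_
  · intro i hi; simp only [Finset.mem_Icc, Finset.mem_range] at *; omega
  · intro m hm; simp only [Finset.mem_Icc, Finset.mem_range] at *; omega
  · intro i hi; simp only [Finset.mem_Icc] at *; omega
  · intro m hm; simp
  · intro i hi
    simp only [Finset.mem_Icc] at hi
    congr 1; omega

/-- Terms before j vanish, so a perturbation that starts at time j is seen through a filter started
at j. -/
theorem discountedDist_of_eq_before (lam : ℝ) {y y' : ℤ → EuclideanSpace ℝ (Fin ny)}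
    (v : ℤ → EuclideanSpace ℝ (Fin nu)) {j k : ℕ} (hjk : j ≤ k) (h : ∀ i < (j : ℤ), y i = y' i) :
    discountedDist na nb lam k y y' v v
      = geomFilter lam (fun m => ‖y ((j + m : ℕ) : ℤ) - y' ((j + m : ℕ) : ℤ)‖) (k - j) := by
  rw [discountedDist, geomFilter, ← Finset.sum_subset (s₁ := Finset.Icc (j : ℤ) k),
    sum_Icc_natCast _ hjk]
  · refine Finset.sum_congr rfl fun m hm => ?_
    have : ((k : ℤ) - ((j + m : ℕ) : ℤ)).toNat = k - j - m := by
      simp only [Finset.mem_range] at hm; omega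
    rw [this, sub_self, norm_zero, zero_add]
  · exact Finset.Icc_subset_Icc (by omega) le_rfl
  · intro i hi hi'
    simp only [Finset.mem_Icc] at hi hi'
    rw [h i (by omega)]; simp

/-- The size of a data record before time `0`. -/
noncomputable def initialSize (na nb : ℕ) {ny nu : ℕ} (y : ℤ → EuclideanSpace ℝ (Fin ny))
    (v : ℤ → EuclideanSpace ℝ (Fin nu)) : ℝ :=
  ∑ i ∈ Finset.Icc (-((max na nb : ℕ) : ℤ)) (-1), (‖v i‖ + ‖y i‖)

theorem initialSize_nonneg (y : ℤ → EuclideanSpace ℝ (Fin ny))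
    (v : ℤ → EuclideanSpace ℝ (Fin nu)) : 0 ≤ initialSize na nb y v :=
  Finset.sum_nonneg fun i _ => by positivity

theorem discountedDist_zero_le {lam : ℝ} (h0 : 0 ≤ lam) (h1 : lam ≤ 1)
    (y : ℤ → EuclideanSpace ℝ (Fin ny)) (v : ℤ → EuclideanSpace ℝ (Fin nu)) (k : ℕ) :
    discountedDist na nb lam k y 0 v 0
      ≤ initialSize na nb y v + geomFilter lam (fun i : ℕ => ‖v i‖ + ‖y i‖) k := by
  rw [discountedDist, ← Finset.sum_filter_add_sum_filter_not _ (fun i : ℤ => i < 0)]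
  have e1 : (Finset.Icc (-((max na nb : ℕ) : ℤ)) (k : ℤ)).filter (fun i => i < 0)
      = Finset.Icc (-((max na nb : ℕ) : ℤ)) (-1) := by
    ext i; simp only [Finset.mem_filter, Finset.mem_Icc]; omega
  have e2 : (Finset.Icc (-((max na nb : ℕ) : ℤ)) (k : ℤ)).filter (fun i => ¬ i < 0)
      = Finset.Icc ((0 : ℕ) : ℤ) k := by
    ext i; simp only [Finset.mem_filter, Finset.mem_Icc]; omega
  rw [e1, e2, sum_Icc_natCast _ (Nat.zero_le k)]
  refine add_le_add (Finset.sum_le_sum fun i hi => ?_)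
    (le_of_eq (Finset.sum_congr rfl fun m hm => ?_))
  · simp only [Pi.zero_apply, sub_zero]
    exact mul_le_of_le_one_left (by positivity) (pow_le_one₀ h0 h1)
  · have : ((k : ℤ) - (m : ℤ)).toNat = k - m := by omega
    simp only [Pi.zero_apply, sub_zero, zero_add, this]

theorem discountedDist_nonneg {lam : ℝ} (h0 : 0 ≤ lam) (k : ℕ)
    (y y' : ℤ → EuclideanSpace ℝ (Fin ny)) (v v' : ℤ → EuclideanSpace ℝ (Fin nu)) :
    0 ≤ discountedDist na nb lam k y y' v v' :=
  Finset.sum_nonneg fun i _ => by positivity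

end DiscountedDistance

/-! ### Prediction errors are forgetting functionals of the noise. -/

section PredictionError

variable {Ω : Type*} {mΩ : MeasurableSpace Ω} {P : Measure Ω} [IsProbabilityMeasure P]

theorem eLpNorm_geomFilter_le {F : Type*} [NormedAddCommGroup F] {a : ℕ → Ω → F} {b : ℕ → ℝ}
    {mu : ℝ} (h0 : 0 ≤ mu) (ha : ∀ i, AEStronglyMeasurable (a i) P) (hb0 : ∀ i, 0 ≤ b i)
    (hb : ∀ i, eLpNorm (a i) 2 P ≤ ENNReal.ofReal (b i)) (k : ℕ) :
    eLpNorm (fun ω => geomFilter mu (fun i => ‖a i ω‖) k) 2 P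
      ≤ ENNReal.ofReal (geomFilter mu b k) := by
  have hrw : (fun ω => geomFilter mu (fun i => ‖a i ω‖) k)
      = ∑ i ∈ Finset.range (k + 1), (mu ^ (k - i)) • fun ω => ‖a i ω‖ := by
    funext ω; simp [geomFilter, Finset.sum_apply]
  rw [hrw]
  refine (eLpNorm_sum_le (fun i _ => (ha i).norm.const_smul _) one_le_two).trans ?_
  rw [geomFilter, ENNReal.ofReal_sum_of_nonneg fun i _ => mul_nonneg (pow_nonneg h0 _) (hb0 i)]
  refine Finset.sum_le_sum fun i _ => ?_
  rw [eLpNorm_const_smul, eLpNorm_norm, ENNReal.ofReal_mul (pow_nonneg h0 _),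
    Real.enorm_eq_ofReal (pow_nonneg h0 _)]
  exact mul_le_mul_right (hb i) _

theorem eLpNorm_add_const_mul_le {F : Type*} [NormedAddCommGroup F] {U : Ω → F} {V : Ω → F}
    {W : Ω → ℝ} {a b c d : ℝ} (hc : 0 ≤ c) (hd : 0 ≤ d) (hV : AEStronglyMeasurable V P)
    (hW : AEStronglyMeasurable W P) (h : ∀ ω, ‖U ω‖ ≤ ‖V ω‖ + (d + c * W ω)) (ha0 : 0 ≤ a)
    (hb0 : 0 ≤ b) (ha : eLpNorm V 2 P ≤ ENNReal.ofReal a)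
    (hb : eLpNorm W 2 P ≤ ENNReal.ofReal b) :
    eLpNorm U 2 P ≤ ENNReal.ofReal (a + (d + c * b)) := by
  refine (eLpNorm_mono_real h).trans ?_
  refine (eLpNorm_add_le (f := fun ω => ‖V ω‖) (g := fun ω => d + c * W ω) hV.norm
    ((hW.const_mul c).const_add d) one_le_two).trans ?_
  rw [ENNReal.ofReal_add ha0 (by positivity), eLpNorm_norm]
  refine add_le_add ha ?_
  refine (eLpNorm_add_le (f := fun _ => d) (g := fun ω => c * W ω) aestronglyMeasurable_const
    (hW.const_mul c) one_le_two).trans ?_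
  rw [ENNReal.ofReal_add hd (by positivity)]
  refine add_le_add ?_ ?_
  · rw [eLpNorm_const _ two_ne_zero (IsProbabilityMeasure.ne_zero P)]
    simp [Real.enorm_eq_ofReal hd]
  · have : (fun ω => c * W ω) = c • W := rfl
    rw [this, eLpNorm_const_smul, ENNReal.ofReal_mul hc, Real.enorm_eq_ofReal hc]
    exact mul_le_mul_right hb _

variable {na nb ny nu : ℕ} {f : Regressor na nb ny nu → EuclideanSpace ℝ (Fin ny)}
  {v : ℤ → EuclideanSpace ℝ (Fin nu)} {e : ℕ → Ω → EuclideanSpace ℝ (Fin ny)} {C lam σ : ℝ}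

/-- The prediction error at time `k` as a functional of the noise. -/
noncomputable def predictionError (f : Regressor na nb ny nu → EuclideanSpace ℝ (Fin ny))
    (v : ℤ → EuclideanSpace ℝ (Fin nu)) (y₀ : ℤ → EuclideanSpace ℝ (Fin ny))
    (g : ℕ → (ℤ → EuclideanSpace ℝ (Fin ny)) → EuclideanSpace ℝ (Fin ny)) (k : ℕ)
    (w : ℕ → EuclideanSpace ℝ (Fin ny)) : EuclideanSpace ℝ (Fin ny) :=
  simulate f v (extendNoise w) y₀ k - g k (simulate f v (extendNoise w) y₀)

/-- The output reacts to e_j at rate λ and the predictor filters this reaction at rate μ; since μ <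
λ strictly, the composition still decays like λ^{k-j}, with the extra factor λ/(λ - μ). For the
size, the output is bounded by one filter of ‖v‖ and the predictor adds another, whence the double
filters. -/
theorem exists_isForgetting_predictionError (hf : Measurable f) (he : ∀ i, Measurable (e i))
    (hi : iIndepFun e P) (hC : 0 ≤ C) (h1 : lam < 1) (h : MeanSquareStable f v e P C lam)
    (hσ0 : 0 ≤ σ) (hσ : ∀ j, eLpNorm (e j) 2 P ≤ ENNReal.ofReal σ)
    (hv : ∃ l, Tendsto (fun N : ℕ => (N : ℝ)⁻¹ * ∑ k ∈ Finset.range N, ‖v k‖ ^ 2) atTop (𝓝 l))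
    (y₀ : ℤ → EuclideanSpace ℝ (Fin ny)) {Cg mu : ℝ} (hCg : 0 ≤ Cg) (hmu : 0 ≤ mu)
    (hmul : mu < lam) {g : ℕ → (ℤ → EuclideanSpace ℝ (Fin ny)) → EuclideanSpace ℝ (Fin ny)}
    (hgm : ∀ k, Measurable (g k))
    (hg1 : ∀ k y y', ‖g k y - g k y'‖ ≤ Cg * discountedDist na nb mu k y y' v v)
    (hg2 : ∀ k y, ‖g k y‖ ≤ Cg + Cg * discountedDist na nb mu k y 0 v 0) :
    ∃ C' β, IsForgetting e P (predictionError f v y₀ g) C' lam β := by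
  have h0 : 0 < lam := hmu.trans_lt hmul
  set L := (1 - lam)⁻¹ with hL
  have hL0 : 0 ≤ L := inv_nonneg.2 (by linarith)
  obtain ⟨K, hK0, hK⟩ := exists_eLpNorm_simulate_le hf he hi hC h0.le h1 h hσ0 hσ y₀
  set nv : ℕ → ℝ := fun i => ‖v i‖ with hnv
  have hnv0 : ∀ i, 0 ≤ nv i := fun i => norm_nonneg _
  set hh : ℕ → ℝ := geomFilter lam nv with hhh
  have hh0 : ∀ i, 0 ≤ hh i := geomFilter_nonneg h0.le hnv0
  set H : ℕ → ℝ := geomFilter lam hh with hH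
  have hH0 : ∀ i, 0 ≤ H i := geomFilter_nonneg h0.le hh0
  have hhH : ∀ i, hh i ≤ H i := le_geomFilter h0.le hh0
  set R : ℕ → ℝ := geomFilter lam (geomFilter lam fun i => nv i ^ 2) with hR
  have hR0 : ∀ i, 0 ≤ R i :=
    geomFilter_nonneg h0.le (geomFilter_nonneg h0.le fun i => sq_nonneg _)
  -- Convergence of the Cesàro means of ‖v‖² is not inherited by H², but it is by R, which is linear
  -- in ‖v‖². Cauchy–Schwarz at each filter passes from H² to R, and β is defined from R for this
  -- reason.
  have hHR : ∀ k, H k ^ 2 ≤ L ^ 2 * R k := fun k => by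
    refine (sq_geomFilter_le h0.le h1 hh k).trans ?_
    have e1 : geomFilter lam (fun i => hh i ^ 2) k
        ≤ geomFilter lam (fun i => L * geomFilter lam (fun i => nv i ^ 2) i) k :=
      geomFilter_mono h0.le (fun i => sq_geomFilter_le h0.le h1 nv i) k
    rw [geomFilter_const_mul] at e1
    calc L * geomFilter lam (fun i => hh i ^ 2) k ≤ L * (L * R k) := by gcongr
      _ = L ^ 2 * R k := by ring
  set N0 := initialSize na nb y₀ v with hN0
  have hN00 : 0 ≤ N0 := initialSize_nonneg y₀ v
  have hsm : ∀ k : ℤ, Measurable fun w : ℕ → EuclideanSpace ℝ (Fin ny) =>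
      simulate f v (extendNoise w) y₀ k := measurable_simulate_noise hf v y₀
  have hem : Measurable fun ω (i : ℕ) => e i ω := measurable_pi_lambda _ he
  set T := K + Cg + Cg * N0 + Cg * (1 + K * L + K) with hT
  have hT0 : 0 ≤ T := by positivity
  set C1 := (1 + σ) * (1 + C / lam) with hC1
  have hC10 : 0 ≤ C1 := by positivity
  have hlm : 0 < lam - mu := sub_pos.2 hmul
  refine ⟨C1 + Cg * (C1 * (lam / (lam - mu))),
    fun k => Real.sqrt (2 * T ^ 2 + 2 * T ^ 2 * L ^ 2 * R k), ?_⟩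
  have hnn : ∀ k, 0 ≤ 2 * T ^ 2 + 2 * T ^ 2 * L ^ 2 * R k := fun k => by
    have := hR0 k; positivity
  refine ⟨by positivity, h0.le, h1, fun k => ?_, fun k w w' hw => ?_, fun w j k hjk => ?_,
    fun k => Real.sqrt_nonneg _, fun k => ?_, ?_⟩
  · exact (hsm k).sub ((hgm k).comp (measurable_pi_lambda _ hsm))
  · have hsim : ∀ i : ℤ, i ≤ k → simulate f v (extendNoise w) y₀ i
        = simulate f v (extendNoise w') y₀ i := fun i hi =>
      simulate_congr fun m hm => hw m (by omega)
    -- Causality of the functional is a consequence of its Lipschitz bound: the discounted distance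
    -- up to k of records that agree up to k is 0.
    have hg : g k (simulate f v (extendNoise w) y₀) = g k (simulate f v (extendNoise w') y₀) := by
      refine sub_eq_zero.1 (norm_le_zero_iff.1 ((hg1 k _ _).trans (le_of_eq ?_)))
      rw [discountedDist_of_eq_before mu v le_rfl fun i hi => hsim i hi.le]
      rw [Nat.sub_self, geomFilter_zero, hsim _ (by simp)]
      simp
    rw [predictionError, predictionError, hg, hsim k le_rfl]
  · set a : ℕ → Ω → EuclideanSpace ℝ (Fin ny) := fun m ω =>
      simulate f v (extendNoise (splice (j + 1) w fun i => e i ω)) y₀ ((j + m : ℕ) : ℤ)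
      - simulate f v (extendNoise (splice j w fun i => e i ω)) y₀ ((j + m : ℕ) : ℤ) with ha
    have hspm : ∀ j, Measurable fun ω => splice j w fun i => e i ω := fun j =>
      (measurable_splice j).comp (measurable_const.prodMk hem)
    have ham : ∀ m, AEStronglyMeasurable (a m) P := fun m =>
      (((hsm _).comp (hspm (j + 1))).sub ((hsm _).comp (hspm j))).aestronglyMeasurable
    have hab : ∀ m, eLpNorm (a m) 2 P ≤ ENNReal.ofReal (C1 * (1 + ‖w j‖) * lam ^ m) := fun m => by
      refine (eLpNorm_simulate_splice_le hf he hi hC h0 h hσ0 hσ y₀ w j m).trans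
        (ENNReal.ofReal_le_ofReal (le_of_eq (by ring)))
    have hgeo := eLpNorm_geomFilter_le hmu ham (fun m => by positivity) hab (k - j)
    rw [geomFilter_const_mul] at hgeo
    have hgp : 0 ≤ geomFilter mu (fun i => lam ^ i) (k - j) :=
      geomFilter_nonneg hmu (fun i => by positivity) _
    have hgeom : Measurable fun ω => geomFilter mu (fun i => ‖a i ω‖) (k - j) := by
      refine Finset.measurable_fun_sum _ fun i _ => ?_
      exact (((hsm _).comp (hspm (j + 1))).sub ((hsm _).comp (hspm j))).norm.const_mul _
    refine (eLpNorm_add_const_mul_le (V := a (k - j)) (c := Cg) (d := 0)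
      (W := fun ω => geomFilter mu (fun i => ‖a i ω‖) (k - j)) hCg le_rfl (ham _)
      hgeom.aestronglyMeasurable (fun ω => ?_) (by positivity) (by positivity) (hab _) hgeo).trans
      (ENNReal.ofReal_le_ofReal ?_)
    · rw [zero_add, predictionError, predictionError, sub_sub_sub_comm]
      refine (norm_sub_le _ _).trans (add_le_add (le_of_eq ?_) ((hg1 k _ _).trans (le_of_eq ?_)))
      · simp only [ha, Nat.add_sub_cancel' hjk]
      · rw [discountedDist_of_eq_before mu v hjk fun i hi => ?_]
        refine simulate_congr fun m hm => ?_
        rw [extendNoise_natCast, extendNoise_natCast, splice_of_lt (by omega),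
          splice_of_lt (by omega)]
    · have hp := geomFilter_pow_le hmu hmul (k - j)
      rw [zero_add]
      calc C1 * (1 + ‖w j‖) * lam ^ (k - j)
            + Cg * (C1 * (1 + ‖w j‖) * geomFilter mu (fun i => lam ^ i) (k - j))
          ≤ C1 * (1 + ‖w j‖) * lam ^ (k - j)
            + Cg * (C1 * (1 + ‖w j‖) * (lam / (lam - mu) * lam ^ (k - j))) := by gcongr
        _ = _ := by ring
  · set a : ℕ → Ω → EuclideanSpace ℝ (Fin ny) := fun m ω =>
      simulate f v (extendNoise fun i => e i ω) y₀ m with ha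
    have ham : ∀ m, AEStronglyMeasurable (a m) P := fun m =>
      ((hsm m).comp hem).aestronglyMeasurable
    have hab : ∀ m, eLpNorm (a m) 2 P ≤ ENNReal.ofReal (K * (1 + hh m)) := hK
    have hgeo := eLpNorm_geomFilter_le hmu ham (fun m => mul_nonneg hK0 (by linarith [hh0 m]))
      hab k
    have hgp : 0 ≤ geomFilter mu (fun m => K * (1 + hh m)) k :=
      geomFilter_nonneg hmu (fun m => mul_nonneg hK0 (by linarith [hh0 m])) k
    have hgeom : Measurable fun ω => geomFilter mu (fun i => ‖a i ω‖) k := by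
      refine Finset.measurable_fun_sum _ fun i _ => ?_
      exact ((hsm _).comp hem).norm.const_mul _
    have hmv : geomFilter mu nv k ≤ H k :=
      (geomFilter_mono_base hmu hmul.le hnv0 k).trans (hhH k)
    have hmv0 : 0 ≤ geomFilter mu nv k := geomFilter_nonneg hmu hnv0 k
    refine (eLpNorm_add_const_mul_le (V := a k) (c := Cg)
      (d := Cg + Cg * (N0 + geomFilter mu nv k))
      (W := fun ω => geomFilter mu (fun i => ‖a i ω‖) k) hCg (by positivity) (ham _)
      hgeom.aestronglyMeasurable (fun ω => ?_) (mul_nonneg hK0 (by linarith [hh0 k])) hgp (hab _)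
      hgeo).trans (ENNReal.ofReal_le_ofReal ?_)
    · rw [predictionError]
      refine (norm_sub_le _ _).trans (add_le_add le_rfl ((hg2 k _).trans ?_))
      have hd := discountedDist_zero_le (na := na) (nb := nb) hmu (hmul.trans h1).le
        (simulate f v (extendNoise fun i => e i ω) y₀) v k
      have hinit : initialSize na nb (simulate f v (extendNoise fun i => e i ω) y₀) v = N0 := by
        refine Finset.sum_congr rfl fun i hi => ?_
        rw [simulate_of_neg _ (by have := (Finset.mem_Icc.1 hi).2; omega)]
      rw [hinit, geomFilter_add] at hd
      calc Cg + Cg * discountedDist na nb mu k (simulate f v (extendNoise fun i => e i ω) y₀) 0 v 0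
          ≤ Cg + Cg * (N0 + (geomFilter mu nv k + geomFilter mu (fun i => ‖a i ω‖) k)) := by
            gcongr
        _ = _ := by ring
    · have hKH : geomFilter mu (fun m => K * (1 + hh m)) k ≤ K * (L + H k) := by
        rw [geomFilter_const_mul, geomFilter_add]
        refine mul_le_mul_of_nonneg_left (add_le_add ?_ ?_) hK0
        · exact (geomFilter_mono_base hmu hmul.le (fun _ => zero_le_one) k).trans
            (geomFilter_one_le h0.le h1 k)
        · exact geomFilter_mono_base hmu hmul.le hh0 k
      have hTk : K * (1 + hh k) + (Cg + Cg * (N0 + geomFilter mu nv k)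
          + Cg * geomFilter mu (fun m => K * (1 + hh m)) k) ≤ T * (1 + H k) := by
        have e0 := hH0 k
        have e1 : K * (1 + hh k) ≤ K * (1 + H k) := by gcongr; exact hhH k
        have e2 : Cg * (N0 + geomFilter mu nv k) ≤ Cg * (N0 + H k) := by gcongr
        have e3 : Cg * geomFilter mu (fun m => K * (1 + hh m)) k ≤ Cg * (K * (L + H k)) := by
          gcongr
        have e4 : 0 ≤ Cg * K * L * H k := by positivity
        have e5 : 0 ≤ Cg * N0 * H k := by positivity
        have e6 : 0 ≤ Cg * H k := by positivity
        have e7 : 0 ≤ Cg * K := by positivity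
        rw [hT]; nlinarith
      refine hTk.trans (Real.le_sqrt_of_sq_le ?_)
      have e1 : (1 + H k) ^ 2 ≤ 2 + 2 * (L ^ 2 * R k) := by
        nlinarith [hHR k, sq_nonneg (1 - H k)]
      calc (T * (1 + H k)) ^ 2 = T ^ 2 * (1 + H k) ^ 2 := by ring
        _ ≤ T ^ 2 * (2 + 2 * (L ^ 2 * R k)) := by gcongr
        _ = _ := by ring
  · obtain ⟨l, hl⟩ := hv
    obtain ⟨l1, hl1⟩ := tendsto_cesaro_geomFilter h0.le h1 hl
    obtain ⟨l2, hl2⟩ := tendsto_cesaro_geomFilter h0.le h1 hl1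
    refine ⟨2 * T ^ 2 + 2 * T ^ 2 * L ^ 2 * l2, ?_⟩
    refine ((hl2.const_mul (2 * T ^ 2 * L ^ 2)).const_add (2 * T ^ 2)).congr' ?_
    -- At N = 0 the mean of the constant part of β² is 0 instead of that constant.
    filter_upwards [eventually_ge_atTop 1] with N hN
    have hN' : (N : ℝ) ≠ 0 := Nat.cast_ne_zero.2 (by omega)
    simp_rw [Real.sq_sqrt (hnn _)]
    have hsum : ∑ k ∈ Finset.range N, 2 * T ^ 2 * L ^ 2 * R k
        = 2 * T ^ 2 * L ^ 2 * ∑ k ∈ Finset.range N, R k := (Finset.mul_sum ..).symm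
    change 2 * T ^ 2 + 2 * T ^ 2 * L ^ 2 * ((N : ℝ)⁻¹ * ∑ k ∈ Finset.range N, R k) = _
    rw [Finset.sum_add_distrib, hsum]
    simp only [Finset.sum_const, Finset.card_range, nsmul_eq_mul]
    field_simp

end PredictionError

/-! ### Stable data functionals and the law for a fixed input. -/

section StableFunctional

variable {na nb ny nu : ℕ}

/-- A family of data functionals whose sensitivity to the data is discounted exponentially, bounded
at the zero record, and blind to the outputs before time `-n_a`. -/
structure IsStableFunctional (na nb : ℕ) {ny nu : ℕ}
    (g : ℕ → (ℤ → EuclideanSpace ℝ (Fin ny)) → (ℤ → EuclideanSpace ℝ (Fin nu)) →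
      EuclideanSpace ℝ (Fin ny)) (C mu : ℝ) : Prop where
  nonneg_C : 0 ≤ C
  mu_nonneg : 0 ≤ mu
  mu_lt_one : mu < 1
  lipschitz : ∀ k y y' u u', ‖g k y u - g k y' u'‖ ≤ C * discountedDist na nb mu k y y' u u'
  zero : ∀ k, ‖g k 0 0‖ ≤ C
  congr : ∀ k y y' u, (∀ i, -(na : ℤ) ≤ i → y i = y' i) → g k y u = g k y' u

/-- For this functional the prediction error is the output itself, so the general results also
control the power of the outputs. -/
theorem isStableFunctional_zero :
    IsStableFunctional na nb
      (fun _ _ _ => 0 : ℕ → (ℤ → EuclideanSpace ℝ (Fin ny)) → (ℤ → EuclideanSpace ℝ (Fin nu)) →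
        EuclideanSpace ℝ (Fin ny)) 0 0 :=
  ⟨le_rfl, le_rfl, zero_lt_one, fun _ _ _ _ _ => by simp, fun _ => by simp, fun _ _ _ _ _ => rfl⟩

/-- The mean square deviation of the outputs from a data functional. -/
noncomputable def meanSquareError
    (g : ℕ → (ℤ → EuclideanSpace ℝ (Fin ny)) → (ℤ → EuclideanSpace ℝ (Fin nu)) →
      EuclideanSpace ℝ (Fin ny)) (N : ℕ) (y : ℤ → EuclideanSpace ℝ (Fin ny))
    (u : ℤ → EuclideanSpace ℝ (Fin nu)) : ℝ :=
  (N : ℝ)⁻¹ * ∑ k ∈ Finset.range N, ‖y (k : ℤ) - g k y u‖ ^ 2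

theorem norm_le_discountedDist {lam : ℝ} (h0 : 0 ≤ lam) (k : ℕ)
    (y : ℤ → EuclideanSpace ℝ (Fin ny)) (u : ℤ → EuclideanSpace ℝ (Fin nu)) :
    ‖y k‖ ≤ discountedDist na nb lam k y 0 u 0 := by
  have h := Finset.single_le_sum (s := Finset.Icc (-((max na nb : ℕ) : ℤ)) (k : ℤ))
    (f := fun i : ℤ => lam ^ ((k : ℤ) - i).toNat
      * (‖u i - (0 : ℤ → EuclideanSpace ℝ (Fin nu)) i‖
        + ‖y i - (0 : ℤ → EuclideanSpace ℝ (Fin ny)) i‖))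
    (fun i _ => by positivity) (a := (k : ℤ)) (Finset.mem_Icc.2 ⟨by omega, le_rfl⟩)
  refine le_trans ?_ h
  simp

/-- Converts the pointwise moduli, stated through discounted distances, into average signal powers,
which stay bounded in N. -/
theorem sum_one_add_discountedDist_sq_le {lam : ℝ} (h0 : 0 ≤ lam) (h1 : lam < 1)
    (y : ℤ → EuclideanSpace ℝ (Fin ny)) (u : ℤ → EuclideanSpace ℝ (Fin nu)) (N : ℕ) :
    ∑ k ∈ Finset.range N, (1 + discountedDist na nb lam k y 0 u 0) ^ 2
      ≤ 2 * (1 + initialSize na nb y u) ^ 2 * N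
        + 4 * (1 - lam)⁻¹ ^ 2 * (∑ i ∈ Finset.range N, ‖u i‖ ^ 2
          + ∑ i ∈ Finset.range N, ‖y i‖ ^ 2) := by
  set a : ℕ → ℝ := fun i => ‖u i‖ + ‖y i‖ with ha
  set I := initialSize na nb y u with hI
  set L := (1 - lam)⁻¹ with hL
  have hL0 : 0 ≤ L := inv_nonneg.2 (by linarith)
  have hk : ∀ k : ℕ, (1 + discountedDist na nb lam k y 0 u 0) ^ 2
      ≤ 2 * (1 + I) ^ 2 + 2 * L * geomFilter lam (fun i => a i ^ 2) k := fun k => by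
    have e1 := discountedDist_zero_le (na := na) (nb := nb) h0 h1.le y u k
    have e2 := sq_geomFilter_le h0 h1 a k
    have e3 := discountedDist_nonneg (na := na) (nb := nb) h0 k y 0 u 0
    calc (1 + discountedDist na nb lam k y 0 u 0) ^ 2
        ≤ ((1 + I) + geomFilter lam a k) ^ 2 := by
          refine pow_le_pow_left₀ (by linarith) ?_ 2
          linarith
      _ ≤ 2 * (1 + I) ^ 2 + 2 * geomFilter lam a k ^ 2 := by
          nlinarith [sq_nonneg ((1 + I) - geomFilter lam a k)]
      _ ≤ 2 * (1 + I) ^ 2 + 2 * (L * geomFilter lam (fun i => a i ^ 2) k) := by gcongr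
      _ = _ := by ring
  refine (Finset.sum_le_sum fun k _ => hk k).trans ?_
  rw [Finset.sum_add_distrib, ← Finset.mul_sum _ (geomFilter lam fun i => a i ^ 2)]
  refine add_le_add (le_of_eq (by simp; ring)) ?_
  have e4 := sum_geomFilter_le h0 h1 (fun i => sq_nonneg (a i)) N
  have e5 : ∑ i ∈ Finset.range N, a i ^ 2
      ≤ 2 * (∑ i ∈ Finset.range N, ‖u i‖ ^ 2 + ∑ i ∈ Finset.range N, ‖y i‖ ^ 2) := by
    rw [← Finset.sum_add_distrib, Finset.mul_sum]
    refine Finset.sum_le_sum fun i _ => ?_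
    simp only [ha]
    nlinarith [sq_nonneg (‖u i‖ - ‖y i‖)]
  calc 2 * L * ∑ k ∈ Finset.range N, geomFilter lam (fun i => a i ^ 2) k
      ≤ 2 * L * (L * (2 * (∑ i ∈ Finset.range N, ‖u i‖ ^ 2
        + ∑ i ∈ Finset.range N, ‖y i‖ ^ 2))) := by
        refine mul_le_mul_of_nonneg_left (e4.trans ?_) (by positivity)
        exact mul_le_mul_of_nonneg_left e5 hL0
    _ = _ := by ring

namespace IsStableFunctional

variable {g : ℕ → (ℤ → EuclideanSpace ℝ (Fin ny)) → (ℤ → EuclideanSpace ℝ (Fin nu)) →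
      EuclideanSpace ℝ (Fin ny)} {Cg mu : ℝ}

theorem norm_le (h : IsStableFunctional na nb g Cg mu) (k : ℕ)
    (y : ℤ → EuclideanSpace ℝ (Fin ny)) (u : ℤ → EuclideanSpace ℝ (Fin nu)) :
    ‖g k y u‖ ≤ Cg + Cg * discountedDist na nb mu k y 0 u 0 := by
  have e1 := h.lipschitz k y 0 u 0
  have e2 := norm_le_norm_add_norm_sub' (g k y u) (g k 0 0)
  linarith [h.zero k]

/-- The discounted distance involves finitely many coordinates, so the Lipschitz bound gives
continuity in the product topology. Joint measurability of the predictor in the data is obtained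
from this. -/
theorem continuous (h : IsStableFunctional na nb g Cg mu) (k : ℕ) :
    Continuous fun x : (ℤ → EuclideanSpace ℝ (Fin ny)) × (ℤ → EuclideanSpace ℝ (Fin nu)) =>
      g k x.1 x.2 := by
  refine continuous_iff_continuousAt.2 fun x₀ => ?_
  refine tendsto_iff_norm_sub_tendsto_zero.2 ?_
  refine squeeze_zero (fun _ => norm_nonneg _) (fun x => h.lipschitz k x.1 x₀.1 x.2 x₀.2) ?_
  have hc : Continuous fun x : (ℤ → EuclideanSpace ℝ (Fin ny)) × (ℤ → EuclideanSpace ℝ (Fin nu)) =>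
      Cg * discountedDist na nb mu k x.1 x₀.1 x.2 x₀.2 := by
    unfold discountedDist
    fun_prop
  have := hc.tendsto x₀
  simpa [discountedDist] using this

variable {α : Type*} [MeasurableSpace α]

theorem measurable (h : IsStableFunctional na nb g Cg mu) (k : ℕ)
    {y : ℤ → α → EuclideanSpace ℝ (Fin ny)} {u : ℤ → α → EuclideanSpace ℝ (Fin nu)}
    (hy : ∀ k, Measurable (y k)) (hu : ∀ k, Measurable (u k)) :
    Measurable fun a => g k (fun i => y i a) (fun i => u i a) :=
  (h.continuous k).measurable.comp
    ((measurable_pi_lambda _ hy).prodMk (measurable_pi_lambda _ hu))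

theorem measurable_meanSquareError (h : IsStableFunctional na nb g Cg mu) (N : ℕ)
    {y : ℤ → α → EuclideanSpace ℝ (Fin ny)} {u : ℤ → α → EuclideanSpace ℝ (Fin nu)}
    (hy : ∀ k, Measurable (y k)) (hu : ∀ k, Measurable (u k)) :
    Measurable fun a => meanSquareError g N (fun i => y i a) (fun i => u i a) :=
  (Finset.measurable_fun_sum _ fun (k : ℕ) _ =>
    ((hy (k : ℤ)).sub (h.measurable k hy hu)).norm.pow_const 2).const_mul _

theorem meanSquareError_congr (h : IsStableFunctional na nb g Cg mu) (N : ℕ)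
    {y y' : ℤ → EuclideanSpace ℝ (Fin ny)} (u : ℤ → EuclideanSpace ℝ (Fin nu))
    (hy : ∀ i, -(na : ℤ) ≤ i → y i = y' i) :
    meanSquareError g N y u = meanSquareError g N y' u := by
  unfold meanSquareError
  congr 1
  refine Finset.sum_congr rfl fun k _ => ?_
  rw [h.congr k y y' u hy, hy k (by omega)]

variable {Ω : Type*} {mΩ : MeasurableSpace Ω} {P : Measure Ω} [IsProbabilityMeasure P]
  {f : Regressor na nb ny nu → EuclideanSpace ℝ (Fin ny)}
  {v : ℤ → EuclideanSpace ℝ (Fin nu)} {e : ℕ → Ω → EuclideanSpace ℝ (Fin ny)}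

theorem exists_isForgetting (h : IsStableFunctional na nb g Cg mu) (hf : Measurable f)
    (he : ∀ i, Measurable (e i)) (hi : iIndepFun e P)
    (hid : ∀ i, IdentDistrib (e i) (e 0) P P) (hL2 : MemLp (e 0) 2 P)
    (hst : ∃ C lam : ℝ, 0 ≤ C ∧ 0 ≤ lam ∧ lam < 1 ∧ MeanSquareStable f v e P C lam)
    (hv : ∃ l, Tendsto (fun N : ℕ => (N : ℝ)⁻¹ * ∑ k ∈ Finset.range N, ‖v k‖ ^ 2) atTop (𝓝 l))
    (y₀ : ℤ → EuclideanSpace ℝ (Fin ny)) :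
    ∃ C lam β, IsForgetting e P (predictionError f v y₀ fun k y => g k y v) C lam β := by
  obtain ⟨C, lam, hC, h0, h1, hs⟩ := hst
  -- A common rate strictly above the predictor's, as the nested filters require; the system's
  -- stability is weakened to it.
  obtain ⟨l, hl, hl1⟩ := exists_between (max_lt h1 h.mu_lt_one)
  have hσ : ∀ j, eLpNorm (e j) 2 P ≤ ENNReal.ofReal (eLpNorm (e 0) 2 P).toReal := fun j => by
    rw [ENNReal.ofReal_toReal hL2.eLpNorm_ne_top, (hid j).eLpNorm_eq]
  obtain ⟨C', β, hF⟩ := exists_isForgetting_predictionError (g := fun k y => g k y v) hf he hi hC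
    hl1 (hs.mono hC h0 ((le_max_left _ _).trans hl.le)) ENNReal.toReal_nonneg hσ hv y₀ h.nonneg_C
    h.mu_nonneg ((le_max_right _ _).trans_lt hl)
    (fun k => h.measurable k (fun i => measurable_pi_apply i) fun _ => measurable_const)
    (fun k y y' => h.lipschitz k y y' v v) (fun k y => h.norm_le k y v)
  exact ⟨C', l, β, hF⟩

/-- For a fixed realization of the input, the mean square error is almost surely close to its
expectation. -/
theorem ae_tendsto_meanSquareError_sub_integral (h : IsStableFunctional na nb g Cg mu)
    (hf : Measurable f) (he : ∀ i, Measurable (e i)) (hi : iIndepFun e P)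
    (hid : ∀ i, IdentDistrib (e i) (e 0) P P) (hL2 : MemLp (e 0) 2 P)
    (hst : ∃ C lam : ℝ, 0 ≤ C ∧ 0 ≤ lam ∧ lam < 1 ∧ MeanSquareStable f v e P C lam)
    (hv : ∃ l, Tendsto (fun N : ℕ => (N : ℝ)⁻¹ * ∑ k ∈ Finset.range N, ‖v k‖ ^ 2) atTop (𝓝 l))
    (y₀ : ℤ → EuclideanSpace ℝ (Fin ny)) :
    ∀ᵐ ω ∂P, Tendsto (fun N : ℕ =>
      meanSquareError g N (simulate f v (extendNoise fun i => e i ω) y₀) v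
        - ∫ ω', meanSquareError g N (simulate f v (extendNoise fun i => e i ω') y₀) v ∂P)
      atTop (𝓝 0) := by
  obtain ⟨C, lam, β, hF⟩ := h.exists_isForgetting hf he hi hid hL2 hst hv y₀
  filter_upwards [hF.strong_law he hi hid hL2] with ω hω
  refine hω.congr fun N => ?_
  rw [Finset.sum_sub_distrib, mul_sub]
  congr 1
  unfold meanSquareError
  rw [integral_const_mul]
  congr 1
  rw [integral_finsetSum]
  · rfl
  · exact fun k _ => (hF.memLp he k).integrable_norm_pow two_ne_zero

theorem integrable_meanSquareError (h : IsStableFunctional na nb g Cg mu)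
    (hf : Measurable f) (he : ∀ i, Measurable (e i)) (hi : iIndepFun e P)
    (hid : ∀ i, IdentDistrib (e i) (e 0) P P) (hL2 : MemLp (e 0) 2 P)
    (hst : ∃ C lam : ℝ, 0 ≤ C ∧ 0 ≤ lam ∧ lam < 1 ∧ MeanSquareStable f v e P C lam)
    (hv : ∃ l, Tendsto (fun N : ℕ => (N : ℝ)⁻¹ * ∑ k ∈ Finset.range N, ‖v k‖ ^ 2) atTop (𝓝 l))
    (y₀ : ℤ → EuclideanSpace ℝ (Fin ny)) (N : ℕ) :
    Integrable (fun ω => meanSquareError g N (simulate f v (extendNoise fun i => e i ω) y₀) v)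
      P := by
  obtain ⟨C, lam, β, hF⟩ := h.exists_isForgetting hf he hi hid hL2 hst hv y₀
  exact (integrable_finsetSum _ fun k _ =>
    (hF.memLp he k).integrable_norm_pow two_ne_zero).const_mul _

end IsStableFunctional

variable {Ω : Type*} {mΩ : MeasurableSpace Ω} {P : Measure Ω} [IsProbabilityMeasure P]
  {f : Regressor na nb ny nu → EuclideanSpace ℝ (Fin ny)}
  {v : ℤ → EuclideanSpace ℝ (Fin nu)} {e : ℕ → Ω → EuclideanSpace ℝ (Fin ny)}

/-- The outputs are square integrable and have bounded averaged power. -/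
theorem exists_sum_integral_norm_sq_simulate_le (hf : Measurable f)
    (he : ∀ i, Measurable (e i)) (hi : iIndepFun e P)
    (hid : ∀ i, IdentDistrib (e i) (e 0) P P) (hL2 : MemLp (e 0) 2 P)
    (hst : ∃ C lam : ℝ, 0 ≤ C ∧ 0 ≤ lam ∧ lam < 1 ∧ MeanSquareStable f v e P C lam)
    (hv : ∃ l, Tendsto (fun N : ℕ => (N : ℝ)⁻¹ * ∑ k ∈ Finset.range N, ‖v k‖ ^ 2) atTop (𝓝 l))
    (y₀ : ℤ → EuclideanSpace ℝ (Fin ny)) :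
    (∀ k : ℕ, Integrable (fun ω => ‖simulate f v (extendNoise fun i => e i ω) y₀ k‖ ^ 2) P) ∧
    ∃ K, ∀ N : ℕ, ∑ k ∈ Finset.range N,
      ∫ ω, ‖simulate f v (extendNoise fun i => e i ω) y₀ k‖ ^ 2 ∂P ≤ K * N := by
  obtain ⟨C, lam, β, hF⟩ := (isStableFunctional_zero (na := na) (nb := nb) (ny := ny)
    (nu := nu)).exists_isForgetting hf he hi hid hL2 hst hv y₀
  have hrw : ∀ (k : ℕ) (ω : Ω), predictionError f v y₀ (fun _ _ => 0) k (fun i => e i ω)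
      = simulate f v (extendNoise fun i => e i ω) y₀ k := fun k ω => sub_zero _
  refine ⟨fun k => ?_, ?_⟩
  · have := (hF.memLp he k).integrable_norm_pow two_ne_zero
    simpa only [hrw] using this
  · obtain ⟨K, -, hK⟩ := hF.exists_sum_sq_le
    refine ⟨K, fun N => (Finset.sum_le_sum fun k _ => ?_).trans (hK N)⟩
    have := integral_norm_sq_le (hF.memLp he k).1 (hF.nonneg_β k) (hF.size k)
    simpa only [hrw] using this

end StableFunctional

/-! ### From a fixed input to the observed record. -/

section Transfer

/-- The joint law of independent variables is the product law, for which being null means that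
almost every section is null. -/
theorem ae_prodMk_mem_of_indepFun {Ω α β : Type*} {mΩ : MeasurableSpace Ω} {P : Measure Ω}
    [IsProbabilityMeasure P] [MeasurableSpace α] [MeasurableSpace β] {A : Ω → α} {B : Ω → β}
    (hA : Measurable A) (hB : Measurable B) (hAB : IndepFun A B P) {s : Set (α × β)}
    (hs : MeasurableSet s) (h : ∀ᵐ ω ∂P, ∀ᵐ ω' ∂P, (A ω, B ω') ∈ s) :
    ∀ᵐ ω ∂P, (A ω, B ω) ∈ s := by
  have := Measure.isProbabilityMeasure_map (μ := P) hA.aemeasurable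
  have := Measure.isProbabilityMeasure_map (μ := P) hB.aemeasurable
  have hmap := (indepFun_iff_map_prod_eq_prod_map_map hA.aemeasurable hB.aemeasurable).1 hAB
  refine (ae_map_iff (p := (· ∈ s)) (hA.prodMk hB).aemeasurable hs).1 ?_
  rw [hmap]
  refine (Measure.ae_prod_mem_iff_ae_ae_mem hs).2 ?_
  have hmeas : MeasurableSet {x | ∀ᵐ y ∂P.map B, (x, y) ∈ s} := by
    have : {x | ∀ᵐ y ∂P.map B, (x, y) ∈ s} = {x | P.map B (Prod.mk x ⁻¹' sᶜ) = 0} := rfl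
    rw [this]
    exact measurable_measure_prodMk_left hs.compl (measurableSet_singleton 0)
  refine (ae_map_iff hA.aemeasurable hmeas).2 ?_
  filter_upwards [h] with ω hω
  exact (ae_map_iff hB.aemeasurable (measurable_prodMk_left hs)).2 hω

theorem ae_tendsto_sub_integral_of_indepFun {Ω α β : Type*} {mΩ : MeasurableSpace Ω}
    {P : Measure Ω} [IsProbabilityMeasure P] [MeasurableSpace α] [MeasurableSpace β] {A : Ω → α}
    {B : Ω → β} (hA : Measurable A) (hB : Measurable B) (hAB : IndepFun A B P)
    {F : ℕ → α × β → ℝ} (hF : ∀ N, Measurable (F N))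
    (h : ∀ᵐ ω ∂P, ∀ᵐ ω' ∂P, Tendsto
      (fun N => F N (A ω, B ω') - ∫ ω'', F N (A ω, B ω'') ∂P) atTop (𝓝 0)) :
    ∀ᵐ ω ∂P, Tendsto (fun N => F N (A ω, B ω) - ∫ ω', F N (A ω, B ω') ∂P) atTop (𝓝 0) := by
  have hG : ∀ N, Measurable fun z : α × β => F N z - ∫ ω', F N (z.1, B ω') ∂P := fun N => by
    have h1 : StronglyMeasurable fun x : α × Ω => F N (x.1, B x.2) :=
      ((hF N).comp (measurable_fst.prodMk (hB.comp measurable_snd))).stronglyMeasurable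
    have h2 : StronglyMeasurable fun a : α => ∫ ω', F N (a, B ω') ∂P := h1.integral_prod_right
    exact (hF N).sub (h2.measurable.comp measurable_fst)
  exact ae_prodMk_mem_of_indepFun hA hB hAB
    (s := {z | Tendsto (fun N => F N z - ∫ ω', F N (z.1, B ω') ∂P) atTop (𝓝 0)})
    (measurableSet_tendsto _ hG) h

variable {na nb ny nu : ℕ}

/-- The record with outputs `b 0, …, b (n_a - 1)` at the times `-1, …, -n_a`. -/
noncomputable def initialOutputs (b : Fin na → EuclideanSpace ℝ (Fin ny)) (i : ℤ) :
    EuclideanSpace ℝ (Fin ny) :=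
  if h : (-1 - i).toNat < na then b ⟨(-1 - i).toNat, h⟩ else 0

theorem initialOutputs_apply (y : ℤ → EuclideanSpace ℝ (Fin ny)) {i : ℤ} (h : -(na : ℤ) ≤ i)
    (hi : i < 0) : initialOutputs (fun j : Fin na => y (-1 - (j.val : ℤ))) i = y i := by
  have hlt : (-1 - i).toNat < na := by omega
  rw [initialOutputs, dif_pos hlt]
  congr 1
  simp only
  omega

theorem measurable_initialOutputs (i : ℤ) :
    Measurable fun b : Fin na → EuclideanSpace ℝ (Fin ny) => initialOutputs b i := by
  unfold initialOutputs
  split_ifs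
  · exact measurable_pi_apply _
  · exact measurable_const

variable {Ω : Type*} [MeasurableSpace Ω] {P : Measure Ω} [IsProbabilityMeasure P]
  {f : Regressor na nb ny nu → EuclideanSpace ℝ (Fin ny)}
  {u : ℤ → Ω → EuclideanSpace ℝ (Fin nu)} {e y : ℤ → Ω → EuclideanSpace ℝ (Fin ny)}

/-- The limit is the trace of the correlation matrix at lag 0. -/
theorem IsQuasiStationary.tendsto_norm_sq {v : ℤ → EuclideanSpace ℝ (Fin nu)}
    (h : IsQuasiStationary v) :
    ∃ l, Tendsto (fun N : ℕ => (N : ℝ)⁻¹ * ∑ k ∈ Finset.range N, ‖v k‖ ^ 2) atTop (𝓝 l) := by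
  obtain ⟨R, hR⟩ := h 0
  refine ⟨∑ a, R a a, (tendsto_finsetSum Finset.univ fun a _ => hR a a).congr fun N => ?_⟩
  rw [← Finset.mul_sum, Finset.sum_comm]
  congr 1
  refine Finset.sum_congr rfl fun k _ => ?_
  rw [EuclideanSpace.real_norm_sq_eq]
  exact Finset.sum_congr rfl fun a _ => by simp [sq]

theorem StableSystem.ae_exists_meanSquareStable (h : StableSystem f u e P) (hf : Measurable f)
    (he : ∀ k, Measurable (e k)) :
    ∀ᵐ ω ∂P, ∃ C lam : ℝ, 0 ≤ C ∧ 0 ≤ lam ∧ lam < 1 ∧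
      MeanSquareStable f (fun i => u i ω) (fun k : ℕ => e k) P C lam := by
  obtain ⟨C, lam, hC, h0, h1, hst⟩ := h 2 two_pos
  filter_upwards [hst] with ω hω
  refine exists_meanSquareStable hf (fun k => he k) hC h0 h1 fun k₀ x₀ x₁ hx m => ?_
  refine lt_of_eq_of_lt (lintegral_congr fun ω' => ?_) (hω k₀ x₀ x₁ hx m)
  have hcongr : ∀ x : Regressor na nb ny nu,
      outputFrom f (fun i => u i ω) (extendNoise fun i : ℕ => e i ω') k₀ x m
        = outputFrom f (fun i => u i ω) (fun i => e i ω') k₀ x m := fun x =>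
    outputFrom_congr fun i _ => by
      have := extendNoise_natCast (fun i : ℕ => e i ω') (k₀ + i)
      push_cast at this
      exact this
  rw [hcongr, hcongr]

theorem simulate_extendNoise (v : ℤ → EuclideanSpace ℝ (Fin nu))
    (w y₀ : ℤ → EuclideanSpace ℝ (Fin ny)) (k : ℤ) :
    simulate f v (extendNoise fun i : ℕ => w i) y₀ k = simulate f v w y₀ k :=
  simulate_congr fun _ _ => rfl

theorem IsWhiteNoise.iIndepFun_natCast (he : IsWhiteNoise e P) :
    iIndepFun (fun k : ℕ => e k) P :=
  he.indep.precomp Nat.cast_injective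

theorem IsStableFunctional.measurable_meanSquareError_simulate_initialOutputs
    {g : ℕ → (ℤ → EuclideanSpace ℝ (Fin ny)) → (ℤ → EuclideanSpace ℝ (Fin nu)) →
      EuclideanSpace ℝ (Fin ny)} {Cg mu : ℝ} (hg : IsStableFunctional na nb g Cg mu)
    (hf : Measurable f) (N : ℕ) :
    Measurable fun z : ((ℤ → EuclideanSpace ℝ (Fin nu)) × (Fin na → EuclideanSpace ℝ (Fin ny))) ×
      (ℕ → EuclideanSpace ℝ (Fin ny)) =>
        meanSquareError g N (simulate f z.1.1 (extendNoise z.2) (initialOutputs z.1.2)) z.1.1 := by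
  have hv : ∀ k : ℤ, Measurable fun z : ((ℤ → EuclideanSpace ℝ (Fin nu)) ×
      (Fin na → EuclideanSpace ℝ (Fin ny))) × (ℕ → EuclideanSpace ℝ (Fin ny)) => z.1.1 k :=
    fun k => (measurable_pi_apply k).comp (measurable_fst.comp measurable_fst)
  have hw : ∀ k : ℤ, Measurable fun z : ((ℤ → EuclideanSpace ℝ (Fin nu)) ×
      (Fin na → EuclideanSpace ℝ (Fin ny))) × (ℕ → EuclideanSpace ℝ (Fin ny)) =>
        extendNoise z.2 k := fun k => (measurable_pi_apply _).comp measurable_snd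
  have hb : ∀ k : ℤ, Measurable fun z : ((ℤ → EuclideanSpace ℝ (Fin nu)) ×
      (Fin na → EuclideanSpace ℝ (Fin ny))) × (ℕ → EuclideanSpace ℝ (Fin ny)) =>
        initialOutputs z.1.2 k :=
    fun k => (measurable_initialOutputs k).comp (measurable_snd.comp measurable_fst)
  exact hg.measurable_meanSquareError N (measurable_simulate hf hv hw hb) hv

/-- The mean square error along the observed record is close to its expectation over the noise. -/
theorem ae_tendsto_meanSquareError_sub (hf : Measurable f) (hu : ∀ k, Measurable (u k))
    (he : IsWhiteNoise e P) (hy : ∀ k, Measurable (y k))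
    (hsys : ∀ᵐ ω ∂P, ∀ k : ℤ, 0 ≤ k →
      y k ω = f (regressor na nb (fun i => y i ω) (fun i => u i ω) k) + e k ω)
    (hind : IndepFun
      (fun ω => ((fun k : ℤ => u k ω), (fun i : Fin na => y (-1 - (i.val : ℤ)) ω)))
      (fun ω => (fun k : ℕ => e (k : ℤ) ω)) P)
    (hqs : ∀ᵐ ω ∂P, IsQuasiStationary (fun k => u k ω)) (hstab : StableSystem f u e P)
    {g : ℕ → (ℤ → EuclideanSpace ℝ (Fin ny)) → (ℤ → EuclideanSpace ℝ (Fin nu)) →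
      EuclideanSpace ℝ (Fin ny)} {Cg mu : ℝ} (hg : IsStableFunctional na nb g Cg mu) :
    ∀ᵐ ω ∂P, Tendsto (fun N : ℕ =>
      meanSquareError g N (fun i => y i ω) (fun i => u i ω)
        - ∫ ω', meanSquareError g N
            (simulate f (fun i => u i ω) (fun i => e i ω') (fun i => y i ω)) (fun i => u i ω) ∂P)
      atTop (𝓝 0) := by
  set A : Ω → (ℤ → EuclideanSpace ℝ (Fin nu)) × (Fin na → EuclideanSpace ℝ (Fin ny)) :=
    fun ω => ((fun k : ℤ => u k ω), (fun i : Fin na => y (-1 - (i.val : ℤ)) ω)) with hAdef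
  set B : Ω → ℕ → EuclideanSpace ℝ (Fin ny) := fun ω k => e (k : ℤ) ω with hBdef
  have hA : Measurable A :=
    (measurable_pi_lambda _ hu).prodMk (measurable_pi_lambda _ fun i => hy _)
  have hB : Measurable B := measurable_pi_lambda _ fun k => he.measurable k
  have hm := fun N => hg.measurable_meanSquareError_simulate_initialOutputs hf N
  -- For almost every realization of the input and the initial outputs, the law holds for almost
  -- every independent noise realization. Independence then allows the realized noise itself to be
  -- inserted.
  have hmain := ae_tendsto_sub_integral_of_indepFun hA hB hind hm (by
    filter_upwards [hqs, hstab.ae_exists_meanSquareStable hf he.measurable] with ω h1 h2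
    exact hg.ae_tendsto_meanSquareError_sub_integral (y₀ := initialOutputs (A ω).2) hf
      (fun k => he.measurable k) he.iIndepFun_natCast (fun k => he.identDistrib k) he.memLp h2
      h1.tendsto_norm_sq)
  filter_upwards [hmain, hsys] with ω h1 h2
  -- Outputs before -n_a are not covered by the independence assumption; they influence neither the
  -- simulation from -n_a on nor the functional, so they may be replaced by 0.
  have hsim : ∀ (w : ℤ → EuclideanSpace ℝ (Fin ny)) (i : ℤ), -(na : ℤ) ≤ i →
      simulate f (fun i => u i ω) (extendNoise fun i : ℕ => w i) (initialOutputs (A ω).2) i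
        = simulate f (fun i => u i ω) w (fun i => y i ω) i := fun w i hi => by
    rw [simulate_extendNoise]
    exact simulate_congr_initial (fun i hi hi' => initialOutputs_apply (fun i => y i ω) hi hi') hi
  refine h1.congr fun N => ?_
  congr 1
  · refine hg.meanSquareError_congr N _ fun i hi => ?_
    exact (hsim (fun i => e i ω) i hi).trans (simulate_eq_self h2 i)
  · refine integral_congr_ae (Eventually.of_forall fun ω' => ?_)
    exact hg.meanSquareError_congr N _ fun i hi => hsim (fun i => e i ω') i hi

end Transfer

/-! ### Equicontinuity in the parameter, uniform in the record length. -/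

section Equicontinuity

/-- A locally equicontinuous sequence on a compact set that tends to zero on a dense subset tends
to zero uniformly. -/
theorem tendstoUniformlyOn_zero_of_dense {α : Type*} [TopologicalSpace α] {K D : Set α}
    (hK : IsCompact K) (hDK : D ⊆ K) (hD : K ⊆ closure D) {G : ℕ → α → ℝ}
    (hG : ∀ θ ∈ D, Tendsto (fun N => G N θ) atTop (𝓝 0))
    (heq : ∀ θ₀ ∈ K, ∀ ε > 0, ∀ᶠ θ in 𝓝 θ₀, θ ∈ K → ∀ N, |G N θ - G N θ₀| ≤ ε) :
    TendstoUniformlyOn G (fun _ => 0) atTop K := by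
  rw [Metric.tendstoUniformlyOn_iff]
  intro ε hε
  have hε4 : 0 < ε / 4 := by positivity
  obtain ⟨t, ht⟩ := hK.elim_nhds_subcover'
    (fun θ _ => interior {θ' | θ' ∈ K → ∀ N, |G N θ' - G N θ| ≤ ε / 4})
    (fun θ hθ => interior_mem_nhds.2 (heq θ hθ _ hε4))
  -- A nearby point of the dense set transfers its eventual smallness by equicontinuity; ε/4 is
  -- spent on each, and a further ε/4 on the finite subcover.
  have hd : ∀ θ : K, ∀ᶠ N in atTop, |G N θ| < ε / 2 := fun θ => by
    obtain ⟨d, hd1, hd2⟩ := mem_closure_iff_nhds.1 (hD θ.2) _ (heq θ θ.2 _ hε4)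
    filter_upwards [(hG d hd2).eventually (Metric.ball_mem_nhds 0 hε4)] with N hN
    have e1 := hd1 (hDK hd2) N
    rw [dist_zero_right, Real.norm_eq_abs] at hN
    rw [abs_sub_comm] at e1
    have e2 := abs_add_le (G N θ - G N d) (G N d)
    rw [sub_add_cancel] at e2
    linarith
  filter_upwards [(Filter.eventually_all_finset t).2 fun θ _ => hd θ] with N hN θ hθ
  obtain ⟨θ₀, h0, h1⟩ := Set.mem_iUnion₂.1 (ht hθ)
  have e1 := interior_subset h1 hθ N
  have e2 := abs_add_le (G N θ - G N θ₀) (G N θ₀)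
  rw [sub_add_cancel] at e2
  rw [dist_zero_left, Real.norm_eq_abs]
  linarith [hN θ₀ h0]

variable {na nb ny nu p q : ℕ}

section MeanSquareError

variable {g g' : ℕ → (ℤ → EuclideanSpace ℝ (Fin ny)) → (ℤ → EuclideanSpace ℝ (Fin nu)) →
  EuclideanSpace ℝ (Fin ny)} {C mu c : ℝ}

theorem IsStableFunctional.norm_sub_le (h : IsStableFunctional na nb g C mu) (k : ℕ)
    (y : ℤ → EuclideanSpace ℝ (Fin ny)) (u : ℤ → EuclideanSpace ℝ (Fin nu)) :
    ‖y k - g k y u‖ ≤ (1 + C) * (1 + discountedDist na nb mu k y 0 u 0) := by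
  have e1 := h.norm_le k y u
  have e2 := norm_le_discountedDist (na := na) (nb := nb) h.mu_nonneg k y u
  linarith [_root_.norm_sub_le (y k) (g k y u)]

/-- Factor each difference of squares as difference times sum: the difference carries the small
constant c, and both factors are of order 1 plus the discounted size of the record. -/
theorem abs_meanSquareError_sub_le (h : IsStableFunctional na nb g C mu)
    (h' : IsStableFunctional na nb g' C mu) (hc : 0 ≤ c)
    (y : ℤ → EuclideanSpace ℝ (Fin ny)) (u : ℤ → EuclideanSpace ℝ (Fin nu))
    (hgg : ∀ k, ‖g k y u - g' k y u‖ ≤ c * (1 + discountedDist na nb mu k y 0 u 0)) (N : ℕ) :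
    |meanSquareError g N y u - meanSquareError g' N y u|
      ≤ c * (2 * (1 + C) * (2 * (1 + initialSize na nb y u) ^ 2
        + 4 * (1 - mu)⁻¹ ^ 2 * ((N : ℝ)⁻¹ * ∑ i ∈ Finset.range N, ‖u i‖ ^ 2
          + (N : ℝ)⁻¹ * ∑ i ∈ Finset.range N, ‖y i‖ ^ 2))) := by
  have hC := h.nonneg_C
  have hk : ∀ k : ℕ, |‖y k - g k y u‖ ^ 2 - ‖y k - g' k y u‖ ^ 2|
      ≤ c * (2 * (1 + C)) * (1 + discountedDist na nb mu k y 0 u 0) ^ 2 := fun k => by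
    have hΓ := discountedDist_nonneg (na := na) (nb := nb) h.mu_nonneg k y 0 u 0
    have e1 : |‖y k - g k y u‖ - ‖y k - g' k y u‖|
        ≤ c * (1 + discountedDist na nb mu k y 0 u 0) := by
      refine (abs_norm_sub_norm_le _ _).trans ?_
      rw [sub_sub_sub_cancel_left, norm_sub_rev]
      exact hgg k
    have e2 : ‖y k - g k y u‖ + ‖y k - g' k y u‖
        ≤ 2 * (1 + C) * (1 + discountedDist na nb mu k y 0 u 0) := by
      linarith [h.norm_sub_le k y u, h'.norm_sub_le k y u]
    rw [sq_sub_sq, abs_mul, abs_of_nonneg (add_nonneg (norm_nonneg _) (norm_nonneg _))]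
    calc _ ≤ 2 * (1 + C) * (1 + discountedDist na nb mu k y 0 u 0)
          * (c * (1 + discountedDist na nb mu k y 0 u 0)) := by gcongr
      _ = _ := by ring
  have hN : (N : ℝ)⁻¹ * N ≤ 1 := inv_mul_le_one
  unfold meanSquareError
  rw [← mul_sub, ← Finset.sum_sub_distrib, abs_mul, abs_of_nonneg (by positivity)]
  have hI := sq_nonneg (1 + initialSize na nb y u)
  calc (N : ℝ)⁻¹ * |∑ k ∈ Finset.range N, (‖y k - g k y u‖ ^ 2 - ‖y k - g' k y u‖ ^ 2)|
      ≤ (N : ℝ)⁻¹ * ∑ k ∈ Finset.range N, c * (2 * (1 + C))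
          * (1 + discountedDist na nb mu k y 0 u 0) ^ 2 := by
        gcongr
        exact (Finset.abs_sum_le_sum_abs _ _).trans (Finset.sum_le_sum fun k _ => hk k)
    _ ≤ (N : ℝ)⁻¹ * (c * (2 * (1 + C)) * (2 * (1 + initialSize na nb y u) ^ 2 * N
        + 4 * (1 - mu)⁻¹ ^ 2 * (∑ i ∈ Finset.range N, ‖u i‖ ^ 2
          + ∑ i ∈ Finset.range N, ‖y i‖ ^ 2))) := by
        rw [← Finset.mul_sum]
        gcongr
        exact sum_one_add_discountedDist_sq_le h.mu_nonneg h.mu_lt_one y u N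
    _ = c * (2 * (1 + C) * (2 * (1 + initialSize na nb y u) ^ 2 * ((N : ℝ)⁻¹ * N)
        + 4 * (1 - mu)⁻¹ ^ 2 * ((N : ℝ)⁻¹ * ∑ i ∈ Finset.range N, ‖u i‖ ^ 2
          + (N : ℝ)⁻¹ * ∑ i ∈ Finset.range N, ‖y i‖ ^ 2))) := by ring
    _ ≤ _ := by
        refine mul_le_mul_of_nonneg_left ?_ hc
        have := mul_le_of_le_one_right (mul_nonneg zero_le_two hI) hN
        have hp : 0 ≤ 2 * (1 + C) := by positivity
        exact mul_le_mul_of_nonneg_left (by linarith) hp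

variable {Ω : Type*} {mΩ : MeasurableSpace Ω} {P : Measure Ω} [IsProbabilityMeasure P]

theorem integral_const_add_of_integrable {F : Ω → ℝ} (hF : Integrable F P) (a : ℝ) :
    ∫ ω, (a + F ω) ∂P = a + ∫ ω, F ω ∂P := by
  rw [integral_add (integrable_const a) hF]
  simp

/-- The pathwise estimate integrated. The size of the record before time 0 is kept constant because
those outputs are held fixed under the expectation. -/
theorem abs_integral_meanSquareError_sub_le (h : IsStableFunctional na nb g C mu)
    (h' : IsStableFunctional na nb g' C mu) (hc : 0 ≤ c)
    {Y : Ω → ℤ → EuclideanSpace ℝ (Fin ny)} (u : ℤ → EuclideanSpace ℝ (Fin nu)) {I : ℝ}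
    (hI : ∀ ω, initialSize na nb (Y ω) u = I)
    (hY : ∀ k : ℕ, Integrable (fun ω => ‖Y ω k‖ ^ 2) P) (N : ℕ)
    (hg : Integrable (fun ω => meanSquareError g N (Y ω) u) P)
    (hg' : Integrable (fun ω => meanSquareError g' N (Y ω) u) P)
    (hgg : ∀ k y, ‖g k y u - g' k y u‖ ≤ c * (1 + discountedDist na nb mu k y 0 u 0)) :
    |∫ ω, meanSquareError g N (Y ω) u ∂P - ∫ ω, meanSquareError g' N (Y ω) u ∂P|
      ≤ c * (2 * (1 + C) * (2 * (1 + I) ^ 2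
        + 4 * (1 - mu)⁻¹ ^ 2 * ((N : ℝ)⁻¹ * ∑ i ∈ Finset.range N, ‖u i‖ ^ 2
          + (N : ℝ)⁻¹ * ∑ i ∈ Finset.range N, ∫ ω, ‖Y ω i‖ ^ 2 ∂P))) := by
  have hS : Integrable (fun ω => (N : ℝ)⁻¹ * ∑ i ∈ Finset.range N, ‖Y ω i‖ ^ 2) P :=
    (integrable_finsetSum _ fun i _ => hY i).const_mul _
  have hS1 : Integrable (fun ω => (N : ℝ)⁻¹ * ∑ i ∈ Finset.range N, ‖u i‖ ^ 2
      + (N : ℝ)⁻¹ * ∑ i ∈ Finset.range N, ‖Y ω i‖ ^ 2) P := (integrable_const _).add hS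
  have hS2 : Integrable (fun ω => 2 * (1 + I) ^ 2
      + 4 * (1 - mu)⁻¹ ^ 2 * ((N : ℝ)⁻¹ * ∑ i ∈ Finset.range N, ‖u i‖ ^ 2
          + (N : ℝ)⁻¹ * ∑ i ∈ Finset.range N, ‖Y ω i‖ ^ 2)) P := (integrable_const _).add (hS1.const_mul _)
  rw [← integral_sub hg hg']
  refine (abs_integral_le_integral_abs).trans ?_
  refine (integral_mono (hg.sub hg').abs ((hS2.const_mul (2 * (1 + C))).const_mul c)
    fun ω => ?_).trans (le_of_eq ?_)
  · have := abs_meanSquareError_sub_le h h' hc (Y ω) u (fun k => hgg k (Y ω)) N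
    rwa [hI] at this
  · rw [integral_const_mul, integral_const_mul, integral_const_add_of_integrable, integral_const_mul,
      integral_const_add_of_integrable, integral_const_mul, integral_finsetSum _ fun i _ => hY i]
    · exact hS
    · exact hS1.const_mul _

end MeanSquareError

section Predictor

variable {γ : OneStepPredictor na nb ny nu p q} {Θ' : Set (Param p q)} {C mu : ℝ}

theorem OneStepPredictor.eval_congr (γ : OneStepPredictor na nb ny nu p q) (k : ℕ)
    {y y' : ℤ → EuclideanSpace ℝ (Fin ny)} (u : ℤ → EuclideanSpace ℝ (Fin nu)) (θ : Param p q)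
    (h : ∀ i, -(na : ℤ) ≤ i → y i = y' i) : γ.eval k y u θ = γ.eval k y' u θ := by
  unfold OneStepPredictor.eval
  congr 1
  exact funext fun i => h i i.2.1

/-- Near `θ₀`, the predictor depends on the parameter uniformly in time, up to the discounted
size of the data. -/
theorem OneStepPredictor.exists_modulus (hΘ' : IsOpen Θ') (hC : 0 ≤ C) (hmu : 0 ≤ mu)
    (hdiff : ∀ (k : ℕ) (y : ℤ → EuclideanSpace ℝ (Fin ny)) (u : ℤ → EuclideanSpace ℝ (Fin nu)),
      ∀ θ ∈ Θ', DifferentiableAt ℝ (γ.eval k y u) θ)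
    (hderiv : ∀ k, ∀ θ ∈ Θ', ∀ (y y' : ℤ → EuclideanSpace ℝ (Fin ny))
      (u u' : ℤ → EuclideanSpace ℝ (Fin nu)),
      ‖fderiv ℝ (γ.eval k y u) θ - fderiv ℝ (γ.eval k y' u') θ‖
        ≤ C * discountedDist na nb mu k y y' u u')
    (hzero : ∀ k, ∀ θ ∈ Θ', γ.eval k 0 0 θ = γ.eval 0 0 0 θ) {θ₀ : Param p q} (hθ₀ : θ₀ ∈ Θ') :
    ∃ κ : Param p q → ℝ, Tendsto κ (𝓝 θ₀) (𝓝 0) ∧ (∀ θ, 0 ≤ κ θ) ∧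
      ∀ᶠ θ in 𝓝 θ₀, ∀ k y u, ‖γ.eval k y u θ - γ.eval k y u θ₀‖
        ≤ κ θ * (1 + discountedDist na nb mu k y 0 u 0) := by
  refine ⟨fun θ => ‖γ.eval 0 0 0 θ - γ.eval 0 0 0 θ₀‖ + C * ‖θ - θ₀‖, ?_, fun θ => by positivity, ?_⟩
  · have h1 := (tendsto_iff_norm_sub_tendsto_zero.1 (hdiff 0 0 0 θ₀ hθ₀).continuousAt.tendsto)
    have h2 : Tendsto (fun θ => ‖θ - θ₀‖) (𝓝 θ₀) (𝓝 0) :=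
      tendsto_iff_norm_sub_tendsto_zero.1 tendsto_id
    simpa using h1.add (h2.const_mul C)
  · obtain ⟨δ, hδ, hball⟩ := Metric.isOpen_iff.1 hΘ' θ₀ hθ₀
    filter_upwards [Metric.ball_mem_nhds θ₀ hδ] with θ hθ k y u
    have hΓ := discountedDist_nonneg (na := na) (nb := nb) hmu k y 0 u 0
    -- The derivative itself is not bounded by assumption, only its difference from the derivative
    -- at the zero record. The mean value inequality is therefore applied to this difference.
    have hmv := (convex_ball θ₀ δ).norm_image_sub_le_of_norm_fderiv_le (𝕜 := ℝ)
      (f := fun θ => γ.eval k y u θ - γ.eval k 0 0 θ)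
      (C := C * discountedDist na nb mu k y 0 u 0)
      (fun x hx => (hdiff k y u x (hball hx)).sub (hdiff k 0 0 x (hball hx)))
      (fun x hx => by
        rw [fderiv_fun_sub (hdiff k y u x (hball hx)) (hdiff k 0 0 x (hball hx))]
        exact hderiv k x (hball hx) y 0 u 0)
      (Metric.mem_ball_self hδ) hθ
    -- The zero-record part is the same for every k, so continuity of the single map at k = 0 gives
    -- a modulus uniform in time.
    have hsplit : γ.eval k y u θ - γ.eval k y u θ₀
        = ((γ.eval k y u θ - γ.eval k 0 0 θ) - (γ.eval k y u θ₀ - γ.eval k 0 0 θ₀))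
          + (γ.eval 0 0 0 θ - γ.eval 0 0 0 θ₀) := by
      rw [hzero k θ (hball hθ), hzero k θ₀ hθ₀]; abel
    rw [hsplit]
    refine (norm_add_le _ _).trans ?_
    have e1 := mul_nonneg hC (norm_nonneg (θ - θ₀))
    have e2 := mul_nonneg (norm_nonneg (γ.eval 0 0 0 θ - γ.eval 0 0 0 θ₀)) hΓ
    nlinarith

end Predictor

end Equicontinuity

/-! ### Uniform Lipschitz dependence of the costs on the predictor. -/

section Convergence

variable {na nb ny nu p q : ℕ} {Ω : Type*} [MeasurableSpace Ω] {P : Measure Ω}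
  [IsProbabilityMeasure P] {f : Regressor na nb ny nu → EuclideanSpace ℝ (Fin ny)}
  {u : ℤ → Ω → EuclideanSpace ℝ (Fin nu)} {e y : ℤ → Ω → EuclideanSpace ℝ (Fin ny)}

theorem initialSize_simulate (v : ℤ → EuclideanSpace ℝ (Fin nu))
    (w y₀ : ℤ → EuclideanSpace ℝ (Fin ny)) :
    initialSize na nb (simulate f v w y₀) v = initialSize na nb y₀ v := by
  refine Finset.sum_congr rfl fun i hi => ?_
  rw [simulate_of_neg _ (by have := (Finset.mem_Icc.1 hi).2; omega)]

theorem meanSquareError_zero (N : ℕ) (y : ℤ → EuclideanSpace ℝ (Fin ny))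
    (v : ℤ → EuclideanSpace ℝ (Fin nu)) :
    meanSquareError (fun _ _ _ => 0) N y v = (N : ℝ)⁻¹ * ∑ i ∈ Finset.range N, ‖y i‖ ^ 2 := by
  simp [meanSquareError]

/-- Almost surely, the mean square error and its expectation over the noise depend on the data
functional in a Lipschitz way, uniformly in the record length. -/
theorem ae_exists_forall_abs_meanSquareError_sub_le (hf : Measurable f)
    (hu : ∀ k, Measurable (u k)) (he : IsWhiteNoise e P) (hy : ∀ k, Measurable (y k))
    (hsys : ∀ᵐ ω ∂P, ∀ k : ℤ, 0 ≤ k →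
      y k ω = f (regressor na nb (fun i => y i ω) (fun i => u i ω) k) + e k ω)
    (hind : IndepFun
      (fun ω => ((fun k : ℤ => u k ω), (fun i : Fin na => y (-1 - (i.val : ℤ)) ω)))
      (fun ω => (fun k : ℕ => e (k : ℤ) ω)) P)
    (hqs : ∀ᵐ ω ∂P, IsQuasiStationary (fun k => u k ω)) (hstab : StableSystem f u e P)
    {C mu : ℝ} (hC : 0 ≤ C) :
    ∀ᵐ ω ∂P, ∃ M, 0 ≤ M ∧ ∀ g g' : ℕ → (ℤ → EuclideanSpace ℝ (Fin ny)) →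
        (ℤ → EuclideanSpace ℝ (Fin nu)) → EuclideanSpace ℝ (Fin ny),
      IsStableFunctional na nb g C mu → IsStableFunctional na nb g' C mu → ∀ c, 0 ≤ c →
      (∀ k y u, ‖g k y u - g' k y u‖ ≤ c * (1 + discountedDist na nb mu k y 0 u 0)) → ∀ N,
      |meanSquareError g N (fun i => y i ω) (fun i => u i ω)
        - meanSquareError g' N (fun i => y i ω) (fun i => u i ω)| ≤ c * M ∧
      |∫ ω', meanSquareError g N
          (simulate f (fun i => u i ω) (fun i => e i ω') (fun i => y i ω)) (fun i => u i ω) ∂P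
        - ∫ ω', meanSquareError g' N
          (simulate f (fun i => u i ω) (fun i => e i ω') (fun i => y i ω)) (fun i => u i ω) ∂P|
        ≤ c * M := by
  -- Applied to the zero functional, the law keeps the average power of the observed outputs within
  -- a bounded distance of its expectation, and that expectation is bounded.
  have h0 := ae_tendsto_meanSquareError_sub hf hu he hy hsys hind hqs hstab
    (isStableFunctional_zero (na := na) (nb := nb))
  filter_upwards [h0, hqs, hstab.ae_exists_meanSquareStable hf he.measurable] with ω h0 hq hst
  have hv := hq.tendsto_norm_sq
  have hsim : ∀ ω', simulate f (fun i => u i ω) (extendNoise fun i : ℕ => e i ω')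
      (fun i => y i ω) = simulate f (fun i => u i ω) (fun i => e i ω') (fun i => y i ω) :=
    fun ω' => funext fun k => simulate_extendNoise _ (fun i => e i ω') _ k
  obtain ⟨hint, K, hK⟩ := exists_sum_integral_norm_sq_simulate_le hf (fun k => he.measurable k)
    he.iIndepFun_natCast (fun k => he.identDistrib k) he.memLp hst hv (fun i => y i ω)
  simp only [hsim] at hint hK
  obtain ⟨l, hl⟩ := hv
  obtain ⟨Ku, hKu⟩ := (Metric.isBounded_range_of_tendsto _ hl).exists_norm_le
  obtain ⟨Ky, hKy⟩ := (Metric.isBounded_range_of_tendsto _ h0).exists_norm_le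
  have hu1 : ∀ N : ℕ, (N : ℝ)⁻¹ * ∑ i ∈ Finset.range N, ‖u i ω‖ ^ 2 ≤ Ku := fun N =>
    (le_abs_self _).trans (hKu _ ⟨N, rfl⟩)
  have hE : ∀ N : ℕ, (N : ℝ)⁻¹ * ∑ k ∈ Finset.range N, ∫ ω', ‖simulate f (fun i => u i ω)
      (fun i => e i ω') (fun i => y i ω) k‖ ^ 2 ∂P ≤ |K| := fun N => by
    calc _ ≤ (N : ℝ)⁻¹ * (|K| * N) := by
          gcongr
          exact (hK N).trans (mul_le_mul_of_nonneg_right (le_abs_self K) (by positivity))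
      _ = |K| * ((N : ℝ)⁻¹ * N) := by ring
      _ ≤ |K| := mul_le_of_le_one_right (abs_nonneg K) inv_mul_le_one
  have hy1 : ∀ N : ℕ, (N : ℝ)⁻¹ * ∑ i ∈ Finset.range N, ‖y i ω‖ ^ 2 ≤ |K| + Ky := fun N => by
    have e1 := (le_abs_self _).trans (hKy _ ⟨N, rfl⟩)
    simp only [meanSquareError_zero] at e1
    rw [integral_const_mul, integral_finsetSum _ fun i _ => hint i] at e1
    linarith [hE N]
  have hKy0 : 0 ≤ Ky := (norm_nonneg _).trans (hKy _ ⟨0, rfl⟩)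
  have hKu0 : 0 ≤ Ku := (norm_nonneg _).trans (hKu _ ⟨0, rfl⟩)
  set I := initialSize na nb (fun i => y i ω) (fun i => u i ω) with hI
  refine ⟨2 * (1 + C) * (2 * (1 + I) ^ 2 + 4 * (1 - mu)⁻¹ ^ 2 * (Ku + (|K| + Ky))),
    by positivity, fun g g' hg hg' c hc hgg N => ⟨?_, ?_⟩⟩
  · refine (abs_meanSquareError_sub_le hg hg' hc (fun i => y i ω) (fun i => u i ω)
      (fun k => hgg k _ _) N).trans ?_
    gcongr
    · exact hu1 N
    · exact hy1 N
  · have hgi : ∀ {g}, IsStableFunctional na nb g C mu → Integrable (fun ω' => meanSquareError g N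
        (simulate f (fun i => u i ω) (fun i => e i ω') (fun i => y i ω)) (fun i => u i ω)) P :=
      fun hg => by
        have := hg.integrable_meanSquareError hf (fun k : ℕ => he.measurable k)
          he.iIndepFun_natCast (fun k => he.identDistrib k) he.memLp hst ⟨l, hl⟩
          (fun i => y i ω) N
        simpa only [hsim] using this
    refine (abs_integral_meanSquareError_sub_le hg hg' hc (fun i => u i ω) (I := I)
      (fun ω' => initialSize_simulate _ _ _) hint N (hgi hg) (hgi hg')
      (fun k y => hgg k y _)).trans ?_
    gcongr
    · exact hu1 N
    · linarith [hE N]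

theorem regressor_zero (k : ℤ) :
    regressor na nb (0 : ℤ → EuclideanSpace ℝ (Fin ny)) (0 : ℤ → EuclideanSpace ℝ (Fin nu)) k
      = 0 := by
  ext i
  rcases i with ⟨i, c⟩ | ⟨i, c⟩ <;> simp [regressor]

end Convergence

end OrthAug

/-! ### The convergence theorem. -/

theorem theorem2 {Ω : Type*} [MeasurableSpace Ω] (P : Measure Ω) [IsProbabilityMeasure P]
    {na nb ny nu p q : ℕ}
    -- the data-generating system and the signals
    (f : OrthAug.Regressor na nb ny nu → EuclideanSpace ℝ (Fin ny)) (hf : Measurable f)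
    (u : ℤ → Ω → EuclideanSpace ℝ (Fin nu)) (hu : ∀ k, Measurable (u k))
    (e : ℤ → Ω → EuclideanSpace ℝ (Fin ny)) (he : OrthAug.IsWhiteNoise e P)
    (y : ℤ → Ω → EuclideanSpace ℝ (Fin ny)) (hy : ∀ k, Measurable (y k))
    (hsys : ∀ᵐ ω ∂P, ∀ k : ℤ, 0 ≤ k →
      y k ω = f (OrthAug.regressor na nb (fun i => y i ω) (fun i => u i ω) k) + e k ω)
    -- the input and the initial outputs are independent of the noise from time 0 on
    (hind : IndepFun
      (fun ω => ((fun k : ℤ => u k ω), (fun i : Fin na => y (-1 - (i.val : ℤ)) ω)))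
      (fun ω => (fun k : ℕ => e (k : ℤ) ω)) P)
    (hqs : ∀ᵐ ω ∂P, OrthAug.IsQuasiStationary (fun k => u k ω))
    (hstab : OrthAug.StableSystem f u e P)
    -- the model structure and its one-step-ahead predictor
    (φ : OrthAug.Regressor na nb ny nu → Matrix (Fin ny) (Fin p) ℝ)
    (fANN : EuclideanSpace ℝ (Fin q) → OrthAug.Regressor na nb ny nu →
      EuclideanSpace ℝ (Fin ny))
    (S : OrthAug.PointRule na nb ny nu)
    (Θ Θ' : Set (OrthAug.Param p q)) (hΘ : IsCompact Θ) (hΘ' : IsOpen Θ') (hsub : Θ ⊆ Θ')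
    (γ : OrthAug.OneStepPredictor na nb ny nu p q)
    (hγ : ∀ N k : ℕ, k < N → ∀ θ ∈ Θ', ∀ (y' : ℤ → EuclideanSpace ℝ (Fin ny))
      (u' : ℤ → EuclideanSpace ℝ (Fin nu)),
      OrthAug.orthPrediction φ fANN S N θ y' u' k = γ.eval k y' u' θ)
    (hdiff : ∀ (k : ℕ) (y' : ℤ → EuclideanSpace ℝ (Fin ny))
      (u' : ℤ → EuclideanSpace ℝ (Fin nu)), ∀ θ ∈ Θ', DifferentiableAt ℝ (γ.eval k y' u') θ)
    (hpred : OrthAug.StablePredictor γ Θ') :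
    -- the empirical cost is uniformly close to its expectation
    (∀ᵐ ω ∂P, TendstoUniformlyOn
      (fun (N : ℕ) (θ : OrthAug.Param p q) =>
        OrthAug.cost φ fANN S N θ (fun i => y i ω) (fun i => u i ω)
          - OrthAug.expectedCost f φ fANN S e P N θ (fun i => y i ω) (fun i => u i ω))
      (fun _ => 0) atTop Θ) ∧
    -- and converges uniformly to the limit of the expectation
    (∀ Vbar : Ω → OrthAug.Param p q → ℝ,
      (∀ᵐ ω ∂P, ∀ θ ∈ Θ, Tendsto
        (fun N : ℕ =>
          OrthAug.expectedCost f φ fANN S e P N θ (fun i => y i ω) (fun i => u i ω))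
        atTop (𝓝 (Vbar ω θ))) →
      ∀ᵐ ω ∂P, TendstoUniformlyOn
        (fun (N : ℕ) (θ : OrthAug.Param p q) =>
          OrthAug.cost φ fANN S N θ (fun i => y i ω) (fun i => u i ω))
        (Vbar ω) atTop Θ) := by
  obtain ⟨C, mu, hC, h0, h1, hp⟩ := hpred
  set g : OrthAug.Param p q → ℕ → (ℤ → EuclideanSpace ℝ (Fin ny)) →
    (ℤ → EuclideanSpace ℝ (Fin nu)) → EuclideanSpace ℝ (Fin ny) :=
    fun θ k y u => γ.eval k y u θ with hg
  have hstable : ∀ θ ∈ Θ', OrthAug.IsStableFunctional na nb (g θ) C mu := fun θ hθ =>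
    ⟨hC, h0, h1, fun k => (hp k θ hθ).1, fun k => (hp k θ hθ).2.1,
      fun k y y' u h => γ.eval_congr k u θ h⟩
  have hcost : ∀ θ ∈ Θ', ∀ N y' u', OrthAug.cost φ fANN S N θ y' u'
      = OrthAug.meanSquareError (g θ) N y' u' := fun θ hθ N y' u' => by
    unfold OrthAug.cost OrthAug.meanSquareError
    congr 1
    refine Finset.sum_congr rfl fun k hk => ?_
    rw [hγ N k (Finset.mem_range.1 hk) θ hθ]
  have hexp : ∀ θ ∈ Θ', ∀ N y' u', OrthAug.expectedCost f φ fANN S e P N θ y' u'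
      = ∫ ω', OrthAug.meanSquareError (g θ) N
          (OrthAug.simulate f u' (fun i => e i ω') y') u' ∂P := fun θ hθ N y' u' =>
    integral_congr_ae (Eventually.of_forall fun ω' => hcost θ hθ N _ _)
  -- Both values are read off from the same record length N = k + 1. They then share the projection
  -- coefficient θ_aux, and on the zero record also the regressor.
  have hzero : ∀ k, ∀ θ ∈ Θ', γ.eval k 0 0 θ = γ.eval 0 0 0 θ := fun k θ hθ => by
    rw [← hγ (k + 1) k (by omega) θ hθ, ← hγ (k + 1) 0 (by omega) θ hθ]
    simp only [OrthAug.orthPrediction, OrthAug.regressor_zero]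
  have hmod : ∀ θ₀ ∈ Θ', ∃ κ : OrthAug.Param p q → ℝ, Tendsto κ (𝓝 θ₀) (𝓝 0) ∧
      (∀ θ, 0 ≤ κ θ) ∧ ∀ᶠ θ in 𝓝 θ₀, ∀ k y u, ‖γ.eval k y u θ - γ.eval k y u θ₀‖
        ≤ κ θ * (1 + OrthAug.discountedDist na nb mu k y 0 u 0) := fun θ₀ hθ₀ =>
    OrthAug.OneStepPredictor.exists_modulus hΘ' hC h0 hdiff (fun k θ hθ => (hp k θ hθ).2.2)
      hzero hθ₀
  -- The exceptional null set of the strong law depends on θ, so the law can be used simultaneously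
  -- only on a countable set.
  obtain ⟨D, hDΘ, hDc, hD⟩ := (TopologicalSpace.IsSeparable.of_separableSpace
    Θ).exists_countable_dense_subset
  have hpt : ∀ᵐ ω ∂P, ∀ θ ∈ D, Tendsto (fun N : ℕ =>
      OrthAug.cost φ fANN S N θ (fun i => y i ω) (fun i => u i ω)
        - OrthAug.expectedCost f φ fANN S e P N θ (fun i => y i ω) (fun i => u i ω))
      atTop (𝓝 0) := by
    refine (ae_ball_iff hDc).2 fun θ hθ => ?_
    have hθ' := hsub (hDΘ hθ)
    simp only [hcost θ hθ', hexp θ hθ']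
    exact OrthAug.ae_tendsto_meanSquareError_sub hf hu he hy hsys hind hqs hstab (hstable θ hθ')
  have hlip : ∀ᵐ ω ∂P, ∀ θ₀ ∈ Θ', ∀ ε > 0, ∀ᶠ θ in 𝓝 θ₀, θ ∈ Θ' → ∀ N,
      |OrthAug.cost φ fANN S N θ (fun i => y i ω) (fun i => u i ω)
        - OrthAug.cost φ fANN S N θ₀ (fun i => y i ω) (fun i => u i ω)| ≤ ε ∧
      |OrthAug.expectedCost f φ fANN S e P N θ (fun i => y i ω) (fun i => u i ω)
        - OrthAug.expectedCost f φ fANN S e P N θ₀ (fun i => y i ω) (fun i => u i ω)| ≤ ε := by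
    filter_upwards [OrthAug.ae_exists_forall_abs_meanSquareError_sub_le (mu := mu) hf hu he hy
      hsys hind hqs hstab hC] with ω hω θ₀ hθ₀ ε hε
    obtain ⟨M, hM0, hM⟩ := hω
    obtain ⟨κ, hκ, hκ0, hκb⟩ := hmod θ₀ hθ₀
    have hκM : Tendsto (fun θ => κ θ * M) (𝓝 θ₀) (𝓝 0) := by
      simpa using hκ.mul_const M
    filter_upwards [hκb, hκM.eventually_le_const hε] with θ hb hle hθ N
    have := hM (g θ) (g θ₀) (hstable θ hθ) (hstable θ₀ hθ₀) (κ θ) (hκ0 θ) hb N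
    rw [hcost θ hθ, hcost θ₀ hθ₀, hexp θ hθ, hexp θ₀ hθ₀]
    exact ⟨this.1.trans hle, this.2.trans hle⟩
  have hunif : ∀ᵐ ω ∂P, TendstoUniformlyOn
      (fun (N : ℕ) (θ : OrthAug.Param p q) =>
        OrthAug.cost φ fANN S N θ (fun i => y i ω) (fun i => u i ω)
          - OrthAug.expectedCost f φ fANN S e P N θ (fun i => y i ω) (fun i => u i ω))
      (fun _ => 0) atTop Θ := by
    filter_upwards [hpt, hlip] with ω hω hl
    refine OrthAug.tendstoUniformlyOn_zero_of_dense hΘ hDΘ hD hω fun θ₀ hθ₀ ε hε => ?_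
    filter_upwards [hl θ₀ (hsub hθ₀) (ε / 2) (half_pos hε)] with θ hθ hθΘ N
    obtain ⟨e1, e2⟩ := hθ (hsub hθΘ) N
    rw [sub_sub_sub_comm]
    refine (abs_sub _ _).trans ?_
    linarith
  refine ⟨hunif, fun Vbar hV => ?_⟩
  filter_upwards [hunif, hlip, hV] with ω hω hl hVω
  have hconv : ∀ θ ∈ Θ, Tendsto (fun N : ℕ =>
      OrthAug.cost φ fANN S N θ (fun i => y i ω) (fun i => u i ω)) atTop (𝓝 (Vbar ω θ)) :=
    fun θ hθ => by simpa using (hω.tendsto_at hθ).add (hVω θ hθ)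
  have hdiff0 : TendstoUniformlyOn (fun (N : ℕ) (θ : OrthAug.Param p q) =>
      OrthAug.cost φ fANN S N θ (fun i => y i ω) (fun i => u i ω) - Vbar ω θ)
      (fun _ => 0) atTop Θ := by
    -- Pointwise convergence to V̄ now holds on all of Θ, so Θ serves as its own dense subset; the
    -- modulus for V̄ is the limit of that of the costs.
    refine OrthAug.tendstoUniformlyOn_zero_of_dense hΘ subset_rfl subset_closure
      (fun θ hθ => tendsto_sub_nhds_zero_iff.2 (hconv θ hθ)) fun θ₀ hθ₀ ε hε => ?_
    filter_upwards [hl θ₀ (hsub hθ₀) (ε / 2) (half_pos hε)] with θ hθ hθΘ N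
    have e1 := (hθ (hsub hθΘ) N).1
    have e2 : |Vbar ω θ - Vbar ω θ₀| ≤ ε / 2 :=
      le_of_tendsto ((hconv θ hθΘ).sub (hconv θ₀ hθ₀)).abs
        (Eventually.of_forall fun N => (hθ (hsub hθΘ) N).1)
    rw [sub_sub_sub_comm]
    refine (abs_sub _ _).trans ?_
    linarith
  rw [Metric.tendstoUniformlyOn_iff] at hdiff0 ⊢
  intro ε hε
  filter_upwards [hdiff0 ε hε] with N hN θ hθ
  have := hN θ hθ
  rwa [dist_zero_left, ← dist_eq_norm, dist_comm] at this
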